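/- Let $n\ge 1$ be an integer, let $0\le\alpha<1$, and put $\langle x\rangle=\sqrt{1+|x|^2}$ and $a(x)=\langle x\rangle^{-\alpha}$ for $x\in\mathbf{R}^n$. For $\delta>0$ put $$\psi(t,x)=A\,\frac{\langle x\rangle^{2-\alpha}}{1+t},\qquad A=\frac{1}{(2-\alpha)^2(2+\delta)} .$$ *Damped wave equation.* Let $u_0,u_1\in C_0^\infty(\mathbf{R}^n)$ be real-valued and supported in $\{|x|\le L\}$ for some $L>0$. A solution of $$u_{tt}-\Delta u+a(x)u_t=0,\quad (t,x)\in(0,\infty)\times\mathbf{R}^n,\qquad (u,u_t)(0,x)=(u_0,u_1)(x) \tag{DW}$$ is a real-valued $u\in C^\infty([0,\infty)\times\mathbf{R}^n)$ satisfying these equations. For such $u$ put $$I_0=\int_{\mathbf{R}^n}e^{2\psi(0,x)}\big(u_0^2+|\nabla u_0|^2+u_1^2\big)\,dx,\qquad I_k=\int_{\mathbf{R}^n}e^{2\psi(0,x)}\big(|\partial_t^{k+1}u(0,x)|^2+|\nabla\partial_t^{k}u(0,x)|^2\big)\,dx+I_{k-1}\quad(k\ge1).$$ *Heat equation.* Let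 $\tau\ge0$ and let $v_\tau\in C_0^\infty(\mathbf{R}^n)$ be real-valued. A solution of $$a(x)v_t-\Delta v=0,\quad (t,x)\in(\tau,\infty)\times\mathbf{R}^n,\qquad v(\tau,x)=v_\tau(x) \tag{H}$$ is a real-valued $v\in C^\infty([\tau,\infty)\times\mathbf{R}^n)$ satisfying these equations and $\int_\tau^T\!\int_{\mathbf{R}^n}a(x)v(t,x)^2\,dx\,dt<\infty$ for every $T>\tau$. **Lemma 1.3.** There is $\varepsilon_0>0$, depending only on $n$ and $\alpha$, such that for every $0<\varepsilon<\varepsilon_0$ there is $\delta>0$, depending only on $n,\alpha,\varepsilon$, such that the following holds. (i) For every $L>0$ there is a constant $C>0$, depending only on $n,\alpha,\varepsilon,L$, such that for all $u_0,u_1$ as above supported in $\{|x|\le L\}$, every solution $u$ of (DW) and every $t\ge0$, the integrals on the left-hand sides below converge and $$(1+t)^{\frac{n-\alpha}{2-\alpha}+2-\varepsilon}\int_{\mathbf{R}^n}e^{2\psi(t,x)}a(x)u_t(t,x)^2\,dx\le CI_1,$$ $$(1+t)^{\frac{n-\alpha}{2-\alpha}+3-\varepsilon}\int_{\mathbf{R}^n}e^{2\psi(t,x)}|\nabla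 u_t(t,x)|^2\,dx\le CI_1,$$ $$(1+t)^{\frac{n-\alpha}{2-\alpha}+4-\varepsilon}\int_{\mathbf{R}^n}e^{2\psi(t,x)}a(x)u_{tt}(t,x)^2\,dx\le CI_2,$$ $$(1+t)^{\frac{n-\alpha}{2-\alpha}+6-\varepsilon}\int_{\mathbf{R}^n}e^{2\psi(t,x)}a(x)u_{ttt}(t,x)^2\,dx\le CI_3.$$ (ii) There is a constant $C>0$, depending only on $n,\alpha,\varepsilon$, such that for all $\tau\ge0$, all $v_\tau$ as above, every solution $v$ of (H) and every $t\ge\tau$, the integrals on the left-hand sides below converge and $$\int_{\mathbf{R}^n}a(x)|v(t,x)|^2\,dx\le\int_{\mathbf{R}^n}a(x)|v_\tau(x)|^2\,dx,$$ $$\begin{aligned}(1+t-\tau)^{\frac{n-\alpha}{2-\alpha}+2-\varepsilon}\int_{\mathbf{R}^n}a(x)|v_t(t,x)|^2\,dx&\le\int_{\mathbf{R}^n}a(x)^{-1}|\Delta v_\tau(x)|^2\,dx\\&\quad+C(1+\tau)^{\frac{n-\alpha}{2-\alpha}+1-\varepsilon}\int_{\mathbf{R}^n}e^{2\psi(\tau,x)}|\nabla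 v_\tau(x)|^2\,dx\\&\quad+C(1+\tau)^{\frac{n-\alpha}{2-\alpha}-\varepsilon}\int_{\mathbf{R}^n}e^{2\psi(\tau,x)}a(x)v_\tau(x)^2\,dx.\end{aligned}$$ -/

import Mathlib

open MeasureTheory Set
open scoped ContDiff Gradient Laplacian

noncomputable section

/-- The space `ℝⁿ` with its Euclidean norm. -/
abbrev Rn (n : ℕ) : Type := EuclideanSpace ℝ (Fin n)

/-- The bracket `⟨x⟩ = √(1 + |x|²)`. -/
def bracket {n : ℕ} (x : Rn n) : ℝ := √(1 + ‖x‖ ^ 2)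

/-- The damping coefficient `a(x) = ⟨x⟩^(-α)`. -/
def damping {n : ℕ} (α : ℝ) (x : Rn n) : ℝ := bracket x ^ (-α)

/-- The weight exponent `ψ(t,x) = A ⟨x⟩^(2-α) / (1+t)` with `A = 1 / ((2-α)² (2+δ))`. -/
def weightPsi {n : ℕ} (α δ t : ℝ) (x : Rn n) : ℝ :=
  1 / ((2 - α) ^ 2 * (2 + δ)) * (bracket x ^ (2 - α) / (1 + t))

/-- The `k`-th partial derivative in time `∂ₜᵏ w(t,x)` of a function `w` on `[τ,∞) × ℝⁿ`
(the usual derivative for `t > τ`, and the one-sided derivative at `t = τ`). -/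
def timeDeriv {n : ℕ} (τ : ℝ) (k : ℕ) (w : ℝ → Rn n → ℝ) (t : ℝ) (x : Rn n) : ℝ :=
  iteratedDerivWithin k (fun s => w s x) (Ici τ) t

/-- `u` is a smooth solution on `[0,∞) × ℝⁿ` of the Cauchy problem
`u_tt - Δu + a(x) u_t = 0` for `t > 0`, with `(u, u_t)(0,·) = (u₀, u₁)`. -/
structure IsDampedWaveSolution {n : ℕ} (α : ℝ) (u₀ u₁ : Rn n → ℝ) (u : ℝ → Rn n → ℝ) :
    Prop where
  smooth : ContDiffOn ℝ ∞ (fun p : ℝ × Rn n => u p.1 p.2) (Ici (0 : ℝ) ×ˢ univ)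
  equation : ∀ t : ℝ, 0 < t → ∀ x : Rn n,
    timeDeriv 0 2 u t x - (Δ (u t)) x + damping α x * timeDeriv 0 1 u t x = 0
  initial_value : ∀ x : Rn n, u 0 x = u₀ x
  initial_velocity : ∀ x : Rn n, timeDeriv 0 1 u 0 x = u₁ x

/-- `v` is a smooth solution on `[τ,∞) × ℝⁿ` of the Cauchy problem
`a(x) v_t - Δv = 0` for `t > τ`, with `v(τ,·) = v_τ`, in the weighted `L²` class. The
condition `finite_energy` (that is, `v ∈ L²((τ,T); L²(a dx))` for all `T`) singles out the
solution given by the heat semigroup among the solutions of the Cauchy problem, which is not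
uniquely solvable without a condition at spatial infinity. -/
structure IsHeatSolution {n : ℕ} (α τ : ℝ) (vτ : Rn n → ℝ) (v : ℝ → Rn n → ℝ) : Prop where
  smooth : ContDiffOn ℝ ∞ (fun p : ℝ × Rn n => v p.1 p.2) (Ici τ ×ˢ univ)
  equation : ∀ t : ℝ, τ < t → ∀ x : Rn n,
    damping α x * timeDeriv τ 1 v t x - (Δ (v t)) x = 0
  initial_value : ∀ x : Rn n, v τ x = vτ x
  finite_energy : ∀ T : ℝ,
    IntegrableOn (fun p : ℝ × Rn n => damping α p.2 * v p.1 p.2 ^ 2) (Icc τ T ×ˢ univ)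

/-- The weighted norms of the data:
`I₀ = ∫ e^{2ψ(0,x)} (u₀² + |∇u₀|² + u₁²) dx` and
`I_k = ∫ e^{2ψ(0,x)} (|∂ₜ^{k+1}u(0,x)|² + |∇∂ₜ^k u(0,x)|²) dx + I_{k-1}`. -/
def dataNorm {n : ℕ} (α δ : ℝ) (u₀ u₁ : Rn n → ℝ) (u : ℝ → Rn n → ℝ) : ℕ → ℝ
  | 0 => ∫ x : Rn n, Real.exp (2 * weightPsi α δ 0 x) *
      (u₀ x ^ 2 + ‖∇ u₀ x‖ ^ 2 + u₁ x ^ 2)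
  | k + 1 => (∫ x : Rn n, Real.exp (2 * weightPsi α δ 0 x) *
      (timeDeriv 0 (k + 2) u 0 x ^ 2 + ‖∇ (timeDeriv 0 (k + 1) u 0) x‖ ^ 2)) +
      dataNorm α δ u₀ u₁ u k

end

/-!
# Weighted decay of time derivatives for damped waves and the corresponding heat flow

Both parts are weighted energy estimates with the weight `(t₀+t)^q e^{2ψ}`. Three properties of
`ψ` drive them: `(2+δ)|∇ψ|² ≤ -a ∂ₜψ` (`norm_gradient_weightPsi_sq_le`), the lower bound `Δψ ≥ β
a/(1+t)` with `β = (n-α)/((2-α)(2+δ))` (`le_laplacian_weightPsi`), and the coercivity of `|∇w|²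
+ 4w∇ψ·∇w + 2|∇ψ|²w² - (∂ₜψ)aw²`, which follows from the first (`quadraticForm_coercive`). The
term with `Δψ` is produced by integrating the divergence of `e^{2ψ} w² ∇ψ`; it makes the zeroth
order term dissipative as long as the power `B` of `t` satisfies `B/2 < β`. With `N =
(n-α)/(2-α)` the choice `δ = ε/N` gives this for `B = N - ε`.

For the damped wave equation, finite speed of propagation (`IsWave.eq_zero_of_lt_norm`) confines
the solution to `|x| ≤ L + t`, where `a ≥ (t₀+t)^{-α}`. The combined multiplier `(t₀+t)^{p+α}
w_t + ν(t₀+t)^p w` then controls `∫ (t₀+t)^p e^{2ψ} a w²` and the space-time integral of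
`(t₀+t)^p e^{2ψ}|∇w|²` (`IsWave.exists_combined_estimate`), and the multiplier `(t₀+t)^{p+1}
w_t` upgrades this to decay of the energy and to a space-time bound for `(t₀+t)^{p+1} e^{2ψ} a
w_t²` (`IsWave.exists_energy_estimate`). The last bound is the hypothesis of the same step for
`w_t` with `p + 2` in place of `p` (`IsWave.exists_decay_step`). Since the coefficients do not
depend on time, `∂ₜᵏu` solves the same equation, and the step is applied to `u`, `u_t`, `u_tt`,
`u_ttt`.

For the heat equation there is no finite speed of propagation, and only the finiteness of `∬ a
v²` is known. The cutoff `logCutoff R` varies on the scale of `log ⟨x⟩`, so that `⟨x⟩|∇χ_R| =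
O(1/R)`; since `1/⟨x⟩ ≤ a` and `|∇ψ| ≤ a⟨x⟩`, all errors of the cutoff are `O(1/R)` times
integrals that are already bounded. To reach the weight `e^{2ψ}`, the bounded weights
`ψ/(1+mψ)`, which satisfy `2|∇φ|² ≤ -a ∂ₜφ` as well, are used first, and `m → 0`
(`IsHeat.cutoff_integral_exp_le`). Then follow the space-time bounds for `(1+t)^B e^{2ψ}|∇v|²`
and for `(1+t)^{B+1} e^{2ψ} a v_t²` (`IsHeat.setIntegral_gradient_le`,
`IsHeat.setIntegral_velocity_le`), and the multiplier `(1+t-τ)^{B+2} v_t` for the equation of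
`v_t` gives the decay (`IsHeat.velocity_decay`), with the initial value `a v_t(τ) = Δv(τ)`.
-/

/-! ### Calculus on the half-space `[τ,∞) × ℝⁿ` -/

/-- `F` is smooth on the closed half-space `[τ,∞) × ℝⁿ`, up to the boundary `t = τ`. -/
def SmoothFrom {n : ℕ} (τ : ℝ) (F : ℝ → Rn n → ℝ) : Prop :=
  ContDiffOn ℝ ∞ (fun p : ℝ × Rn n => F p.1 p.2) (Ici τ ×ˢ univ)

/-- The time derivative `∂ₜF`, one-sided at `t = τ`. -/
noncomputable def dTime {n : ℕ} (τ : ℝ) (F : ℝ → Rn n → ℝ) (t : ℝ) (x : Rn n) : ℝ :=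
  derivWithin (fun s => F s x) (Ici τ) t

/-- The partial derivative `∂F/∂xᵢ`. -/
noncomputable def dSpace {n : ℕ} (i : Fin n) (F : ℝ → Rn n → ℝ) (t : ℝ) (x : Rn n) : ℝ :=
  fderiv ℝ (F t) x (EuclideanSpace.single i 1)

section Calculus

variable {n : ℕ} {τ : ℝ} {F G : ℝ → Rn n → ℝ}

theorem timeDeriv_one (τ : ℝ) (F : ℝ → Rn n → ℝ) : timeDeriv τ 1 F = dTime τ F := by
  funext t x
  simp [timeDeriv, dTime, iteratedDerivWithin_one]

theorem timeDeriv_succ (τ : ℝ) (k : ℕ) (F : ℝ → Rn n → ℝ) :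
    timeDeriv τ (k + 1) F = dTime τ (timeDeriv τ k F) := by
  funext t x
  simp only [timeDeriv, dTime, iteratedDerivWithin_succ]

theorem uniqueDiffOn_halfSpace (τ : ℝ) : UniqueDiffOn ℝ (Ici τ ×ˢ (univ : Set (Rn n))) :=
  (uniqueDiffOn_Ici τ).prod uniqueDiffOn_univ

theorem halfSpace_mem_nhds {t : ℝ} (ht : τ < t) (x : Rn n) :
    Ici τ ×ˢ (univ : Set (Rn n)) ∈ nhds (t, x) :=
  prod_mem_nhds (Ici_mem_nhds ht) Filter.univ_mem

namespace SmoothFrom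

theorem continuousOn (hF : SmoothFrom τ F) :
    ContinuousOn (fun p : ℝ × Rn n => F p.1 p.2) (Ici τ ×ˢ univ) :=
  ContDiffOn.continuousOn hF

theorem contDiff_slice (hF : SmoothFrom τ F) {t : ℝ} (ht : τ ≤ t) : ContDiff ℝ ∞ (F t) := by
  rw [← contDiffOn_univ]
  exact ContDiffOn.comp (g := fun p : ℝ × Rn n => F p.1 p.2) (f := fun x => (t, x)) hF
    (contDiff_const.prodMk contDiff_id).contDiffOn (fun x _ => ⟨ht, mem_univ _⟩)

theorem differentiable_slice (hF : SmoothFrom τ F) {t : ℝ} (ht : τ ≤ t) :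
    Differentiable ℝ (F t) := (hF.contDiff_slice ht).differentiable (by simp)

theorem hasFDerivWithinAt (hF : SmoothFrom τ F) {t : ℝ} (ht : τ ≤ t) (x : Rn n) :
    HasFDerivWithinAt (fun p : ℝ × Rn n => F p.1 p.2)
      (fderivWithin ℝ (fun p : ℝ × Rn n => F p.1 p.2) (Ici τ ×ˢ univ) (t, x))
      (Ici τ ×ˢ univ) (t, x) :=
  ((ContDiffOn.differentiableOn hF (by simp)) (t, x) ⟨ht, mem_univ _⟩).hasFDerivWithinAt

theorem dTime_eq (hF : SmoothFrom τ F) {t : ℝ} (ht : τ ≤ t) (x : Rn n) :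
    dTime τ F t x =
      fderivWithin ℝ (fun p : ℝ × Rn n => F p.1 p.2) (Ici τ ×ˢ univ) (t, x) (1, 0) := by
  have h1 : HasDerivWithinAt (fun s : ℝ => (s, x)) ((1 : ℝ), (0 : Rn n)) (Ici τ) t :=
    (hasDerivWithinAt_id t _).prodMk (hasDerivWithinAt_const t _ x)
  have h2 := (hF.hasFDerivWithinAt ht x).comp_hasDerivWithinAt t h1
    (fun s hs => (⟨hs, mem_univ _⟩ : (s, x) ∈ Ici τ ×ˢ univ))
  exact h2.derivWithin (uniqueDiffOn_Ici τ t ht)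

theorem dSpace_eq (hF : SmoothFrom τ F) {t : ℝ} (ht : τ ≤ t) (x : Rn n) (i : Fin n) :
    dSpace i F t x =
      fderivWithin ℝ (fun p : ℝ × Rn n => F p.1 p.2) (Ici τ ×ˢ univ) (t, x)
        (0, EuclideanSpace.single i 1) := by
  have h1 : HasFDerivWithinAt (fun y : Rn n => (t, y))
      ((0 : Rn n →L[ℝ] ℝ).prod (ContinuousLinearMap.id ℝ (Rn n))) univ x :=
    (hasFDerivWithinAt_const t x _).prodMk (hasFDerivWithinAt_id x _)
  have h2 := (hF.hasFDerivWithinAt ht x).comp x h1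
    (fun s _ => (⟨ht, mem_univ _⟩ : (t, s) ∈ Ici τ ×ˢ univ))
  rw [hasFDerivWithinAt_univ] at h2
  have h3 := h2.fderiv
  simp only [dSpace]
  change fderiv ℝ ((fun p : ℝ × Rn n => F p.1 p.2) ∘ fun y => (t, y)) x _ = _
  rw [h3]
  simp

theorem deriv_time (hF : SmoothFrom τ F) : SmoothFrom τ (dTime τ F) := by
  have h := (ContDiffOn.fderivWithin (m := ∞) hF (uniqueDiffOn_halfSpace τ) (by simp)).clm_apply
    (contDiffOn_const (c := ((1 : ℝ), (0 : Rn n))))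
  exact h.congr fun p hp => hF.dTime_eq hp.1 p.2

theorem deriv_space (hF : SmoothFrom τ F) (i : Fin n) : SmoothFrom τ (dSpace i F) := by
  have h := (ContDiffOn.fderivWithin (m := ∞) hF (uniqueDiffOn_halfSpace τ) (by simp)).clm_apply
    (contDiffOn_const (c := ((0 : ℝ), (EuclideanSpace.single i 1 : Rn n))))
  exact h.congr fun p hp => hF.dSpace_eq hp.1 p.2 i

theorem congr (hF : SmoothFrom τ F) (h : ∀ t, τ ≤ t → ∀ x, G t x = F t x) : SmoothFrom τ G :=
  ContDiffOn.congr hF fun p hp => h p.1 hp.1 p.2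

theorem hasDerivAt (hF : SmoothFrom τ F) {t : ℝ} (ht : τ < t) (x : Rn n) :
    HasDerivAt (fun s => F s x) (dTime τ F t x) t := by
  have h1 : DifferentiableWithinAt ℝ (fun s : ℝ => F s x) (Ici τ) t := by
    have h1 : HasDerivWithinAt (fun s : ℝ => (s, x)) ((1 : ℝ), (0 : Rn n)) (Ici τ) t :=
      (hasDerivWithinAt_id t _).prodMk (hasDerivWithinAt_const t _ x)
    exact ((hF.hasFDerivWithinAt ht.le x).comp_hasDerivWithinAt t h1
      (fun s hs => (⟨hs, mem_univ _⟩ : (s, x) ∈ Ici τ ×ˢ univ))).differentiableWithinAt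
  exact h1.hasDerivWithinAt.hasDerivAt (Ici_mem_nhds ht)

theorem continuousOn_time (hF : SmoothFrom τ F) (x : Rn n) :
    ContinuousOn (fun s => F s x) (Ici τ) :=
  hF.continuousOn.comp (by fun_prop : Continuous fun s : ℝ => (s, x)).continuousOn
    fun s hs => ⟨hs, mem_univ _⟩

theorem dTime_eq_of_hasDerivAt {t d : ℝ} (ht : τ < t) {x : Rn n}
    (h : HasDerivAt (fun s => F s x) d t) : dTime τ F t x = d :=
  h.hasDerivWithinAt.derivWithin (uniqueDiffOn_Ici τ t ht.le)

/-- Time and space derivatives commute in the interior of the half-space. -/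
theorem dTime_dSpace (hF : SmoothFrom τ F) (i : Fin n) {t : ℝ} (ht : τ < t) (x : Rn n) :
    dTime τ (dSpace i F) t x = dSpace i (dTime τ F) t x := by
  set U : ℝ × Rn n → ℝ := fun p => F p.1 p.2 with hU
  have hnear : ∀ (s : ℝ), τ < s → ∀ y : Rn n,
      fderivWithin ℝ U (Ici τ ×ˢ univ) (s, y) = fderiv ℝ U (s, y) := fun s hs y =>
    fderivWithin_of_mem_nhds (halfSpace_mem_nhds hs y)
  have hC : ContDiffAt ℝ ∞ U (t, x) := ContDiffOn.contDiffAt hF (halfSpace_mem_nhds ht x)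
  have hd : DifferentiableAt ℝ (fderiv ℝ U) (t, x) :=
    (hC.fderiv_right (m := 1) (by norm_cast)).differentiableAt (by simp)
  have hsymm : IsSymmSndFDerivAt ℝ U (t, x) :=
    hC.isSymmSndFDerivAt (by simp only [minSmoothness_of_isRCLikeNormedField]; norm_cast)
  have happ : ∀ c : ℝ × Rn n, HasFDerivAt (fun p => fderiv ℝ U p c)
      ((fderiv ℝ (fderiv ℝ U) (t, x)).flip c) (t, x) := fun c => by
    have := (ContinuousLinearMap.apply ℝ ℝ c).hasFDerivAt.comp (t, x) hd.hasFDerivAt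
    exact this.congr_fderiv (by ext <;> rfl)
  have e1 : dTime τ (dSpace i F) t x
      = fderiv ℝ (fderiv ℝ U) (t, x) (1, 0) (0, EuclideanSpace.single i 1) := by
    apply dTime_eq_of_hasDerivAt ht
    have h1 : HasDerivAt (fun s : ℝ => (s, x)) ((1 : ℝ), (0 : Rn n)) t :=
      (hasDerivAt_id t).prodMk (hasDerivAt_const t x)
    have h2 := (happ (0, EuclideanSpace.single i 1)).comp_hasDerivAt t h1
    refine h2.congr_of_eventuallyEq ?_
    filter_upwards [Ioi_mem_nhds ht] with s hs
    rw [hF.dSpace_eq (le_of_lt hs), hnear s hs]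
    rfl
  have e2 : dSpace i (dTime τ F) t x
      = fderiv ℝ (fderiv ℝ U) (t, x) (0, EuclideanSpace.single i 1) (1, 0) := by
    have h1 : HasFDerivAt (fun y : Rn n => (t, y))
        ((0 : Rn n →L[ℝ] ℝ).prod (ContinuousLinearMap.id ℝ (Rn n))) x :=
      (hasFDerivAt_const t x).prodMk (hasFDerivAt_id x)
    have h2 := (happ (1, 0)).comp x h1
    have h3 : dTime τ F t = (fun p => fderiv ℝ U p (1, 0)) ∘ fun y => (t, y) := by
      funext y
      rw [hF.dTime_eq ht.le, hnear t ht]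
      rfl
    simp only [dSpace, h3]
    rw [h2.fderiv]
    rfl
  rw [e1, e2]
  exact hsymm _ _

theorem add (hF : SmoothFrom τ F) (hG : SmoothFrom τ G) :
    SmoothFrom τ fun t x => F t x + G t x := ContDiffOn.add hF hG

theorem sub (hF : SmoothFrom τ F) (hG : SmoothFrom τ G) :
    SmoothFrom τ fun t x => F t x - G t x := ContDiffOn.sub hF hG

theorem mul (hF : SmoothFrom τ F) (hG : SmoothFrom τ G) :
    SmoothFrom τ fun t x => F t x * G t x := ContDiffOn.mul hF hG

theorem pow (hF : SmoothFrom τ F) (k : ℕ) : SmoothFrom τ fun t x => F t x ^ k :=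
  ContDiffOn.pow hF k

theorem exp (hF : SmoothFrom τ F) : SmoothFrom τ fun t x => Real.exp (F t x) :=
  ContDiffOn.exp hF

theorem const (c : ℝ) : SmoothFrom τ fun _ (_ : Rn n) => c := contDiffOn_const

theorem const_mul (c : ℝ) (hF : SmoothFrom τ F) : SmoothFrom τ fun t x => c * F t x :=
  (const c).mul hF

theorem of_space {f : Rn n → ℝ} (hf : ContDiff ℝ ∞ f) : SmoothFrom τ fun _ x => f x :=
  (hf.comp contDiff_snd).contDiffOn

theorem of_time {f : ℝ → ℝ} (hf : ContDiffOn ℝ ∞ f (Ici τ)) :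
    SmoothFrom τ fun t (_ : Rn n) => f t :=
  ContDiffOn.comp hf contDiff_fst.contDiffOn fun _ hp => hp.1

theorem sum {ι : Type*} (s : Finset ι) {F : ι → ℝ → Rn n → ℝ} (h : ∀ i, SmoothFrom τ (F i)) :
    SmoothFrom τ fun t x => ∑ i ∈ s, F i t x := ContDiffOn.sum fun i _ => h i

end SmoothFrom

theorem gradient_apply (f : Rn n → ℝ) (x : Rn n) (i : Fin n) :
    (∇ f x) i = fderiv ℝ f x (EuclideanSpace.single i 1) := by
  rw [← inner_gradient_left, EuclideanSpace.inner_single_right]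
  simp

theorem inner_gradient_eq_sum (f g : Rn n → ℝ) (x : Rn n) :
    inner ℝ (∇ f x) (∇ g x) = ∑ i, fderiv ℝ f x (EuclideanSpace.single i 1) *
      fderiv ℝ g x (EuclideanSpace.single i 1) := by
  rw [PiLp.inner_apply]
  refine Finset.sum_congr rfl fun i _ => ?_
  simp [gradient_apply, mul_comm]

theorem laplacian_eq_sum {f : Rn n → ℝ} (hf : ContDiff ℝ ∞ f) (x : Rn n) :
    (Δ f) x = ∑ i, fderiv ℝ (fun y => fderiv ℝ f y (EuclideanSpace.single i 1)) x
      (EuclideanSpace.single i 1) := by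
  rw [InnerProductSpace.laplacian_eq_iteratedFDeriv_orthonormalBasis f
    (EuclideanSpace.basisFun (Fin n) ℝ)]
  refine Finset.sum_congr rfl fun i _ => ?_
  have hd : DifferentiableAt ℝ (fderiv ℝ f) x :=
    ((hf.fderiv_right (m := 1) (by norm_cast)).differentiable (by simp)) x
  rw [iteratedFDeriv_two_apply, fderiv_clm_apply hd (by fun_prop)]
  simp

namespace SmoothFrom

theorem inner_gradient (hF : SmoothFrom τ F) (hG : SmoothFrom τ G) :
    SmoothFrom τ fun t x => inner ℝ (∇ (F t) x) (∇ (G t) x) :=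
  (sum Finset.univ fun i => (hF.deriv_space i).mul (hG.deriv_space i)).congr fun _ _ _ =>
    inner_gradient_eq_sum _ _ _

theorem norm_gradient_sq (hF : SmoothFrom τ F) :
    SmoothFrom τ fun t x => ‖∇ (F t) x‖ ^ 2 :=
  (hF.inner_gradient hF).congr fun _ _ _ => (real_inner_self_eq_norm_sq _).symm

theorem laplacian (hF : SmoothFrom τ F) : SmoothFrom τ fun t x => (Δ (F t)) x :=
  (sum Finset.univ fun i => (hF.deriv_space i).deriv_space i).congr fun _ ht x =>
    laplacian_eq_sum (hF.contDiff_slice ht) x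

theorem dTime_laplacian (hF : SmoothFrom τ F) {t : ℝ} (ht : τ < t) (x : Rn n) :
    dTime τ (fun t x => (Δ (F t)) x) t x = (Δ (dTime τ F t)) x := by
  apply dTime_eq_of_hasDerivAt ht
  have h1 : HasDerivAt (fun s => ∑ i, dSpace i (dSpace i F) s x)
      (∑ i, dTime τ (dSpace i (dSpace i F)) t x) t :=
    HasDerivAt.fun_sum fun i _ => ((hF.deriv_space i).deriv_space i).hasDerivAt ht x
  have h2 : (Δ (dTime τ F t)) x
      = ∑ i, dTime τ (dSpace i (dSpace i F)) t x := by
    rw [laplacian_eq_sum (hF.deriv_time.contDiff_slice ht.le)]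
    refine Finset.sum_congr rfl fun i _ => ?_
    rw [(hF.deriv_space i).dTime_dSpace i ht]
    have : dTime τ (dSpace i F) t = dSpace i (dTime τ F) t :=
      funext fun y => hF.dTime_dSpace i ht y
    change _ = fderiv ℝ (dTime τ (dSpace i F) t) x _
    rw [this]
    rfl
  rw [h2]
  refine h1.congr_of_eventuallyEq ?_
  filter_upwards [Ioi_mem_nhds ht] with s hs
  exact laplacian_eq_sum (hF.contDiff_slice (le_of_lt hs)) x

theorem hasDerivAt_norm_gradient_sq (hF : SmoothFrom τ F) {t : ℝ} (ht : τ < t) (x : Rn n) :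
    HasDerivAt (fun s => ‖∇ (F s) x‖ ^ 2)
      (2 * inner ℝ (∇ (dTime τ F t) x) (∇ (F t) x)) t := by
  have h1 : HasDerivAt (fun s => ∑ i, dSpace i F s x * dSpace i F s x)
      (∑ i, (dSpace i (dTime τ F) t x * dSpace i F t x
        + dSpace i F t x * dSpace i (dTime τ F) t x)) t := by
    refine HasDerivAt.fun_sum fun i _ => ?_
    have := (hF.deriv_space i).hasDerivAt ht x
    rw [hF.dTime_dSpace i ht] at this
    exact this.mul this
  have h2 : (fun s => ‖∇ (F s) x‖ ^ 2)
      = fun s => ∑ i, dSpace i F s x * dSpace i F s x := by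
    funext s
    rw [← real_inner_self_eq_norm_sq, inner_gradient_eq_sum]
    rfl
  rw [h2]
  convert h1 using 1
  rw [inner_gradient_eq_sum, Finset.mul_sum]
  refine Finset.sum_congr rfl fun i _ => ?_
  simp only [dSpace]
  ring

end SmoothFrom

theorem gradient_mul {f g : Rn n → ℝ} {x : Rn n} (hf : DifferentiableAt ℝ f x)
    (hg : DifferentiableAt ℝ g x) :
    ∇ (fun y => f y * g y) x = f x • ∇ g x + g x • ∇ f x := by
  ext i
  simp [gradient_apply, fderiv_fun_mul hf hg]

theorem gradient_add {f g : Rn n → ℝ} {x : Rn n} (hf : DifferentiableAt ℝ f x)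
    (hg : DifferentiableAt ℝ g x) :
    ∇ (fun y => f y + g y) x = ∇ f x + ∇ g x := by
  ext i
  simp [gradient_apply, fderiv_fun_add hf hg]

/-- Chain rule for the gradient of `h ∘ f`. -/
theorem gradient_comp {f : Rn n → ℝ} {x : Rn n} {h : ℝ → ℝ} {h' : ℝ}
    (hh : HasDerivAt h h' (f x)) (hf : DifferentiableAt ℝ f x) :
    ∇ (fun y => h (f y)) x = h' • ∇ f x := by
  ext i
  have := (hh.comp_hasFDerivAt x hf.hasFDerivAt).fderiv
  simp only [Function.comp_def] at this
  simp [gradient_apply, this]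

end Calculus

/-! ### Integration over space-time slabs -/

/-- The open space-time slab `(τ,T) × ℝⁿ`. -/
def slab (n : ℕ) (τ T : ℝ) : Set (ℝ × Rn n) := Ioo τ T ×ˢ univ

section Integration

variable {n : ℕ} {τ T R : ℝ} {F G : ℝ → Rn n → ℝ}

theorem measurableSet_slab : MeasurableSet (slab n τ T) :=
  measurableSet_Ioo.prod MeasurableSet.univ

/-- Vanishing outside a ball replaces compact support throughout. -/
theorem integrable_of_vanish {f : Rn n → ℝ} (hf : Continuous f)
    (h0 : ∀ x, R < ‖x‖ → f x = 0) : Integrable f := by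
  refine hf.integrable_of_hasCompactSupport
    (HasCompactSupport.intro (isCompact_closedBall 0 R) fun x hx => h0 x ?_)
  simpa using hx

theorem integrableOn_slab
    (hF : ContinuousOn (fun p : ℝ × Rn n => F p.1 p.2) (Ici τ ×ˢ univ))
    (h0 : ∀ t ∈ Ioo τ T, ∀ x, R < ‖x‖ → F t x = 0) :
    IntegrableOn (fun p : ℝ × Rn n => F p.1 p.2) (slab n τ T) := by
  have h1 : IntegrableOn (fun p : ℝ × Rn n => F p.1 p.2)
      (Icc τ T ×ˢ Metric.closedBall (0 : Rn n) R) :=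
    (hF.mono (prod_mono Icc_subset_Ici_self (subset_univ _))).integrableOn_compact
      (isCompact_Icc.prod (isCompact_closedBall _ _))
  refine h1.of_forall_sdiff_eq_zero measurableSet_slab ?_
  rintro ⟨t, x⟩ ⟨⟨ht, -⟩, hx⟩
  refine h0 t ht x ?_
  by_contra hle
  exact hx ⟨Ioo_subset_Icc_self ht, by simpa using hle⟩

theorem dTime_eq_zero_of_vanish (h0 : ∀ t ∈ Ioo τ T, ∀ x, R < ‖x‖ → F t x = 0) :
    ∀ t ∈ Ioo τ T, ∀ x, R < ‖x‖ → dTime τ F t x = 0 := by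
  intro t ht x hx
  apply SmoothFrom.dTime_eq_of_hasDerivAt ht.1
  refine (hasDerivAt_const t (0 : ℝ)).congr_of_eventuallyEq ?_
  filter_upwards [Ioo_mem_nhds ht.1 ht.2] with s hs using h0 s hs x hx

theorem gradient_eq_zero_of_vanish {f : Rn n → ℝ} (h0 : ∀ x, R < ‖x‖ → f x = 0) {x : Rn n}
    (hx : R < ‖x‖) : ∇ f x = 0 := by
  have : f =ᶠ[nhds x] fun _ => 0 := by
    filter_upwards [(isOpen_lt continuous_const continuous_norm).mem_nhds hx] with y hy
    exact h0 y hy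
  rw [this.gradient_eq, gradient_fun_const]

/-- The balance of `∫ F dx`: the fundamental theorem of calculus in time together with Fubini's
theorem. -/
theorem integral_sub_integral_eq (hF : SmoothFrom τ F) (hT : τ ≤ T)
    (h0 : ∀ t ∈ Icc τ T, ∀ x, R < ‖x‖ → F t x = 0) :
    (∫ x, F T x) - (∫ x, F τ x) = ∫ p in slab n τ T, dTime τ F p.1 p.2 := by
  have h1 : IntegrableOn (fun p : ℝ × Rn n => dTime τ F p.1 p.2) (slab n τ T) :=
    integrableOn_slab hF.deriv_time.continuousOn
      (dTime_eq_zero_of_vanish fun t ht => h0 t (Ioo_subset_Icc_self ht))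
  have hint : ∀ t, τ ≤ t → t ≤ T → Integrable (F t) := fun t h1 h2 =>
    integrable_of_vanish (hF.contDiff_slice h1).continuous (h0 t ⟨h1, h2⟩)
  rw [← integral_sub (hint T hT le_rfl) (hint τ le_rfl hT)]
  rw [slab, Measure.volume_eq_prod, ← Measure.prod_restrict,
    integral_prod_symm _ (by
      rwa [Measure.prod_restrict, ← Measure.volume_eq_prod])]
  rw [Measure.restrict_univ]
  refine integral_congr_ae (Filter.Eventually.of_forall fun x => ?_)
  have hc : ContinuousOn (fun s => dTime τ F s x) (Icc τ T) :=
    (hF.deriv_time.continuousOn_time x).mono Icc_subset_Ici_self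
  have := intervalIntegral.integral_eq_sub_of_hasDerivAt_of_le hT
    ((hF.continuousOn_time x).mono Icc_subset_Ici_self)
    (fun t ht => hF.hasDerivAt ht.1 x) (hc.intervalIntegrable_of_Icc hT)
  rw [intervalIntegral.integral_of_le hT, integral_Ioc_eq_integral_Ioo] at this
  exact this.symm

/-- Green's identity on `ℝⁿ`. -/
theorem integral_green {f g : Rn n → ℝ} (hf : ContDiff ℝ ∞ f) (hg : ContDiff ℝ ∞ g)
    (h0 : ∀ x, R < ‖x‖ → f x = 0) :
    ∫ x, (f x * (Δ g) x + inner ℝ (∇ f x) (∇ g x)) = 0 := by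
  have hd : ∀ {h : Rn n → ℝ} (i : Fin n), ContDiff ℝ ∞ h →
      ContDiff ℝ ∞ fun x => fderiv ℝ h x (EuclideanSpace.single i 1) := fun i hh =>
    (hh.fderiv_right (m := ∞) (by norm_cast)).clm_apply contDiff_const
  have hz : ∀ (i : Fin n) (x : Rn n), R < ‖x‖ → fderiv ℝ f x (EuclideanSpace.single i 1) = 0 :=
    fun i x hx => by rw [← gradient_apply, gradient_eq_zero_of_vanish h0 hx]; simp
  have i1 : ∀ i : Fin n, Integrable fun x => f x *
      fderiv ℝ (fun y => fderiv ℝ g y (EuclideanSpace.single i 1)) x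
        (EuclideanSpace.single i 1) := fun i =>
    integrable_of_vanish (R := R) (hf.continuous.mul (hd i (hd i hg)).continuous)
      fun x hx => by rw [h0 x hx, zero_mul]
  have i2 : ∀ i : Fin n, Integrable fun x => fderiv ℝ f x (EuclideanSpace.single i 1) *
      fderiv ℝ g x (EuclideanSpace.single i 1) := fun i =>
    integrable_of_vanish (R := R) ((hd i hf).continuous.mul (hd i hg).continuous)
      fun x hx => by rw [hz i x hx, zero_mul]
  have hpt : ∀ x, f x * (Δ g) x + inner ℝ (∇ f x) (∇ g x) = ∑ i, (f x *
      fderiv ℝ (fun y => fderiv ℝ g y (EuclideanSpace.single i 1)) x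
        (EuclideanSpace.single i 1) + fderiv ℝ f x (EuclideanSpace.single i 1) *
      fderiv ℝ g x (EuclideanSpace.single i 1)) := fun x => by
    rw [laplacian_eq_sum hg, inner_gradient_eq_sum, Finset.mul_sum, Finset.sum_add_distrib]
  simp_rw [hpt]
  rw [integral_finsetSum _ fun i _ => (i1 i).fun_add (i2 i)]
  refine Finset.sum_eq_zero fun i _ => ?_
  rw [integral_add (i1 i) (i2 i), integral_mul_fderiv_eq_neg_fderiv_mul_of_integrable (i2 i) (i1 i)
    (integrable_of_vanish (R := R) (hf.continuous.mul (hd i hg).continuous)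
      fun x hx => by rw [h0 x hx, zero_mul])
    (fun x _ => hf.differentiable (by simp) x) (fun x _ => (hd i hg).differentiable (by simp) x)]
  ring

theorem setIntegral_slab
    (hF : ContinuousOn (fun p : ℝ × Rn n => F p.1 p.2) (Ici τ ×ˢ univ))
    (h0 : ∀ t ∈ Ioo τ T, ∀ x, R < ‖x‖ → F t x = 0) :
    ∫ p in slab n τ T, F p.1 p.2 = ∫ t in Ioo τ T, ∫ x, F t x := by
  have h1 := integrableOn_slab hF h0
  rw [slab, Measure.volume_eq_prod] at h1 ⊢
  rw [setIntegral_prod _ h1, Measure.restrict_univ]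

/-- Green's identity integrated over a slab. -/
theorem setIntegral_slab_green (hF : SmoothFrom τ F) (hG : SmoothFrom τ G)
    (h0 : ∀ t ∈ Ioo τ T, ∀ x, R < ‖x‖ → F t x = 0) :
    ∫ p in slab n τ T, (F p.1 p.2 * (Δ (G p.1)) p.2
      + inner ℝ (∇ (F p.1) p.2) (∇ (G p.1) p.2)) = 0 := by
  have hcont := ((hF.mul hG.laplacian).add (hF.inner_gradient hG)).continuousOn
  refine (setIntegral_slab (R := R)
    (F := fun t x => F t x * (Δ (G t)) x + inner ℝ (∇ (F t) x) (∇ (G t) x)) hcont ?_).trans ?_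
  rotate_left
  · refine setIntegral_eq_zero_of_forall_eq_zero fun t ht => ?_
    exact integral_green (hF.contDiff_slice ht.1.le) (hG.contDiff_slice ht.1.le) (h0 t ht)
  · intro t ht x hx
    rw [h0 t ht x hx, gradient_eq_zero_of_vanish (h0 t ht) hx]
    simp

/-- The energy inequality in integrated form: if `∂ₜF ≤ G` up to the two divergences
`div (f₁ ∇g₁)` and `div (f₂ ∇g₂)`, then `∫ F(T) ≤ ∫ F(τ) + ∬ G`. -/
theorem integral_le_of_dTime_le {f₁ g₁ f₂ g₂ : ℝ → Rn n → ℝ} (hT : τ ≤ T)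
    (hF : SmoothFrom τ F) (hG : SmoothFrom τ G)
    (hf₁ : SmoothFrom τ f₁) (hg₁ : SmoothFrom τ g₁) (hf₂ : SmoothFrom τ f₂)
    (hg₂ : SmoothFrom τ g₂)
    (hF0 : ∀ t ∈ Icc τ T, ∀ x, R < ‖x‖ → F t x = 0)
    (hG0 : ∀ t ∈ Ioo τ T, ∀ x, R < ‖x‖ → G t x = 0)
    (hf0₁ : ∀ t ∈ Ioo τ T, ∀ x, R < ‖x‖ → f₁ t x = 0)
    (hf0₂ : ∀ t ∈ Ioo τ T, ∀ x, R < ‖x‖ → f₂ t x = 0)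
    (h : ∀ t ∈ Ioo τ T, ∀ x, ∃ d, HasDerivAt (fun s => F s x) d t ∧
      d ≤ G t x + (f₁ t x * (Δ (g₁ t)) x + inner ℝ (∇ (f₁ t) x) (∇ (g₁ t) x))
        + (f₂ t x * (Δ (g₂ t)) x + inner ℝ (∇ (f₂ t) x) (∇ (g₂ t) x))) :
    ∫ x, F T x ≤ (∫ x, F τ x) + ∫ p in slab n τ T, G p.1 p.2 := by
  have hI : ∀ {f g : ℝ → Rn n → ℝ}, SmoothFrom τ f → SmoothFrom τ g →
      (∀ t ∈ Ioo τ T, ∀ x, R < ‖x‖ → f t x = 0) →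
      IntegrableOn (fun p : ℝ × Rn n => f p.1 p.2 * (Δ (g p.1)) p.2
        + inner ℝ (∇ (f p.1) p.2) (∇ (g p.1) p.2)) (slab n τ T) := fun {f g} hf hg h0 =>
    integrableOn_slab (F := fun t x => f t x * (Δ (g t)) x + inner ℝ (∇ (f t) x) (∇ (g t) x))
      (R := R) ((hf.mul hg.laplacian).add (hf.inner_gradient hg)).continuousOn
      fun t ht x hx => by
        rw [h0 t ht x hx, gradient_eq_zero_of_vanish (h0 t ht) hx]; simp
  have hGi := integrableOn_slab hG.continuousOn hG0
  have h1 := hI hf₁ hg₁ hf0₁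
  have h2 := hI hf₂ hg₂ hf0₂
  have key : ∫ p in slab n τ T, dTime τ F p.1 p.2 ≤ ∫ p in slab n τ T,
      (G p.1 p.2 + (f₁ p.1 p.2 * (Δ (g₁ p.1)) p.2 + inner ℝ (∇ (f₁ p.1) p.2) (∇ (g₁ p.1) p.2))
        + (f₂ p.1 p.2 * (Δ (g₂ p.1)) p.2 + inner ℝ (∇ (f₂ p.1) p.2) (∇ (g₂ p.1) p.2))) := by
    refine setIntegral_mono_on (integrableOn_slab hF.deriv_time.continuousOn
      (dTime_eq_zero_of_vanish fun t ht => hF0 t (Ioo_subset_Icc_self ht)))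
      ((hGi.add h1).add h2) measurableSet_slab ?_
    rintro ⟨t, x⟩ ⟨ht, -⟩
    obtain ⟨d, hd, hle⟩ := h t ht x
    simp only
    rwa [SmoothFrom.dTime_eq_of_hasDerivAt ht.1 hd]
  rw [integral_add (hGi.fun_add h1) h2, integral_add hGi h1, setIntegral_slab_green hf₁ hg₁ hf0₁,
    setIntegral_slab_green hf₂ hg₂ hf0₂, ← integral_sub_integral_eq hF hT hF0] at key
  linarith

end Integration

/-! ### The bracket, the damping and the weight `ψ` -/

section Bracket

variable {n : ℕ}

theorem bracket_sq (x : Rn n) : bracket x ^ 2 = 1 + ‖x‖ ^ 2 :=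
  Real.sq_sqrt (by positivity)

theorem bracket_pos (x : Rn n) : 0 < bracket x := Real.sqrt_pos.2 (by positivity)

theorem one_le_bracket (x : Rn n) : 1 ≤ bracket x :=
  Real.one_le_sqrt.2 (by nlinarith [sq_nonneg ‖x‖])

theorem norm_le_bracket (x : Rn n) : ‖x‖ ≤ bracket x :=
  Real.le_sqrt_of_sq_le (by linarith)

theorem bracket_le_one_add_norm (x : Rn n) : bracket x ≤ 1 + ‖x‖ :=
  Real.sqrt_le_iff.2 ⟨by positivity, by nlinarith [norm_nonneg x]⟩

theorem contDiff_bracket : ContDiff ℝ ∞ (bracket : Rn n → ℝ) :=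
  ContDiff.sqrt (contDiff_const.add (contDiff_norm_sq ℝ)) fun x => by positivity

theorem contDiff_bracket_rpow (q : ℝ) : ContDiff ℝ ∞ fun x : Rn n => bracket x ^ q :=
  contDiff_bracket.rpow_const_of_ne fun x => (bracket_pos x).ne'

theorem gradient_norm_sq (x : Rn n) : ∇ (fun y : Rn n => ‖y‖ ^ 2) x = (2 : ℝ) • x := by
  ext i
  rw [gradient_apply, fderiv_norm_sq_apply]
  simp [EuclideanSpace.inner_single_right]

theorem gradient_bracket_rpow (q : ℝ) (x : Rn n) :
    ∇ (fun y : Rn n => bracket y ^ q) x = (q * bracket x ^ (q - 2)) • x := by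
  have hpos : 0 < 1 + ‖x‖ ^ 2 := by positivity
  have e : ∀ (r : ℝ) (y : Rn n), bracket y ^ r = (1 + ‖y‖ ^ 2) ^ (r / 2) := fun r y => by
    rw [bracket, Real.sqrt_eq_rpow, ← Real.rpow_mul (by positivity)]
    ring_nf
  have h1 : HasDerivAt (fun s : ℝ => (1 + s) ^ (q / 2))
      (1 * (q / 2) * (1 + ‖x‖ ^ 2) ^ (q / 2 - 1)) (‖x‖ ^ 2) :=
    ((hasDerivAt_id (‖x‖ ^ 2)).const_add 1).rpow_const (Or.inl hpos.ne')
  have h2 := gradient_comp (f := fun y : Rn n => ‖y‖ ^ 2) h1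
    ((contDiff_norm_sq ℝ (n := 1)).differentiable (by simp) x)
  simp_rw [e q]
  rw [h2, gradient_norm_sq, smul_smul, e]
  congr 1
  rw [show (q - 2) / 2 = q / 2 - 1 by ring]
  ring

theorem laplacian_bracket_rpow (q : ℝ) (x : Rn n) :
    (Δ (fun y : Rn n => bracket y ^ q)) x
      = q * (n * bracket x ^ (q - 2) + (q - 2) * bracket x ^ (q - 4) * ‖x‖ ^ 2) := by
  rw [laplacian_eq_sum (contDiff_bracket_rpow q)]
  have e : ∀ i : Fin n, (fun y : Rn n => fderiv ℝ (fun y : Rn n => bracket y ^ q) y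
      (EuclideanSpace.single i 1)) = fun y : Rn n => q * bracket y ^ (q - 2) * y i := fun i => by
    funext y
    rw [← gradient_apply, gradient_bracket_rpow]
    simp
  simp_rw [e]
  have h : ∀ i : Fin n, fderiv ℝ (fun y : Rn n => q * bracket y ^ (q - 2) * y i) x
      (EuclideanSpace.single i 1)
      = q * (bracket x ^ (q - 2) + (q - 2) * bracket x ^ (q - 4) * x i ^ 2) := fun i => by
    have hd : DifferentiableAt ℝ (fun y : Rn n => bracket y ^ (q - 2)) x :=
      (contDiff_bracket_rpow (q - 2)).differentiable (by simp) x
    have hi : DifferentiableAt ℝ (fun y : Rn n => y i) x := by fun_prop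
    have hi' : fderiv ℝ (fun y : Rn n => y i) x (EuclideanSpace.single i 1) = 1 := by
      have : (fun y : Rn n => y i) = (EuclideanSpace.proj i : Rn n →L[ℝ] ℝ) := rfl
      rw [this, ContinuousLinearMap.fderiv]
      simp
    rw [fderiv_fun_mul (hd.const_mul q) hi, fderiv_const_mul hd]
    simp only [add_apply, smul_apply, hi', smul_eq_mul]
    rw [← gradient_apply (fun y : Rn n => bracket y ^ (q - 2)), gradient_bracket_rpow]
    simp only [PiLp.smul_apply, smul_eq_mul]
    rw [show q - 2 - 2 = q - 4 by ring]
    ring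
  simp_rw [h]
  rw [← Finset.mul_sum, Finset.sum_add_distrib, ← Finset.mul_sum, EuclideanSpace.real_norm_sq_eq]
  simp

theorem damping_pos (α : ℝ) (x : Rn n) : 0 < damping α x := Real.rpow_pos_of_pos (bracket_pos x) _

theorem damping_le_one {α : ℝ} (hα : 0 ≤ α) (x : Rn n) : damping α x ≤ 1 :=
  Real.rpow_le_one_of_one_le_of_nonpos (one_le_bracket x) (by linarith)

theorem contDiff_damping (α : ℝ) : ContDiff ℝ ∞ (damping α : Rn n → ℝ) :=
  contDiff_bracket_rpow _

theorem weightPsi_nonneg {α δ t : ℝ} (hδ : 0 < δ) (ht : 0 ≤ t) (x : Rn n) :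
    0 ≤ weightPsi α δ t x := by
  have := bracket_pos x
  unfold weightPsi
  positivity

theorem smoothFrom_weightPsi {α δ τ : ℝ} (hτ : 0 ≤ τ) :
    SmoothFrom (n := n) τ (weightPsi α δ) := by
  have h1 : ContDiffOn ℝ ∞ (fun t : ℝ => (1 + t)⁻¹) (Ici τ) :=
    ContDiffOn.inv (by fun_prop) fun t ht => by
      have : τ ≤ t := ht
      linarith
  exact ((SmoothFrom.of_space (contDiff_bracket_rpow (2 - α))).mul
    (SmoothFrom.of_time h1)).const_mul _

theorem hasDerivAt_weightPsi {α δ t : ℝ} (ht : 0 ≤ t) (x : Rn n) :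
    HasDerivAt (fun s => weightPsi α δ s x) (-(weightPsi α δ t x / (1 + t))) t := by
  have h0 : (1 + t) ≠ 0 := by linarith
  have h1 : HasDerivAt (fun s : ℝ => 1 + s) 1 t := (hasDerivAt_id t).const_add 1
  have h2 := ((hasDerivAt_const t (bracket x ^ (2 - α))).div h1 h0).const_mul
    (1 / ((2 - α) ^ 2 * (2 + δ)))
  refine h2.congr_deriv ?_
  unfold weightPsi
  field_simp
  ring

theorem weightPsi_eq (α δ t : ℝ) :
    (weightPsi α δ t : Rn n → ℝ)
      = fun x => (1 / ((2 - α) ^ 2 * (2 + δ)) / (1 + t)) * bracket x ^ (2 - α) := by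
  funext x
  unfold weightPsi
  ring

theorem gradient_weightPsi {α δ t : ℝ} (hα : α < 2) (x : Rn n) :
    ∇ (weightPsi α δ t) x = (1 / ((2 - α) * (2 + δ)) / (1 + t) * damping α x) • x := by
  have h1 : HasDerivAt (fun s : ℝ => (1 / ((2 - α) ^ 2 * (2 + δ)) / (1 + t)) * s)
      ((1 / ((2 - α) ^ 2 * (2 + δ)) / (1 + t)) * 1) (bracket x ^ (2 - α)) :=
    (hasDerivAt_id _).const_mul _
  have hα' : 2 - α ≠ 0 := by linarith
  rw [weightPsi_eq, gradient_comp (f := fun x : Rn n => bracket x ^ (2 - α)) h1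
    ((contDiff_bracket_rpow _).differentiable (by simp) x), gradient_bracket_rpow, smul_smul]
  congr 1
  rw [damping, show 2 - α - 2 = -α by ring]
  field_simp

/-- The slack `2 + δ` in the weight: `(2+δ) |∇ψ|² ≤ -a ∂ₜψ`. -/
theorem norm_gradient_weightPsi_sq_le {α δ t : ℝ} (hα : α < 2) (hδ : 0 < δ) (ht : 0 ≤ t)
    (x : Rn n) :
    (2 + δ) * ‖∇ (weightPsi α δ t) x‖ ^ 2 ≤ damping α x * (weightPsi α δ t x / (1 + t)) := by
  have hα' : 0 < 2 - α := by linarith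
  have hb := bracket_pos x
  have ha := damping_pos α x
  have hsplit : bracket x ^ (2 - α) = bracket x ^ 2 * damping α x := by
    rw [damping, sub_eq_add_neg, Real.rpow_add hb]
    norm_num
  rw [gradient_weightPsi hα, norm_smul, mul_pow, Real.norm_eq_abs, sq_abs]
  have hx : ‖x‖ ^ 2 ≤ bracket x ^ 2 := by rw [bracket_sq]; linarith
  calc _ = (damping α x ^ 2 / ((2 - α) ^ 2 * (2 + δ) * (1 + t) ^ 2)) * ‖x‖ ^ 2 := by
        field_simp
    _ ≤ (damping α x ^ 2 / ((2 - α) ^ 2 * (2 + δ) * (1 + t) ^ 2)) * bracket x ^ 2 := by gcongr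
    _ = _ := by
        unfold weightPsi
        rw [hsplit]
        field_simp

theorem two_mul_norm_gradient_weightPsi_sq_le {α δ t : ℝ} (hα : α < 2) (hδ : 0 < δ) (ht : 0 ≤ t)
    (x : Rn n) :
    2 * ‖∇ (weightPsi α δ t) x‖ ^ 2 ≤ damping α x * (weightPsi α δ t x / (1 + t)) := by
  nlinarith [norm_gradient_weightPsi_sq_le hα hδ ht x, sq_nonneg ‖∇ (weightPsi α δ t) x‖]

/-- The gradient of `ψ` grows no faster than `a⟨x⟩`, which a logarithmic cutoff can absorb. -/
theorem norm_gradient_weightPsi_le {α δ t : ℝ} (hα : α ≤ 1) (hδ : 0 < δ) (ht : 0 ≤ t)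
    (x : Rn n) : ‖∇ (weightPsi α δ t) x‖ ≤ damping α x * bracket x := by
  have ha := damping_pos α x
  rw [gradient_weightPsi (by linarith), norm_smul, Real.norm_eq_abs, abs_of_nonneg (by
    have : 0 < 2 - α := by linarith
    positivity)]
  have h1 : 1 / ((2 - α) * (2 + δ)) / (1 + t) ≤ 1 := by
    rw [div_div, div_le_one (by have : 0 < 2 - α := by linarith
                                positivity)]
    have h2 : 1 ≤ (2 - α) * (2 + δ) := by nlinarith
    nlinarith
  calc _ ≤ 1 * damping α x * bracket x := by gcongr; exact norm_le_bracket x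
    _ = _ := by ring

/-- The lower bound `Δψ ≥ β a / (1+t)` with `β = (n-α) / ((2-α)(2+δ))`, which tends to
`(n-α) / (2(2-α))` as `δ → 0`. It is the source of the decay rate. -/
theorem le_laplacian_weightPsi {α δ t : ℝ} (hα0 : 0 ≤ α) (hα : α < 2) (hδ : 0 < δ) (ht : 0 ≤ t)
    (x : Rn n) :
    (n - α) / ((2 - α) * (2 + δ)) * (damping α x / (1 + t)) ≤ (Δ (weightPsi α δ t)) x := by
  have hα' : 0 < 2 - α := by linarith
  have hb := bracket_pos x
  have ha := damping_pos α x
  have hf : (weightPsi α δ t : Rn n → ℝ)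
      = (1 / ((2 - α) ^ 2 * (2 + δ)) / (1 + t)) • fun x => bracket x ^ (2 - α) := by
    rw [weightPsi_eq]; rfl
  rw [hf, InnerProductSpace.laplacian_smul _
    ((contDiff_bracket_rpow _).contDiffAt.of_le (by norm_cast)), laplacian_bracket_rpow,
    smul_eq_mul, show 2 - α - 2 = -α by ring, show 2 - α - 4 = -α - 2 by ring]
  have hsplit : bracket x ^ (-α - 2) = damping α x / bracket x ^ 2 := by
    rw [Real.rpow_sub hb, damping]
    norm_num
  have hx : ‖x‖ ^ 2 / bracket x ^ 2 ≤ 1 := by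
    rw [div_le_one (by positivity), bracket_sq]; linarith
  rw [hsplit, ← damping]
  calc _ = (1 / ((2 - α) ^ 2 * (2 + δ)) / (1 + t)) *
        ((2 - α) * damping α x * (n - α * 1)) := by
        field_simp
    _ ≤ (1 / ((2 - α) ^ 2 * (2 + δ)) / (1 + t)) *
        ((2 - α) * damping α x * (n - α * (‖x‖ ^ 2 / bracket x ^ 2))) := by gcongr
    _ = _ := by
        field_simp
        ring

end Bracket

/-! ### Logarithmic cutoffs -/

section Cutoff

variable {n : ℕ}

/-- A cutoff that is `1` on `⟨x⟩ ≤ e^R` and `0` on `⟨x⟩ ≥ e^{2R}`. The transition takes place on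
the logarithmic scale, so that `⟨x⟩ |∇χ_R(x)|` is of size `1/R`. -/
noncomputable def logCutoff (R : ℝ) (x : Rn n) : ℝ :=
  1 - Real.smoothTransition (Real.log (bracket x) / R - 1)

theorem logCutoff_nonneg (R : ℝ) (x : Rn n) : 0 ≤ logCutoff R x :=
  sub_nonneg.2 (Real.smoothTransition.le_one _)

theorem logCutoff_le_one (R : ℝ) (x : Rn n) : logCutoff R x ≤ 1 :=
  sub_le_self _ (Real.smoothTransition.nonneg _)

theorem contDiff_log_bracket : ContDiff ℝ ∞ fun x : Rn n => Real.log (bracket x) :=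
  contDiff_bracket.log fun x => (bracket_pos x).ne'

theorem contDiff_logCutoff (R : ℝ) : ContDiff ℝ ∞ (logCutoff R : Rn n → ℝ) :=
  contDiff_const.sub (Real.smoothTransition.contDiff.comp
    ((contDiff_log_bracket.div_const R).sub contDiff_const))

theorem log_bracket_nonneg (x : Rn n) : 0 ≤ Real.log (bracket x) :=
  Real.log_nonneg (one_le_bracket x)

theorem logCutoff_mono {r R : ℝ} (hr : 0 < r) (hR : r ≤ R) (x : Rn n) :
    logCutoff r x ≤ logCutoff R x := by
  have := log_bracket_nonneg x
  unfold logCutoff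
  gcongr
  apply Real.smoothTransition.monotone
  gcongr

theorem logCutoff_eq_one {R : ℝ} (hR : 0 < R) {x : Rn n} (hx : Real.log (bracket x) ≤ R) :
    logCutoff R x = 1 := by
  unfold logCutoff
  rw [Real.smoothTransition.zero_of_nonpos, sub_zero]
  rw [sub_nonpos, div_le_one hR]
  exact hx

theorem logCutoff_eq_zero {R : ℝ} (hR : 0 < R) {x : Rn n} (hx : 2 * R ≤ Real.log (bracket x)) :
    logCutoff R x = 0 := by
  unfold logCutoff
  rw [Real.smoothTransition.one_of_one_le, sub_self]
  rw [le_sub_iff_add_le, le_div_iff₀ hR]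
  linarith

theorem logCutoff_vanish {R : ℝ} (hR : 0 < R) {x : Rn n} (hx : Real.exp (2 * R) < ‖x‖) :
    logCutoff R x = 0 := by
  apply logCutoff_eq_zero hR
  rw [Real.le_log_iff_exp_le (bracket_pos x)]
  exact hx.le.trans (norm_le_bracket x)

theorem exists_abs_deriv_smoothTransition_le :
    ∃ M : ℝ, 0 < M ∧ ∀ s, |deriv Real.smoothTransition s| ≤ M := by
  have hc : Continuous (deriv Real.smoothTransition) :=
    (Real.smoothTransition.contDiff (n := 1)).continuous_deriv (by simp)
  have h0 : ∀ s ∉ Icc (0 : ℝ) 1, deriv Real.smoothTransition s = 0 := by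
    intro s hs
    rw [mem_Icc, not_and_or, not_le, not_le] at hs
    have : ∃ c : ℝ, Real.smoothTransition =ᶠ[nhds s] fun _ => c := by
      rcases hs with hs | hs
      · refine ⟨0, ?_⟩
        filter_upwards [Iio_mem_nhds hs] with r hr
        exact Real.smoothTransition.zero_of_nonpos (le_of_lt hr)
      · refine ⟨1, ?_⟩
        filter_upwards [Ioi_mem_nhds hs] with r hr
        exact Real.smoothTransition.one_of_one_le (le_of_lt hr)
    obtain ⟨c, hc⟩ := this
    rw [hc.deriv_eq, deriv_const]
  obtain ⟨M, hM⟩ := (HasCompactSupport.intro isCompact_Icc h0).exists_bound_of_continuous hc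
  exact ⟨max M 1, by positivity, fun s => (hM s).trans (le_max_left _ _)⟩

/-- The gradient of `χ_R` is of size `1 / (R⟨x⟩)`, and it is supported where `χ_{2R} = 1`. -/
theorem exists_norm_gradient_logCutoff_le (n : ℕ) : ∃ M : ℝ, 0 < M ∧
    ∀ R : ℝ, 0 < R → ∀ x : Rn n, ‖∇ (logCutoff R) x‖ * bracket x ≤ M / R * logCutoff (2 * R) x := by
  obtain ⟨M, hM0, hM⟩ := exists_abs_deriv_smoothTransition_le
  refine ⟨M, hM0, fun R hR x => ?_⟩
  have hb := bracket_pos x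
  by_cases hx : Real.log (bracket x) ≤ 2 * R
  · rw [logCutoff_eq_one (by positivity) hx, mul_one]
    have h1 : HasDerivAt (fun s : ℝ => 1 - Real.smoothTransition (Real.log s / R - 1))
        (-(deriv Real.smoothTransition (Real.log (bracket x) / R - 1) * ((bracket x)⁻¹ / R)))
        (bracket x) := by
      have h2 := ((Real.hasDerivAt_log hb.ne').div_const R).sub_const 1
      have h3 := ((Real.smoothTransition.contDiff (n := 1)).differentiable (by simp)
        (Real.log (bracket x) / R - 1)).hasDerivAt
      exact (h3.comp (bracket x) h2).const_sub 1
    have h4 := gradient_comp (f := bracket) h1 (contDiff_bracket.differentiable (by simp) x)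
    have h5 : ∇ (bracket : Rn n → ℝ) x = (bracket x)⁻¹ • x := by
      have := gradient_bracket_rpow (n := n) 1 x
      simp only [Real.rpow_one] at this
      rw [this]
      norm_num [Real.rpow_neg_one]
    change ‖∇ (fun y => 1 - Real.smoothTransition (Real.log (bracket y) / R - 1)) x‖ * _ ≤ _
    rw [h4, h5, norm_smul, norm_smul, norm_neg, norm_mul, Real.norm_eq_abs, Real.norm_eq_abs,
      Real.norm_eq_abs, abs_of_nonneg (by positivity : 0 ≤ (bracket x)⁻¹ / R),
      abs_of_nonneg (by positivity : 0 ≤ (bracket x)⁻¹)]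
    calc _ ≤ M * ((bracket x)⁻¹ / R) * ((bracket x)⁻¹ * bracket x) * bracket x := by
          gcongr
          · exact hM _
          · exact norm_le_bracket x
      _ = M / R := by field_simp
  · have h0 : logCutoff R =ᶠ[nhds x] fun _ => (0 : ℝ) := by
      have : {y : Rn n | 2 * R < Real.log (bracket y)} ∈ nhds x :=
        (isOpen_lt continuous_const contDiff_log_bracket.continuous).mem_nhds (not_le.1 hx)
      filter_upwards [this] with y hy
      exact logCutoff_eq_zero hR (le_of_lt hy)
    rw [h0.gradient_eq, gradient_fun_const, norm_zero, zero_mul]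
    have := logCutoff_nonneg (2 * R) x
    positivity

end Cutoff

/-! ### The damped wave equation: energy inequality and finite speed of propagation -/

/-- `w` is a smooth solution of `w_tt - Δw + a w_t = 0` on `[0,∞) × ℝⁿ`, with no condition on the
data. -/
structure IsWave {n : ℕ} (α : ℝ) (w : ℝ → Rn n → ℝ) : Prop where
  smooth : SmoothFrom 0 w
  equation : ∀ t : ℝ, 0 < t → ∀ x : Rn n,
    dTime 0 (dTime 0 w) t x - (Δ (w t)) x + damping α x * dTime 0 w t x = 0

section Wave

variable {n : ℕ} {α : ℝ} {w : ℝ → Rn n → ℝ}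

theorem IsWave.deriv_time (hw : IsWave α w) : IsWave α (dTime 0 w) where
  smooth := hw.smooth.deriv_time
  equation t ht x := by
    have h1 := hw.smooth.deriv_time.deriv_time.hasDerivAt ht x
    have h2 := hw.smooth.laplacian.hasDerivAt ht x
    have h3 := (hw.smooth.deriv_time.hasDerivAt ht x).const_mul (damping α x)
    rw [hw.smooth.dTime_laplacian ht x] at h2
    have h4 := (h1.sub h2).add h3
    refine h4.unique ((hasDerivAt_const t (0 : ℝ)).congr_of_eventuallyEq ?_)
    filter_upwards [Ioi_mem_nhds ht] with s hs
    exact hw.equation s hs x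

/-- The weighted energy inequality for the damped wave equation. The density combines the
multipliers `ρ₁ w_t` and `ρ₂ w`; the function `ψ` enters through the divergence of
`ρ₂ w² ∇ψ`, which has integral zero. -/
theorem IsWave.integral_energy_le (hw : IsWave α w) {T R : ℝ} (hT : 0 ≤ T)
    {ρ₁ ρ₂ ψ G : ℝ → Rn n → ℝ} (hρ₁ : SmoothFrom 0 ρ₁) (hρ₂ : SmoothFrom 0 ρ₂)
    (hψ : SmoothFrom 0 ψ) (hG : SmoothFrom 0 G)
    (hz : ∀ t ∈ Icc 0 T, ∀ x, R < ‖x‖ →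
      (w t x = 0 ∧ dTime 0 w t x = 0 ∧ ∇ (w t) x = 0) ∨ (ρ₁ t x = 0 ∧ ρ₂ t x = 0))
    (hG0 : ∀ t ∈ Ioo 0 T, ∀ x, R < ‖x‖ → G t x = 0)
    (h : ∀ t ∈ Ioo 0 T, ∀ x,
      1 / 2 * dTime 0 ρ₁ t x * (dTime 0 w t x ^ 2 + ‖∇ (w t) x‖ ^ 2)
        - ρ₁ t x * damping α x * dTime 0 w t x ^ 2
        - dTime 0 w t x * inner ℝ (∇ (ρ₁ t) x) (∇ (w t) x)
        + dTime 0 ρ₂ t x * (w t x * dTime 0 w t x + damping α x * w t x ^ 2 / 2)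
        + ρ₂ t x * dTime 0 w t x ^ 2 - ρ₂ t x * ‖∇ (w t) x‖ ^ 2
        - w t x * inner ℝ (∇ (ρ₂ t) x) (∇ (w t) x)
        - ρ₂ t x * w t x ^ 2 * (Δ (ψ t)) x - w t x ^ 2 * inner ℝ (∇ (ρ₂ t) x) (∇ (ψ t) x)
        - 2 * ρ₂ t x * w t x * inner ℝ (∇ (w t) x) (∇ (ψ t) x) ≤ G t x) :
    ∫ x, (1 / 2 * ρ₁ T x * (dTime 0 w T x ^ 2 + ‖∇ (w T) x‖ ^ 2)
        + ρ₂ T x * (w T x * dTime 0 w T x + damping α x * w T x ^ 2 / 2))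
      ≤ (∫ x, (1 / 2 * ρ₁ 0 x * (dTime 0 w 0 x ^ 2 + ‖∇ (w 0) x‖ ^ 2)
        + ρ₂ 0 x * (w 0 x * dTime 0 w 0 x + damping α x * w 0 x ^ 2 / 2)))
        + ∫ p in slab n 0 T, G p.1 p.2 := by
  have hs := hw.smooth
  have hP := hs.deriv_time
  have ha : SmoothFrom 0 fun _ (x : Rn n) => damping α x := .of_space (contDiff_damping α)
  refine integral_le_of_dTime_le
    (F := fun t x => 1 / 2 * ρ₁ t x * (dTime 0 w t x ^ 2 + ‖∇ (w t) x‖ ^ 2)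
      + ρ₂ t x * (w t x * dTime 0 w t x + damping α x * w t x ^ 2 / 2)) (R := R)
    (f₁ := fun t x => ρ₁ t x * dTime 0 w t x + ρ₂ t x * w t x) (g₁ := w)
    (f₂ := fun t x => ρ₂ t x * (w t x * w t x)) (g₂ := ψ) hT ?_ hG
    ((hρ₁.mul hP).add (hρ₂.mul hs)) hs (hρ₂.mul (hs.mul hs)) hψ ?_ hG0 ?_ ?_ ?_
  · have h1 := ((hρ₁.const_mul (1 / 2)).mul ((hP.pow 2).add hs.norm_gradient_sq)).add
      (hρ₂.mul ((hs.mul hP).add (((ha.mul (hs.pow 2)).const_mul (1 / 2)))))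
    exact h1.congr fun t _ x => by ring
  · intro t ht x hx
    rcases hz t ht x hx with ⟨h1, h2, h3⟩ | ⟨h1, h2⟩ <;> simp [*]
  · intro t ht x hx
    rcases hz t (Ioo_subset_Icc_self ht) x hx with ⟨h1, h2, h3⟩ | ⟨h1, h2⟩ <;> simp [*]
  · intro t ht x hx
    rcases hz t (Ioo_subset_Icc_self ht) x hx with ⟨h1, h2, h3⟩ | ⟨h1, h2⟩ <;> simp [*]
  · intro t ht x
    have d1 := hρ₁.hasDerivAt ht.1 x
    have d2 := hρ₂.hasDerivAt ht.1 x
    have dw := hs.hasDerivAt ht.1 x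
    have dP := hP.hasDerivAt ht.1 x
    have dg := hs.hasDerivAt_norm_gradient_sq ht.1 x
    have hd := (((d1.const_mul (1 / 2)).mul ((dP.pow 2).add dg)).add
      (d2.mul ((dw.mul dP).add (((dw.pow 2).const_mul (damping α x)).div_const 2))))
    refine ⟨_, hd, ?_⟩
    have e1 : ∇ (fun x => ρ₁ t x * dTime 0 w t x + ρ₂ t x * w t x) x
        = ρ₁ t x • ∇ (dTime 0 w t) x + dTime 0 w t x • ∇ (ρ₁ t) x
          + (ρ₂ t x • ∇ (w t) x + w t x • ∇ (ρ₂ t) x) := by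
      have k1 := hρ₁.differentiable_slice ht.1.le x
      have k2 := hρ₂.differentiable_slice ht.1.le x
      have k3 := hs.differentiable_slice ht.1.le x
      have k4 := hP.differentiable_slice ht.1.le x
      rw [gradient_add (k1.fun_mul k4) (k2.fun_mul k3), gradient_mul k1 k4, gradient_mul k2 k3]
    have e2 : ∇ (fun x => ρ₂ t x * (w t x * w t x)) x
        = ρ₂ t x • (w t x • ∇ (w t) x + w t x • ∇ (w t) x)
          + (w t x * w t x) • ∇ (ρ₂ t) x := by
      have k2 := hρ₂.differentiable_slice ht.1.le x
      have k3 := hs.differentiable_slice ht.1.le x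
      rw [gradient_mul k2 (k3.fun_mul k3), gradient_mul k3 k3]
    have heq := hw.equation t ht.1 x
    have hle := h t ht x
    rw [e1, e2]
    simp only [inner_add_left, real_inner_smul_left, real_inner_self_eq_norm_sq, Pi.pow_apply,
      Pi.mul_apply, Pi.add_apply]
    have hP' : dTime 0 (dTime 0 w) t x
        = (Δ (w t)) x - damping α x * dTime 0 w t x := by linarith
    rw [hP']
    refine le_trans (le_of_eq ?_) (add_le_add_left (add_le_add_left hle _) _)
    push_cast
    ring

/-- Finite speed of propagation, by the energy in a smoothed backward light cone. -/
theorem IsWave.eq_zero_of_lt_norm (hw : IsWave α w) {L : ℝ} (h0 : ∀ x, L < ‖x‖ → w 0 x = 0)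
    (h1 : ∀ x, L < ‖x‖ → dTime 0 w 0 x = 0) {t : ℝ} (ht : 0 ≤ t) {x : Rn n}
    (hx : L + t < ‖x‖) : w t x = 0 := by
  -- The weight `ρ(s,y)` vanishes outside the cone `|y-x| ≤ r - s`, whose base misses the support of
  -- the data, and `ρ(s,x) > 0` for `s ≤ t` because `r - t = 2k > k`.
  set r := ‖x‖ - L with hr
  set k := (r - t) / 2 with hk
  have hkpos : 0 < k := by rw [hk, hr]; linarith
  set c : ℝ → Rn n → ℝ := fun s y => r - s - √(‖y - x‖ ^ 2 + k ^ 2) with hc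
  set ρ : ℝ → Rn n → ℝ := fun s y => Real.smoothTransition (c s y) with hρ
  have hsq : ContDiff ℝ ∞ fun y : Rn n => √(‖y - x‖ ^ 2 + k ^ 2) :=
    ContDiff.sqrt (((contDiff_norm_sq ℝ).comp (contDiff_id.sub contDiff_const)).add
      contDiff_const) fun y => by positivity
  have hcs : SmoothFrom 0 c :=
    ((SmoothFrom.of_time (f := fun s => r - s) (by fun_prop)).sub (SmoothFrom.of_space hsq))
  have hρs : SmoothFrom 0 ρ :=
    (Real.smoothTransition.contDiff (n := ⊤)).comp_contDiffOn hcs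
  have hdist : ∀ y : Rn n, ‖y - x‖ ≤ √(‖y - x‖ ^ 2 + k ^ 2) := fun y =>
    Real.le_sqrt_of_sq_le (by nlinarith [sq_nonneg k])
  have hvel : ∀ T, 0 ≤ T → T ≤ t → dTime 0 w T x = 0 := by
    intro T hT hTt
    have hst : Differentiable ℝ Real.smoothTransition :=
      (Real.smoothTransition.contDiff (n := 1)).differentiable (by simp)
    have key := hw.integral_energy_le (T := T) (R := ‖x‖ + r) (ρ₁ := ρ) (ρ₂ := fun _ _ => 0)
      (ψ := fun _ _ => 0) (G := fun _ _ => 0) hT hρs (.const 0) (.const 0) (.const 0)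
      (by
        intro s hs y hy
        refine Or.inr ⟨Real.smoothTransition.zero_of_nonpos ?_, rfl⟩
        have h2 : ‖y‖ ≤ ‖y - x‖ + ‖x‖ := norm_le_norm_sub_add y x
        have h3 := hdist y
        have h4 := hs.1
        simp only [hc]
        linarith)
      (fun _ _ _ _ => rfl)
      (by
        intro s hs y
        set D := deriv Real.smoothTransition (c s y) with hD
        have hD0 : 0 ≤ D := Real.smoothTransition.monotone.deriv_nonneg
        set q := √(‖y - x‖ ^ 2 + k ^ 2) with hq
        have hq0 : 0 < q := Real.sqrt_pos.2 (by positivity)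
        have e1 : dTime 0 ρ s y = -D := by
          apply SmoothFrom.dTime_eq_of_hasDerivAt hs.1
          have h2 : HasDerivAt (fun s => c s y) (-1) s :=
            ((hasDerivAt_id s).const_sub r).sub_const _
          have h3 : HasDerivAt (fun s => Real.smoothTransition (c s y)) (D * -1) s :=
            HasDerivAt.comp (h₂ := Real.smoothTransition) (h := fun s => c s y) s
              (hst (c s y)).hasDerivAt h2
          exact h3.congr_deriv (by ring)
        have e2 : ∇ (ρ s) y = (-(D / q)) • (y - x) := by
          have h2 : HasDerivAt (fun z => Real.smoothTransition (r - s - √(z + k ^ 2)))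
              (D * -(1 / (2 * q))) (‖y - x‖ ^ 2) := by
            have h3 : HasDerivAt (fun z : ℝ => z + k ^ 2) 1 (‖y - x‖ ^ 2) :=
              (hasDerivAt_id _).add_const _
            have h4 := (h3.sqrt (by positivity)).const_sub (r - s)
            have h5 : HasDerivAt Real.smoothTransition D (r - s - √(‖y - x‖ ^ 2 + k ^ 2)) :=
              (hst (c s y)).hasDerivAt
            exact h5.comp (‖y - x‖ ^ 2) h4
          have h3 : ∇ (fun z : Rn n => ‖z - x‖ ^ 2) y = (2 : ℝ) • (y - x) := by
            rw [← gradient_norm_sq]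
            ext i
            rw [gradient_apply, gradient_apply, fderiv_comp_sub (f := fun z : Rn n => ‖z‖ ^ 2)]
          have h5 : DifferentiableAt ℝ (fun z : Rn n => ‖z - x‖ ^ 2) y :=
            (((contDiff_norm_sq ℝ).comp (contDiff_id.sub contDiff_const)).differentiable
              (n := 1) (by simp)) y
          have h4 := gradient_comp (f := fun z : Rn n => ‖z - x‖ ^ 2) h2 h5
          refine h4.trans ?_
          rw [h3, smul_smul]
          congr 1
          field_simp
        have e3 : |inner ℝ (∇ (ρ s) y) (∇ (w s) y)| ≤ D * ‖∇ (w s) y‖ := by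
          refine (abs_real_inner_le_norm _ _).trans ?_
          gcongr
          rw [e2, norm_smul, norm_neg, Real.norm_eq_abs, abs_of_nonneg (by positivity),
            div_mul_eq_mul_div, div_le_iff₀ hq0]
          gcongr
          exact hdist y
        have e4 : |dTime 0 w s y * inner ℝ (∇ (ρ s) y) (∇ (w s) y)|
            ≤ D * (|dTime 0 w s y| * ‖∇ (w s) y‖) := by
          rw [abs_mul]
          calc _ ≤ |dTime 0 w s y| * (D * ‖∇ (w s) y‖) := by gcongr
            _ = _ := by ring
        have e5 := neg_abs_le (dTime 0 w s y * inner ℝ (∇ (ρ s) y) (∇ (w s) y))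
        have e6 : 0 ≤ ρ s y * damping α y * dTime 0 w s y ^ 2 := by
          have := (damping_pos α y).le
          have := Real.smoothTransition.nonneg (c s y)
          positivity
        have e7 : 0 ≤ D * (|dTime 0 w s y| - ‖∇ (w s) y‖) ^ 2 := by positivity
        have e8 := sq_abs (dTime 0 w s y)
        have e9 : dTime 0 (fun _ (_ : Rn n) => (0 : ℝ)) s y = 0 :=
          SmoothFrom.dTime_eq_of_hasDerivAt hs.1 (hasDerivAt_const s 0)
        simp only [e1, e9, gradient_fun_const, inner_zero_left, inner_zero_right]
        rw [← e8] at e6 ⊢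
        nlinarith)
    have hzero : ∀ y, 1 / 2 * ρ 0 y * (dTime 0 w 0 y ^ 2 + ‖∇ (w 0) y‖ ^ 2) = 0 := by
      intro y
      by_cases hy : L < ‖y‖
      · rw [h1 y hy, gradient_eq_zero_of_vanish h0 hy]
        simp
      · have : ρ 0 y = 0 := by
          refine Real.smoothTransition.zero_of_nonpos ?_
          have h2 : ‖x‖ - ‖y‖ ≤ ‖y - x‖ := by
            rw [norm_sub_rev]; exact norm_sub_norm_le x y
          have h3 := hdist y
          simp only [hc]
          linarith
        rw [this]
        ring
    simp only [zero_mul, add_zero, hzero, integral_zero] at key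
    set E : Rn n → ℝ := fun y => 1 / 2 * ρ T y * (dTime 0 w T y ^ 2 + ‖∇ (w T) y‖ ^ 2)
      with hE
    have hEc : Continuous E :=
      (((hρs.const_mul (1 / 2)).mul ((hw.smooth.deriv_time.pow 2).add
        hw.smooth.norm_gradient_sq)).contDiff_slice hT).continuous
    have hE0 : ∀ y, 0 ≤ E y := fun y => by
      have := Real.smoothTransition.nonneg (c T y)
      simp only [hE, hρ]
      positivity
    have hEv : ∀ y, ‖x‖ + r < ‖y‖ → E y = 0 := fun y hy => by
      have : ρ T y = 0 := by
        refine Real.smoothTransition.zero_of_nonpos ?_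
        have h2 : ‖y‖ ≤ ‖y - x‖ + ‖x‖ := norm_le_norm_sub_add y x
        have h3 := hdist y
        simp only [hc]
        linarith
      simp only [hE, this]
      ring
    have hint : ∫ y, E y = 0 := le_antisymm key (integral_nonneg hE0)
    rw [integral_eq_zero_iff_of_nonneg hE0 (integrable_of_vanish hEc hEv),
      hEc.ae_eq_iff_eq volume continuous_zero] at hint
    have hEx : E x = 0 := congrFun hint x
    have hρx : 0 < ρ T x := by
      apply Real.smoothTransition.pos_of_pos
      simp only [hc, sub_self, norm_zero]
      rw [zero_pow two_ne_zero, zero_add, Real.sqrt_sq hkpos.le]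
      linarith
    by_contra hne
    have : 0 < E x := by
      simp only [hE]
      positivity
    linarith
  -- Along the line through `x` the velocity vanishes, so `w` keeps its initial value `0`.
  have hconst := constant_of_has_deriv_right_zero (f := fun s => w s x) (a := 0) (b := t)
    ((hw.smooth.continuousOn_time x).mono Icc_subset_Ici_self) ?_ t ⟨ht, le_rfl⟩
  · exact hconst.trans (h0 x (by linarith))
  · intro s hs
    have hd : DifferentiableWithinAt ℝ (fun s => w s x) (Ici 0) s := by
      have hC : ContDiffOn ℝ ∞ (fun s => w s x) (Ici 0) :=
        ContDiffOn.comp (g := fun p : ℝ × Rn n => w p.1 p.2) (f := fun s => (s, x)) hw.smooth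
          (contDiff_id.prodMk contDiff_const).contDiffOn (fun s hs => ⟨hs, mem_univ _⟩)
      exact hC.differentiableOn (by simp) s hs.1
    have h2 := hd.hasDerivWithinAt
    have h3 := hvel s hs.1 hs.2.le
    rw [dTime] at h3
    rw [h3] at h2
    exact h2.mono (Ici_subset_Ici.2 hs.1)

/-- The support of a function of `(t,x)` lies in the forward light cone `|x| ≤ L + t`. -/
def SupportedInCone (L : ℝ) (w : ℝ → Rn n → ℝ) : Prop :=
  ∀ t, 0 ≤ t → ∀ x, L + t < ‖x‖ → w t x = 0

theorem SupportedInCone.deriv_time {L : ℝ} (h : SupportedInCone L w) :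
    SupportedInCone L (dTime 0 w) := by
  intro t ht x hx
  have : HasDerivWithinAt (fun s => w s x) 0 (Ici 0) t := by
    refine (hasDerivWithinAt_const t _ (0 : ℝ)).congr_of_eventuallyEq ?_ (h t ht x hx)
    have hlt : t < ‖x‖ - L := by linarith
    filter_upwards [self_mem_nhdsWithin, mem_nhdsWithin_of_mem_nhds (Iio_mem_nhds hlt)]
      with s hs hs'
    have : s < ‖x‖ - L := hs'
    exact h s hs x (by linarith)
  exact this.derivWithin (uniqueDiffOn_Ici 0 t ht)

end Wave

/-! ### The space-time weight and the pointwise dissipation inequalities -/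

/-- The weight `(t₀+t)^q e^{2ψ(t,x)}`. -/
noncomputable def expWeight {n : ℕ} (α δ t₀ q t : ℝ) (x : Rn n) : ℝ :=
  (t₀ + t) ^ q * Real.exp (2 * weightPsi α δ t x)

section Weight

variable {n : ℕ} {α δ t₀ q τ t : ℝ}

theorem expWeight_pos (ht : 0 < t₀ + t) (x : Rn n) : 0 < expWeight α δ t₀ q t x :=
  mul_pos (Real.rpow_pos_of_pos ht _) (Real.exp_pos _)

theorem smoothFrom_expWeight (hτ : 0 ≤ τ) (ht₀ : 0 < t₀) :
    SmoothFrom (n := n) τ (expWeight α δ t₀ q) := by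
  have h1 : ContDiffOn ℝ ∞ (fun t : ℝ => (t₀ + t) ^ q) (Ici τ) :=
    ContDiffOn.rpow_const_of_ne (by fun_prop) fun t ht => by
      have : τ ≤ t := ht
      linarith
  exact (SmoothFrom.of_time h1).mul ((smoothFrom_weightPsi hτ).const_mul 2).exp

theorem hasDerivAt_expWeight (ht₀ : 0 < t₀) (ht : 0 ≤ t) (x : Rn n) :
    HasDerivAt (fun s => expWeight α δ t₀ q s x)
      (expWeight α δ t₀ q t x * (q / (t₀ + t) - 2 * (weightPsi α δ t x / (1 + t)))) t := by
  have hs : 0 < t₀ + t := by linarith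
  have h1 : HasDerivAt (fun s : ℝ => (t₀ + s) ^ q) (1 * q * (t₀ + t) ^ (q - 1)) t :=
    ((hasDerivAt_id t).const_add t₀).rpow_const (Or.inl hs.ne')
  have h2 := ((hasDerivAt_weightPsi (α := α) (δ := δ) ht x).const_mul 2).exp
  refine (h1.mul h2).congr_deriv ?_
  unfold expWeight
  rw [Real.rpow_sub_one hs.ne']
  field_simp
  ring

theorem gradient_expWeight (ht : 0 ≤ t) (x : Rn n) :
    ∇ (expWeight α δ t₀ q t) x = (2 * expWeight α δ t₀ q t x) • ∇ (weightPsi α δ t) x := by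
  have h1 : HasDerivAt (fun s : ℝ => (t₀ + t) ^ q * Real.exp (2 * s))
      ((t₀ + t) ^ q * (Real.exp (2 * weightPsi α δ t x) * (2 * 1))) (weightPsi α δ t x) :=
    (((hasDerivAt_id _).const_mul 2).exp).const_mul _
  have h2 := gradient_comp (f := weightPsi α δ t) h1
    ((smoothFrom_weightPsi le_rfl).differentiable_slice ht x)
  refine h2.trans ?_
  unfold expWeight
  congr 1
  ring

theorem expWeight_add (hs : 0 < t₀ + t) (r : ℝ) (x : Rn n) :
    expWeight α δ t₀ (q + r) t x = expWeight α δ t₀ q t x * (t₀ + t) ^ r := by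
  unfold expWeight
  rw [Real.rpow_add hs]
  ring

theorem expWeight_sub_one (hs : 0 < t₀ + t) (x : Rn n) :
    expWeight α δ t₀ (q - 1) t x = expWeight α δ t₀ q t x / (t₀ + t) := by
  unfold expWeight
  rw [Real.rpow_sub_one hs.ne']
  ring

end Weight

section Pointwise

/-- The first multiplier: the cross term with `∇ψ` is absorbed by half of the damping and by
`-∂ₜψ`. Here `m = -∂ₜψ` and `d = |∇ψ|`. -/
theorem abs_velocity_cross_le {a m d g P X : ℝ} (ha : 0 < a)
    (hd : 2 * d ^ 2 ≤ a * m) (hX : |X| ≤ d * g) :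
    2 * |P * X| ≤ a * P ^ 2 / 2 + m * g ^ 2 := by
  rw [abs_mul]
  have h1 : 2 * (|P| * |X|) ≤ 2 * |P| * (d * g) := by nlinarith [abs_nonneg P]
  have h2 : (2 * |P| * (d * g)) * a ≤ (a * P ^ 2 / 2 + m * g ^ 2) * a := by
    have := sq_nonneg (a * |P| - 2 * d * g)
    have h3 : 2 * d ^ 2 * g ^ 2 ≤ a * m * g ^ 2 := by gcongr
    rw [← sq_abs P]
    nlinarith
  exact h1.trans (le_of_mul_le_mul_right h2 ha)

/-- The second multiplier: `|∇w|² + 4 w ∇ψ·∇w + 2|∇ψ|²w² - (∂ₜψ) a w²` is coercive, because of the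
slack `(2+δ)|∇ψ|² ≤ -a ∂ₜψ`. -/
theorem quadraticForm_coercive {δ a m d g W X : ℝ} (hδ : 0 < δ) (hδ1 : δ ≤ 1)
    (hd : (2 + δ) * d ^ 2 ≤ a * m) (hX : |X| ≤ d * g) :
    δ / 16 * g ^ 2 + δ / 16 * (m * a * W ^ 2)
      ≤ g ^ 2 + 4 * (W * X) + 2 * d ^ 2 * W ^ 2 + m * a * W ^ 2 := by
  have h1 : -(|W| * (d * g)) ≤ W * X := by
    have h2 : |W * X| ≤ |W| * (d * g) := by
      rw [abs_mul]; gcongr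
    linarith [neg_abs_le (W * X)]
  have h3 : (2 + δ) * d ^ 2 * W ^ 2 ≤ a * m * W ^ 2 := by gcongr
  have h4 : 0 ≤ ((1 - δ / 16) * g - 2 * (d * |W|)) ^ 2 := sq_nonneg _
  have h5 := sq_abs W
  have h6 : 0 ≤ d ^ 2 * W ^ 2 := by positivity
  -- It suffices to prove the inequality multiplied by `1 - δ/16`
  have h7 : 0 < 1 - δ / 16 := by linarith
  have h8 : 4 ≤ (1 - δ / 16) * (2 + (1 - δ / 16) * (2 + δ)) := by
    nlinarith [mul_nonneg hδ.le (sub_nonneg.2 hδ1), pow_pos hδ 3]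
  have h9 : 4 * (d ^ 2 * W ^ 2) ≤ (1 - δ / 16) * (2 * (d ^ 2 * W ^ 2)
      + (1 - δ / 16) * (m * a * W ^ 2)) := by
    calc 4 * (d ^ 2 * W ^ 2) ≤ (1 - δ / 16) * (2 + (1 - δ / 16) * (2 + δ)) * (d ^ 2 * W ^ 2) := by
          gcongr
      _ = (1 - δ / 16) * (2 * (d ^ 2 * W ^ 2)
          + (1 - δ / 16) * ((2 + δ) * d ^ 2 * W ^ 2)) := by ring
      _ ≤ (1 - δ / 16) * (2 * (d ^ 2 * W ^ 2) + (1 - δ / 16) * (a * m * W ^ 2)) := by gcongr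
      _ = _ := by ring
  have h10 : 0 ≤ (1 - δ / 16) * ((1 - δ / 16) * g ^ 2 - 4 * (|W| * (d * g)) + 2 * d ^ 2 * W ^ 2
      + (1 - δ / 16) * (m * a * W ^ 2)) := by
    have e : d ^ 2 * W ^ 2 = d ^ 2 * |W| ^ 2 := by rw [h5]
    nlinarith
  have h11 := nonneg_of_mul_nonneg_right h10 h7
  linarith

/-- The pointwise dissipation inequality behind the combined multiplier
`(t₀+t)^{p+α} w_t + ν (t₀+t)^p w`. The letters stand for `S = t₀+t`, `Sα = S^α`, `P = w_t`,
`W = w`, `g = |∇w|`, `X = ∇ψ·∇w`, `m = -∂ₜψ`, `d = |∇ψ|`, `Λ = Δψ`. -/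
theorem combined_dissipation {α p δ η β ν θ a m d g P W X Λ S Sα : ℝ}
    (hα0 : 0 ≤ α) (hp : 0 ≤ p) (hδ : 0 < δ) (hδ1 : δ ≤ 1) (hη : 0 < η)
    (hν : 0 < ν) (hν1 : ν ≤ δ / 16) (hν2 : ν * (1 + p ^ 2 / (4 * η)) ≤ 1 / 8)
    (hθ1 : θ * (p + α) ≤ 1 / 4) (hθ2 : θ * (p + α) ≤ ν * (δ / 16)) (hθ3 : θ ≤ 1)
    (ha : 0 < a) (hm : 0 ≤ m) (hd : (2 + δ) * d ^ 2 ≤ a * m)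
    (hX : |X| ≤ d * g) (hS : 0 < S) (hSα : 0 < Sα) (haS : 1 ≤ Sα * a) (hSθ : Sα / S ≤ θ)
    (hΛ : β * (a / S) ≤ Λ) :
    Sα * (1 / 2 * ((p + α) / S - 2 * m) * (P ^ 2 + g ^ 2) - a * P ^ 2 - 2 * (P * X))
      + ν * ((p / S - 2 * m) * (W * P + a * W ^ 2 / 2) + P ^ 2 - g ^ 2 - 2 * (W * X)
        - W ^ 2 * Λ - 2 * d ^ 2 * W ^ 2 - 2 * (W * X))
      ≤ ν * (p / 2 - β + η) * (a * W ^ 2 / S) - ν * (δ / 16) / 2 * g ^ 2 := by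
  have hd2 : 2 * d ^ 2 ≤ a * m := by nlinarith [sq_nonneg d]
  have k1 := abs_velocity_cross_le (P := P) ha hd2 hX
  have k1' : -(2 * (P * X)) ≤ a * P ^ 2 / 2 + m * g ^ 2 := by
    linarith [neg_abs_le (P * X)]
  have k2 := quadraticForm_coercive (W := W) hδ hδ1 hd hX
  have hP1 : P ^ 2 ≤ Sα * a * P ^ 2 := le_mul_of_one_le_left (sq_nonneg P) haS
  have hpα : 0 ≤ p + α := by linarith
  have k3 : Sα * ((p + α) / S) ≤ θ * (p + α) := by
    calc Sα * ((p + α) / S) = Sα / S * (p + α) := by ring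
      _ ≤ _ := by gcongr
  have k4 : 1 / 2 * (Sα * ((p + α) / S)) * P ^ 2 ≤ 1 / 8 * (Sα * a * P ^ 2) := by
    calc _ ≤ 1 / 2 * (1 / 4) * P ^ 2 := by gcongr; exact k3.trans hθ1
      _ ≤ 1 / 2 * (1 / 4) * (Sα * a * P ^ 2) := by gcongr
      _ = _ := by ring
  have k5 : 1 / 2 * (Sα * ((p + α) / S)) * g ^ 2 ≤ ν * (δ / 16) / 2 * g ^ 2 := by
    calc _ ≤ 1 / 2 * (ν * (δ / 16)) * g ^ 2 := by
          gcongr ?_ * g ^ 2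
          exact mul_le_mul_of_nonneg_left (k3.trans hθ2) (by norm_num)
      _ = _ := by ring
  have hinv : 1 / a ≤ Sα := by rw [div_le_iff₀ ha]; exact haS
  have k6 : p / S * (W * P) ≤ η * (a * W ^ 2 / S) + p ^ 2 / (4 * η) * (Sα * a * P ^ 2) := by
    have h1 : p * (W * P) ≤ η * (a * W ^ 2) + p ^ 2 / (4 * η) * (1 / a * P ^ 2) := by
      have h2 : 0 ≤ (2 * η * a * W - p * P) ^ 2 / (4 * η * a) := by positivity
      have h3 : (2 * η * a * W - p * P) ^ 2 / (4 * η * a)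
          = η * (a * W ^ 2) + p ^ 2 / (4 * η) * (1 / a * P ^ 2) - p * (W * P) := by
        field_simp
        ring
      linarith
    have h4 : 1 / a * P ^ 2 / S ≤ Sα * a * P ^ 2 := by
      calc 1 / a * P ^ 2 / S ≤ Sα * P ^ 2 / S := by gcongr
        _ = Sα / S * P ^ 2 := by ring
        _ ≤ 1 * P ^ 2 := by gcongr; exact hSθ.trans hθ3
        _ ≤ _ := by linarith
    calc p / S * (W * P) = p * (W * P) / S := by ring
      _ ≤ (η * (a * W ^ 2) + p ^ 2 / (4 * η) * (1 / a * P ^ 2)) / S := by gcongr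
      _ = η * (a * W ^ 2 / S) + p ^ 2 / (4 * η) * (1 / a * P ^ 2 / S) := by ring
      _ ≤ _ := by gcongr
  have k7 : -(2 * m * (W * P)) ≤ δ / 16 * (m * a * W ^ 2) + 16 / δ * (m * Sα * P ^ 2) := by
    have h1 : -(2 * (W * P)) ≤ δ / 16 * (a * W ^ 2) + 16 / δ * (1 / a * P ^ 2) := by
      have h2 : 0 ≤ (δ / 16 * a * W + P) ^ 2 / (δ / 16 * a) := by positivity
      have h3 : (δ / 16 * a * W + P) ^ 2 / (δ / 16 * a)
          = δ / 16 * (a * W ^ 2) + 16 / δ * (1 / a * P ^ 2) + 2 * (W * P) := by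
        field_simp
        ring
      linarith
    calc -(2 * m * (W * P)) = m * -(2 * (W * P)) := by ring
      _ ≤ m * (δ / 16 * (a * W ^ 2) + 16 / δ * (1 / a * P ^ 2)) := by gcongr
      _ ≤ m * (δ / 16 * (a * W ^ 2) + 16 / δ * (Sα * P ^ 2)) := by gcongr
      _ = _ := by ring
  have k8 : ν * (16 / δ * (m * Sα * P ^ 2)) ≤ Sα * (m * P ^ 2) := by
    have h1 : ν * (16 / δ) ≤ 1 := by
      rw [mul_div_assoc', div_le_one hδ]; linarith
    calc _ = ν * (16 / δ) * (m * Sα * P ^ 2) := by ring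
      _ ≤ 1 * (m * Sα * P ^ 2) := by gcongr
      _ = _ := by ring
  have k9 : ν * (1 + p ^ 2 / (4 * η)) * (Sα * a * P ^ 2) ≤ 1 / 8 * (Sα * a * P ^ 2) := by gcongr
  have k10 : W ^ 2 * (β * (a / S)) ≤ W ^ 2 * Λ := by gcongr
  have e1 := mul_le_mul_of_nonneg_left k1' hSα.le
  have e2 := mul_le_mul_of_nonneg_left k2 hν.le
  have e3 := mul_le_mul_of_nonneg_left k6 hν.le
  have e4 := mul_le_mul_of_nonneg_left k7 hν.le
  have e5 := mul_le_mul_of_nonneg_left k10 hν.le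
  have e6 := mul_le_mul_of_nonneg_left hP1 hν.le
  have e7 : 0 ≤ Sα * a * P ^ 2 := by positivity
  have e8 : p / S * (a * W ^ 2 / 2) = p / 2 * (a * W ^ 2 / S) := by ring
  have e9 : W ^ 2 * (β * (a / S)) = β * (a * W ^ 2 / S) := by ring
  rw [e9] at e5
  have e10 : ν * ((p / S - 2 * m) * (W * P + a * W ^ 2 / 2))
      = ν * (p / S * (W * P)) + ν * -(2 * m * (W * P)) + ν * (p / 2 * (a * W ^ 2 / S))
        - ν * (m * a * W ^ 2) := by
    rw [← e8]; ring
  have e11 : Sα * (1 / 2 * ((p + α) / S - 2 * m) * (P ^ 2 + g ^ 2))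
      = 1 / 2 * (Sα * ((p + α) / S)) * P ^ 2 + 1 / 2 * (Sα * ((p + α) / S)) * g ^ 2
        - Sα * (m * P ^ 2) - Sα * (m * g ^ 2) := by ring
  -- After naming the nonlinear atoms the inequality is linear.
  generalize a * W ^ 2 / S = y at *
  generalize 1 / 2 * (Sα * ((p + α) / S)) * P ^ 2 = u₁ at *
  generalize 1 / 2 * (Sα * ((p + α) / S)) * g ^ 2 = u₂ at *
  generalize p / S * (W * P) = u₃ at *
  generalize p ^ 2 / (4 * η) = c₁ at *
  generalize 16 / δ = c₂ at *
  rw [mul_sub, mul_sub, e11]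
  rw [mul_sub, mul_sub, mul_sub, mul_sub, mul_sub, mul_add, e10]
  linarith

end Pointwise

/-! ### Weighted energy estimates for the damped wave equation -/

/-- The weighted size `∫ e^{2ψ(0,x)} (w² + w_t² + |∇w|²)(0,x) dx` of the data of `w`. -/
noncomputable def dataEnergy {n : ℕ} (α δ : ℝ) (w : ℝ → Rn n → ℝ) : ℝ :=
  ∫ x, Real.exp (2 * weightPsi α δ 0 x) *
    (w 0 x ^ 2 + dTime 0 w 0 x ^ 2 + ‖∇ (w 0) x‖ ^ 2)

section WaveDecay

variable {n : ℕ} {α δ L t₀ T : ℝ} {w : ℝ → Rn n → ℝ}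

theorem dataEnergy_nonneg : 0 ≤ dataEnergy α δ w :=
  integral_nonneg fun x => by positivity

theorem SupportedInCone.vanish (h : SupportedInCone L w) {t : ℝ} (ht : 0 ≤ t) {x : Rn n}
    (hx : L + t < ‖x‖) : w t x = 0 ∧ dTime 0 w t x = 0 ∧ ∇ (w t) x = 0 :=
  ⟨h t ht x hx, h.deriv_time t ht x hx, gradient_eq_zero_of_vanish (h t ht) hx⟩

theorem SupportedInCone.vanish_of_le (h : SupportedInCone L w) {t : ℝ} (ht : 0 ≤ t) (htT : t ≤ T)
    {x : Rn n} (hx : L + T < ‖x‖) : w t x = 0 ∧ dTime 0 w t x = 0 ∧ ∇ (w t) x = 0 :=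
  h.vanish ht (by linarith)

/-- In the cone `|x| ≤ L + t` the damping is bounded below by `(t₀+t)^{-α}`. -/
theorem one_le_rpow_mul_damping (hα0 : 0 ≤ α) {S : ℝ} {x : Rn n} (hx : 1 + ‖x‖ ≤ S) :
    1 ≤ S ^ α * damping α x := by
  have hb := bracket_pos x
  have h1 : bracket x ≤ S := (bracket_le_one_add_norm x).trans hx
  rw [damping, Real.rpow_neg hb.le, ← div_eq_mul_inv, one_le_div (Real.rpow_pos_of_pos hb _)]
  exact Real.rpow_le_rpow hb.le h1 hα0

theorem smoothFrom_dampingSq {τ : ℝ} (hw : SmoothFrom τ w) :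
    SmoothFrom τ fun t x => damping α x * w t x ^ 2 :=
  (SmoothFrom.of_space (contDiff_damping α)).mul (hw.pow 2)

/-- For `α < 1` the growth `S^α` is negligible against `S`. -/
theorem exists_rpow_div_le (hα1 : α < 1) {θ : ℝ} (hθ : 0 < θ) (b : ℝ) :
    ∃ T₀, b ≤ T₀ ∧ ∀ S, T₀ ≤ S → 0 < S → S ^ α / S ≤ θ := by
  have h1 : Filter.Tendsto (fun S : ℝ => S ^ (-(1 - α))) Filter.atTop (nhds 0) :=
    tendsto_rpow_neg_atTop (by linarith)
  obtain ⟨T₁, hT₁⟩ := Filter.eventually_atTop.1 (h1.eventually (Iio_mem_nhds hθ))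
  refine ⟨max b T₁, le_max_left _ _, fun S hS hS0 => ?_⟩
  have h2 := hT₁ S ((le_max_right _ _).trans hS)
  rw [← Real.rpow_sub_one hS0.ne']
  rw [show α - 1 = -(1 - α) by ring]
  exact le_of_lt h2

/-- The combined multiplier estimate: `∫ (t₀+t)^p e^{2ψ} a w²` and the space-time integral of
`(t₀+t)^p e^{2ψ} |∇w|²` are controlled by the data and by the space-time integral of
`(t₀+t)^{p-1} e^{2ψ} a w²`, whose coefficient has the sign of `p/2 - β + η`. -/
theorem IsWave.exists_combined_estimate (hn : 1 ≤ n) (hα0 : 0 ≤ α) (hα1 : α < 1) (hδ : 0 < δ)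
    (hδ1 : δ ≤ 1) (hL : 0 < L) {p η : ℝ} (hp : 0 ≤ p) (hη : 0 < η) :
    ∃ ν, 0 < ν ∧ ∃ T₀, 1 + L ≤ T₀ ∧ ∀ t₀, T₀ ≤ t₀ → ∃ C, 0 < C ∧
      ∀ w : ℝ → Rn n → ℝ, IsWave α w → SupportedInCone L w → ∀ T, 0 ≤ T →
        ν / 4 * (∫ x, expWeight α δ t₀ p T x * (damping α x * w T x ^ 2))
          + ν * (δ / 16) / 2 * (∫ q in slab n 0 T,
            expWeight α δ t₀ p q.1 q.2 * ‖∇ (w q.1) q.2‖ ^ 2)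
        ≤ C * dataEnergy α δ w
          + ν * (p / 2 - (n - α) / ((2 - α) * (2 + δ)) + η) * (∫ q in slab n 0 T,
            expWeight α δ t₀ (p - 1) q.1 q.2 * (damping α q.2 * w q.1 q.2 ^ 2)) := by
  set β : ℝ := (n - α) / ((2 - α) * (2 + δ)) with hβ
  have hnα : (1 : ℝ) ≤ n := by exact_mod_cast hn
  have hβ0 : 0 ≤ β := by
    have : 0 < 2 - α := by linarith
    have : 0 ≤ n - α := by linarith
    positivity
  have hc : 0 < 1 + p ^ 2 / (4 * η) := by positivity
  -- `ν` is small so that `ν w_t²` and the cross terms are absorbed by the damping `S^α a w_t²`.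
  set ν := min (δ / 16) (1 / (8 * (1 + p ^ 2 / (4 * η)))) with hν
  have hν0 : 0 < ν := by positivity
  have hν1 : ν ≤ δ / 16 := min_le_left _ _
  have hν2 : ν * (1 + p ^ 2 / (4 * η)) ≤ 1 / 8 := by
    calc _ ≤ 1 / (8 * (1 + p ^ 2 / (4 * η))) * (1 + p ^ 2 / (4 * η)) := by
          gcongr; exact min_le_right _ _
      _ = 1 / 8 := by field_simp
  -- For `t₀` large, `S^α / S ≤ θ`, which makes the derivative of `S^{p+α}` negligible.
  set θ := min 1 (min (1 / 4) (ν * (δ / 16)) / (p + α + 1)) with hθ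
  have hθ0 : 0 < θ := by positivity
  have hθ' : θ * (p + α) ≤ min (1 / 4) (ν * (δ / 16)) := by
    calc _ ≤ min (1 / 4) (ν * (δ / 16)) / (p + α + 1) * (p + α + 1) := by
          gcongr
          · exact min_le_right _ _
          · linarith
      _ = _ := div_mul_cancel₀ _ (by positivity)
  obtain ⟨T₀, hT₀, hT₀θ⟩ := exists_rpow_div_le hα1 hθ0 (1 + L)
  refine ⟨ν, hν0, T₀, hT₀, fun t₀ ht₀ => ?_⟩
  have ht₀0 : 0 < t₀ := by linarith
  refine ⟨t₀ ^ (p + α) + t₀ ^ p, by positivity, fun w hw hs T hT => ?_⟩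
  have hsm := hw.smooth
  have hE : ∀ q, SmoothFrom (n := n) 0 (expWeight α δ t₀ q) := fun q =>
    smoothFrom_expWeight le_rfl ht₀0
  have hρ₂ : SmoothFrom 0 fun t (x : Rn n) => ν * expWeight α δ t₀ p t x := (hE p).const_mul ν
  have g1 : SmoothFrom 0 fun t x => expWeight α δ t₀ (p - 1) t x * (damping α x * w t x ^ 2) :=
    (hE _).mul (smoothFrom_dampingSq hsm)
  have g2 : SmoothFrom 0 fun t x => expWeight α δ t₀ p t x * ‖∇ (w t) x‖ ^ 2 :=
    (hE _).mul hsm.norm_gradient_sq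
  have key := hw.integral_energy_le (T := T) (R := L + T) hT (ρ₁ := expWeight α δ t₀ (p + α))
    (ρ₂ := fun t x => ν * expWeight α δ t₀ p t x) (ψ := weightPsi α δ)
    (G := fun t x => ν * (p / 2 - β + η) * (expWeight α δ t₀ (p - 1) t x
      * (damping α x * w t x ^ 2)) - ν * (δ / 16) / 2 * (expWeight α δ t₀ p t x
      * ‖∇ (w t) x‖ ^ 2)) (hE _) hρ₂ (smoothFrom_weightPsi le_rfl)
    ((g1.const_mul _).sub (g2.const_mul _))
    (fun t ht x hx => Or.inl (hs.vanish_of_le ht.1 ht.2 hx))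
    (fun t ht x hx => by
      obtain ⟨h1, h2, h3⟩ := hs.vanish_of_le ht.1.le ht.2.le hx
      simp [h1, h3])
    (by
      intro t ht x
      by_cases hx : L + t < ‖x‖
      · obtain ⟨h1, h2, h3⟩ := hs.vanish ht.1.le hx
        simp [h1, h2, h3]
      have ht0 := ht.1.le
      have hS : 0 < t₀ + t := by linarith
      have ha := damping_pos α x
      have e1 : dTime 0 (expWeight α δ t₀ (p + α)) t x = expWeight α δ t₀ (p + α) t x *
          ((p + α) / (t₀ + t) - 2 * (weightPsi α δ t x / (1 + t))) :=
        SmoothFrom.dTime_eq_of_hasDerivAt ht.1 (hasDerivAt_expWeight ht₀0 ht0 x)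
      have e2 : dTime 0 (fun t x => ν * expWeight α δ t₀ p t x) t x
          = ν * (expWeight α δ t₀ p t x *
          (p / (t₀ + t) - 2 * (weightPsi α δ t x / (1 + t)))) :=
        SmoothFrom.dTime_eq_of_hasDerivAt (F := fun t x => ν * expWeight α δ t₀ p t x) ht.1
          ((hasDerivAt_expWeight ht₀0 ht0 x).const_mul ν)
      have e3 : ∇ (fun x => ν * expWeight α δ t₀ p t x) x
          = (ν * (2 * expWeight α δ t₀ p t x)) • ∇ (weightPsi α δ t) x := by
        have := gradient_comp (f := expWeight α δ t₀ p t) (x := x)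
          ((hasDerivAt_id _).const_mul ν) ((hE p).differentiable_slice ht0 x)
        rw [gradient_expWeight ht0, smul_smul, mul_one] at this
        exact this
      have hψ := weightPsi_nonneg (α := α) hδ ht0 x
      have hd := norm_gradient_weightPsi_sq_le (by linarith : α < 2) hδ ht0 x
      have hΛ : β * (damping α x / (t₀ + t)) ≤ (Δ (weightPsi α δ t)) x := by
        refine le_trans ?_ (le_laplacian_weightPsi hα0 (by linarith) hδ ht0 x)
        have : 1 ≤ t₀ := by linarith
        gcongr
      have hpt := combined_dissipation (P := dTime 0 w t x) (W := w t x) (g := ‖∇ (w t) x‖)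
        (m := weightPsi α δ t x / (1 + t)) (Sα := (t₀ + t) ^ α) (η := η)
        hα0 hp hδ hδ1 hη hν0 hν1 hν2
        (hθ'.trans (min_le_left _ _)) (hθ'.trans (min_le_right _ _)) (min_le_left _ _) ha
        (by positivity) hd (abs_real_inner_le_norm (∇ (weightPsi α δ t) x) (∇ (w t) x)) hS
        (by positivity) (one_le_rpow_mul_damping hα0 (by linarith))
        (hT₀θ _ (by linarith) hS) hΛ
      have hpt' := mul_le_mul_of_nonneg_left hpt (expWeight_pos (α := α) (δ := δ) (q := p) hS x).le
      rw [e1, e2, e3, gradient_expWeight ht0, expWeight_add hS, expWeight_sub_one hS]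
      simp only [real_inner_smul_left, real_inner_self_eq_norm_sq]
      rw [real_inner_comm (∇ (weightPsi α δ t) x) (∇ (w t) x)]
      refine le_trans (le_of_eq ?_) (hpt'.trans (le_of_eq ?_))
      · ring
      · ring)
  have hint1 : IntegrableOn (fun q : ℝ × Rn n => expWeight α δ t₀ (p - 1) q.1 q.2
      * (damping α q.2 * w q.1 q.2 ^ 2)) (slab n 0 T) :=
    integrableOn_slab (F := fun t x => expWeight α δ t₀ (p - 1) t x * (damping α x * w t x ^ 2))
      (R := L + T) g1.continuousOn fun t ht x hx => by
      simp [(hs.vanish_of_le ht.1.le ht.2.le hx).1]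
  have hint2 : IntegrableOn (fun q : ℝ × Rn n => expWeight α δ t₀ p q.1 q.2
      * ‖∇ (w q.1) q.2‖ ^ 2) (slab n 0 T) :=
    integrableOn_slab (F := fun t x => expWeight α δ t₀ p t x * ‖∇ (w t) x‖ ^ 2)
      (R := L + T) g2.continuousOn fun t ht x hx => by
      simp [(hs.vanish_of_le ht.1.le ht.2.le hx).2.2]
  rw [integral_sub (hint1.const_mul _) (hint2.const_mul _), integral_const_mul,
    integral_const_mul] at key
  have ha : SmoothFrom 0 fun _ (x : Rn n) => damping α x := .of_space (contDiff_damping α)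
  have hdens : SmoothFrom 0 fun t x => 1 / 2 * expWeight α δ t₀ (p + α) t x *
      (dTime 0 w t x ^ 2 + ‖∇ (w t) x‖ ^ 2) + ν * expWeight α δ t₀ p t x *
      (w t x * dTime 0 w t x + damping α x * w t x ^ 2 / 2) :=
    ((((hE (p + α)).const_mul (1 / 2)).mul ((hsm.deriv_time.pow 2).add hsm.norm_gradient_sq)).add
      (hρ₂.mul ((hsm.mul hsm.deriv_time).add ((ha.mul (hsm.pow 2)).const_mul (1 / 2))))).congr
      fun t _ x => by ring
  have hlow : ν / 4 * (∫ x, expWeight α δ t₀ p T x * (damping α x * w T x ^ 2))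
      ≤ ∫ x, (1 / 2 * expWeight α δ t₀ (p + α) T x *
      (dTime 0 w T x ^ 2 + ‖∇ (w T) x‖ ^ 2) + ν * expWeight α δ t₀ p T x *
      (w T x * dTime 0 w T x + damping α x * w T x ^ 2 / 2)) := by
    rw [← integral_const_mul]
    refine integral_mono (integrable_of_vanish (R := L + T)
      ((((hE p).mul (smoothFrom_dampingSq hsm)).const_mul _).contDiff_slice hT).continuous
      fun x hx => ?_) (integrable_of_vanish (R := L + T) (hdens.contDiff_slice hT).continuous
      fun x hx => ?_) fun x => ?_
    · simp [(hs.vanish hT hx).1]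
    · obtain ⟨h1, h2, h3⟩ := hs.vanish hT hx
      simp [h1, h2, h3]
    · by_cases hx : L + T < ‖x‖
      · obtain ⟨h1, h2, h3⟩ := hs.vanish hT hx
        simp [h1, h2, h3]
      have hS : 0 < t₀ + T := by linarith
      have hW := expWeight_pos (α := α) (δ := δ) (q := p) hS x
      have h1 := one_le_rpow_mul_damping (x := x) (S := t₀ + T) hα0 (by linarith)
      simp only [expWeight_add hS]
      set a := damping α x with ha'
      have ha0 : 0 < a := damping_pos α x
      set Sα := (t₀ + T) ^ α
      have h2 : -(w T x * dTime 0 w T x) ≤ a * w T x ^ 2 / 4 + Sα * dTime 0 w T x ^ 2 := by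
        have h3 : 0 ≤ (a * w T x / 2 + dTime 0 w T x) ^ 2 / a := by positivity
        have h4 : (a * w T x / 2 + dTime 0 w T x) ^ 2 / a
            = a * w T x ^ 2 / 4 + 1 / a * dTime 0 w T x ^ 2 + w T x * dTime 0 w T x := by
          field_simp
          ring
        have h5 : 1 / a * dTime 0 w T x ^ 2 ≤ Sα * dTime 0 w T x ^ 2 := by
          gcongr
          rw [div_le_iff₀ ha0]
          exact h1
        linarith
      have h6 : ν * (Sα * dTime 0 w T x ^ 2) ≤ 1 / 2 * (Sα * dTime 0 w T x ^ 2) := by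
        have : ν ≤ 1 / 2 := by linarith
        have : 0 < Sα := by positivity
        gcongr
      have h7 : 0 ≤ 1 / 2 * (Sα * ‖∇ (w T) x‖ ^ 2) := by positivity
      have h8 := mul_le_mul_of_nonneg_left h2 hν0.le
      have h9 : ν / 4 * (a * w T x ^ 2) ≤ 1 / 2 * Sα * (dTime 0 w T x ^ 2 + ‖∇ (w T) x‖ ^ 2)
          + ν * (w T x * dTime 0 w T x + a * w T x ^ 2 / 2) := by linarith
      have h10 := mul_le_mul_of_nonneg_left h9 hW.le
      refine le_trans (le_of_eq ?_) (h10.trans (le_of_eq ?_)) <;> ring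
  have hup : ∫ x, (1 / 2 * expWeight α δ t₀ (p + α) 0 x *
      (dTime 0 w 0 x ^ 2 + ‖∇ (w 0) x‖ ^ 2) + ν * expWeight α δ t₀ p 0 x *
      (w 0 x * dTime 0 w 0 x + damping α x * w 0 x ^ 2 / 2))
      ≤ (t₀ ^ (p + α) + t₀ ^ p) * dataEnergy α δ w := by
    rw [dataEnergy, ← integral_const_mul]
    refine integral_mono (integrable_of_vanish (R := L + 0) (hdens.contDiff_slice le_rfl).continuous
      fun x hx => ?_) (integrable_of_vanish (R := L + 0)
      (((((((smoothFrom_weightPsi le_rfl).const_mul 2).exp).mul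
        (((hsm.pow 2).add (hsm.deriv_time.pow 2)).add hsm.norm_gradient_sq)).const_mul
        (t₀ ^ (p + α) + t₀ ^ p)).contDiff_slice le_rfl).continuous)
      fun x hx => ?_) fun x => ?_
    · obtain ⟨h1, h2, h3⟩ := hs.vanish le_rfl hx
      simp [h1, h2, h3]
    · obtain ⟨h1, h2, h3⟩ := hs.vanish le_rfl hx
      simp [h1, h2, h3]
    · simp only [expWeight, add_zero]
      have ha1 := damping_le_one hα0 x
      have ha0 := damping_pos α x
      have h1 : 0 < t₀ ^ (p + α) := by positivity
      have h2 : 0 < t₀ ^ p := by positivity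
      have hν3 : ν ≤ 1 := by linarith
      have h3 : w 0 x * dTime 0 w 0 x + damping α x * w 0 x ^ 2 / 2
          ≤ w 0 x ^ 2 + dTime 0 w 0 x ^ 2 + ‖∇ (w 0) x‖ ^ 2 := by
        nlinarith [sq_nonneg (w 0 x - dTime 0 w 0 x), sq_nonneg ‖∇ (w 0) x‖,
          mul_nonneg (sub_nonneg.2 ha1) (sq_nonneg (w 0 x)), sq_nonneg (w 0 x),
          sq_nonneg (dTime 0 w 0 x)]
      have h4 : ν * (w 0 x * dTime 0 w 0 x + damping α x * w 0 x ^ 2 / 2)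
          ≤ w 0 x ^ 2 + dTime 0 w 0 x ^ 2 + ‖∇ (w 0) x‖ ^ 2 := by
        calc _ ≤ ν * (w 0 x ^ 2 + dTime 0 w 0 x ^ 2 + ‖∇ (w 0) x‖ ^ 2) := by gcongr
          _ ≤ 1 * (w 0 x ^ 2 + dTime 0 w 0 x ^ 2 + ‖∇ (w 0) x‖ ^ 2) := by gcongr
          _ = _ := one_mul _
      have h5 : 1 / 2 * (dTime 0 w 0 x ^ 2 + ‖∇ (w 0) x‖ ^ 2)
          ≤ w 0 x ^ 2 + dTime 0 w 0 x ^ 2 + ‖∇ (w 0) x‖ ^ 2 := by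
        nlinarith [sq_nonneg ‖∇ (w 0) x‖, sq_nonneg (w 0 x), sq_nonneg (dTime 0 w 0 x)]
      have h6 := mul_le_mul_of_nonneg_left h5 h1.le
      have h7 := mul_le_mul_of_nonneg_left h4 h2.le
      have h8 := mul_le_mul_of_nonneg_left (add_le_add h6 h7)
        (Real.exp_pos (2 * weightPsi α δ 0 x)).le
      refine le_trans (le_of_eq ?_) (h8.trans (le_of_eq ?_)) <;> ring
  linarith

theorem setIntegral_slab_nonneg {τ : ℝ} {F : ℝ → Rn n → ℝ}
    (h : ∀ t ∈ Ioo τ T, ∀ x, 0 ≤ F t x) : 0 ≤ ∫ q in slab n τ T, F q.1 q.2 :=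
  setIntegral_nonneg measurableSet_slab fun q hq => h q.1 hq.1 q.2

theorem rpow_mul_integral_eq (q : ℝ) (f : Rn n → ℝ) :
    (t₀ + T) ^ q * ∫ x, Real.exp (2 * weightPsi α δ T x) * f x
      = ∫ x, expWeight α δ t₀ q T x * f x := by
  rw [← integral_const_mul]
  simp only [expWeight, mul_assoc]

/-- The energy multiplier `(t₀+t)^{p+1} w_t`: given the space-time integral of
`(t₀+t)^p e^{2ψ}|∇w|²`, the energy decays with one more power of `t`. -/
theorem IsWave.exists_energy_estimate (hα0 : 0 ≤ α) (hα1 : α < 1) (hδ : 0 < δ)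
    (hL : 0 < L) {p : ℝ} (hp : 0 ≤ p) :
    ∃ T₀, 1 + L ≤ T₀ ∧ ∀ t₀, T₀ ≤ t₀ → ∃ C, 0 < C ∧
      ∀ w : ℝ → Rn n → ℝ, IsWave α w → SupportedInCone L w → ∀ T, 0 ≤ T →
        1 / 2 * (∫ x, expWeight α δ t₀ (p + 1) T x * ‖∇ (w T) x‖ ^ 2)
          + 1 / 4 * (∫ q in slab n 0 T,
            expWeight α δ t₀ (p + 1) q.1 q.2 * (damping α q.2 * dTime 0 w q.1 q.2 ^ 2))
        ≤ C * dataEnergy α δ w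
          + (p + 1) / 2 * (∫ q in slab n 0 T,
            expWeight α δ t₀ p q.1 q.2 * ‖∇ (w q.1) q.2‖ ^ 2) := by
  -- For `t₀` large, `(p+1)/S ≤ a/2` in the cone, so the damping absorbs the derivative of the
  -- weight `S^{p+1}`.
  set θ : ℝ := 1 / (2 * (p + 1)) with hθ
  have hθ0 : 0 < θ := by positivity
  obtain ⟨T₀, hT₀, hT₀θ⟩ := exists_rpow_div_le hα1 hθ0 (1 + L)
  refine ⟨T₀, hT₀, fun t₀ ht₀ => ?_⟩
  have ht₀0 : 0 < t₀ := by linarith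
  refine ⟨t₀ ^ (p + 1), by positivity, fun w hw hs T hT => ?_⟩
  have hsm := hw.smooth
  have hE : ∀ q, SmoothFrom (n := n) 0 (expWeight α δ t₀ q) := fun q =>
    smoothFrom_expWeight le_rfl ht₀0
  have g1 : SmoothFrom 0 fun t x => expWeight α δ t₀ (p + 1) t x *
      (damping α x * dTime 0 w t x ^ 2) := (hE _).mul (smoothFrom_dampingSq hsm.deriv_time)
  have g2 : SmoothFrom 0 fun t x => expWeight α δ t₀ p t x * ‖∇ (w t) x‖ ^ 2 :=
    (hE _).mul hsm.norm_gradient_sq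
  have key := hw.integral_energy_le (T := T) (R := L + T) hT (ρ₁ := expWeight α δ t₀ (p + 1))
    (ρ₂ := fun _ _ => 0) (ψ := fun _ _ => 0)
    (G := fun t x => (p + 1) / 2 * (expWeight α δ t₀ p t x * ‖∇ (w t) x‖ ^ 2)
      - 1 / 4 * (expWeight α δ t₀ (p + 1) t x * (damping α x * dTime 0 w t x ^ 2)))
    (hE _) (.const 0) (.const 0)
    ((g2.const_mul _).sub (g1.const_mul _))
    (fun t ht x hx => Or.inl (hs.vanish_of_le ht.1 ht.2 hx))
    (fun t ht x hx => by
      obtain ⟨h1, h2, h3⟩ := hs.vanish_of_le ht.1.le ht.2.le hx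
      simp [h2, h3])
    (by
      intro t ht x
      have e9 : dTime 0 (fun _ (_ : Rn n) => (0 : ℝ)) t x = 0 :=
        SmoothFrom.dTime_eq_of_hasDerivAt ht.1 (hasDerivAt_const t 0)
      by_cases hx : L + t < ‖x‖
      · obtain ⟨h1, h2, h3⟩ := hs.vanish ht.1.le hx
        simp [h1, h2, h3]
      have ht0 := ht.1.le
      have hS : 0 < t₀ + t := by linarith
      have ha := damping_pos α x
      have e1 : dTime 0 (expWeight α δ t₀ (p + 1)) t x = expWeight α δ t₀ (p + 1) t x *
          ((p + 1) / (t₀ + t) - 2 * (weightPsi α δ t x / (1 + t))) :=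
        SmoothFrom.dTime_eq_of_hasDerivAt ht.1 (hasDerivAt_expWeight ht₀0 ht0 x)
      have hψ := weightPsi_nonneg (α := α) hδ ht0 x
      have hd2 := two_mul_norm_gradient_weightPsi_sq_le (by linarith : α < 2) hδ ht0 x
      have hX := abs_velocity_cross_le (P := dTime 0 w t x) ha hd2
        (abs_real_inner_le_norm (∇ (weightPsi α δ t) x) (∇ (w t) x))
      have hX' := neg_abs_le (dTime 0 w t x * inner ℝ (∇ (weightPsi α δ t) x) (∇ (w t) x))
      have hinv : (p + 1) / (t₀ + t) ≤ damping α x / 2 := by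
        have h1 := hT₀θ (t₀ + t) (by linarith) hS
        have h2 := one_le_rpow_mul_damping (x := x) (S := t₀ + t) hα0 (by linarith)
        have h3 : 1 / (t₀ + t) ≤ θ * damping α x := by
          calc 1 / (t₀ + t) ≤ (t₀ + t) ^ α * damping α x / (t₀ + t) := by gcongr
            _ = (t₀ + t) ^ α / (t₀ + t) * damping α x := by ring
            _ ≤ _ := by gcongr
        calc (p + 1) / (t₀ + t) = (p + 1) * (1 / (t₀ + t)) := by ring
          _ ≤ (p + 1) * (θ * damping α x) := by gcongr
          _ = _ := by rw [hθ]; field_simp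
      have hm : 0 ≤ weightPsi α δ t x / (1 + t) := by positivity
      have hpt : 1 / 2 * ((p + 1) / (t₀ + t) - 2 * (weightPsi α δ t x / (1 + t))) *
          (dTime 0 w t x ^ 2 + ‖∇ (w t) x‖ ^ 2) - damping α x * dTime 0 w t x ^ 2
          - 2 * (dTime 0 w t x * inner ℝ (∇ (weightPsi α δ t) x) (∇ (w t) x))
          ≤ (p + 1) / 2 * (1 / (t₀ + t) * ‖∇ (w t) x‖ ^ 2)
            - 1 / 4 * (damping α x * dTime 0 w t x ^ 2) := by
        have h1 := mul_le_mul_of_nonneg_right hinv (sq_nonneg (dTime 0 w t x))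
        have h2 := mul_nonneg hm (sq_nonneg (dTime 0 w t x))
        have h3 : (p + 1) / 2 * (1 / (t₀ + t) * ‖∇ (w t) x‖ ^ 2)
          = 1 / 2 * ((p + 1) / (t₀ + t) * ‖∇ (w t) x‖ ^ 2) := by ring
        rw [h3]
        linarith
      have hpt' := mul_le_mul_of_nonneg_left hpt
        (expWeight_pos (α := α) (δ := δ) (q := p + 1) hS x).le
      have e5 : expWeight α δ t₀ (p + 1) t x * (1 / (t₀ + t)) = expWeight α δ t₀ p t x := by
        rw [expWeight_add hS, Real.rpow_one]
        field_simp
      rw [e1, e9, gradient_expWeight ht0, ← e5]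
      simp only [real_inner_smul_left, gradient_fun_const, inner_zero_left, inner_zero_right]
      refine le_trans (le_of_eq ?_) (hpt'.trans (le_of_eq ?_))
      · ring
      · ring)
  have hint1 : IntegrableOn (fun q : ℝ × Rn n => expWeight α δ t₀ (p + 1) q.1 q.2
      * (damping α q.2 * dTime 0 w q.1 q.2 ^ 2)) (slab n 0 T) :=
    integrableOn_slab (F := fun t x => expWeight α δ t₀ (p + 1) t x *
      (damping α x * dTime 0 w t x ^ 2)) (R := L + T) g1.continuousOn fun t ht x hx => by
      simp [(hs.vanish_of_le ht.1.le ht.2.le hx).2.1]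
  have hint2 : IntegrableOn (fun q : ℝ × Rn n => expWeight α δ t₀ p q.1 q.2
      * ‖∇ (w q.1) q.2‖ ^ 2) (slab n 0 T) :=
    integrableOn_slab (F := fun t x => expWeight α δ t₀ p t x * ‖∇ (w t) x‖ ^ 2)
      (R := L + T) g2.continuousOn fun t ht x hx => by
      simp [(hs.vanish_of_le ht.1.le ht.2.le hx).2.2]
  rw [integral_sub (hint2.const_mul _) (hint1.const_mul _), integral_const_mul,
    integral_const_mul] at key
  simp only [zero_mul, add_zero] at key
  have hdens : SmoothFrom 0 fun t x => 1 / 2 * expWeight α δ t₀ (p + 1) t x *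
      (dTime 0 w t x ^ 2 + ‖∇ (w t) x‖ ^ 2) :=
    ((hE (p + 1)).const_mul (1 / 2)).mul ((hsm.deriv_time.pow 2).add hsm.norm_gradient_sq)
  have hlow : 1 / 2 * (∫ x, expWeight α δ t₀ (p + 1) T x * ‖∇ (w T) x‖ ^ 2)
      ≤ ∫ x, 1 / 2 * expWeight α δ t₀ (p + 1) T x *
      (dTime 0 w T x ^ 2 + ‖∇ (w T) x‖ ^ 2) := by
    rw [← integral_const_mul]
    refine integral_mono (integrable_of_vanish (R := L + T)
      ((((hE (p + 1)).mul hsm.norm_gradient_sq).const_mul _).contDiff_slice hT).continuous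
      fun x hx => ?_) (integrable_of_vanish (R := L + T) (hdens.contDiff_slice hT).continuous
      fun x hx => ?_) fun x => ?_
    · simp [(hs.vanish hT hx).2.2]
    · obtain ⟨h1, h2, h3⟩ := hs.vanish hT hx
      simp [h2, h3]
    · have hW := expWeight_pos (α := α) (δ := δ) (q := p + 1) (by linarith : 0 < t₀ + T) x
      have := mul_nonneg hW.le (sq_nonneg (dTime 0 w T x))
      simp only
      linarith
  have hup : ∫ x, 1 / 2 * expWeight α δ t₀ (p + 1) 0 x *
      (dTime 0 w 0 x ^ 2 + ‖∇ (w 0) x‖ ^ 2) ≤ t₀ ^ (p + 1) * dataEnergy α δ w := by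
    rw [dataEnergy, ← integral_const_mul]
    refine integral_mono (integrable_of_vanish (R := L + 0) (hdens.contDiff_slice le_rfl).continuous
      fun x hx => ?_) (integrable_of_vanish (R := L + 0)
      (((((((smoothFrom_weightPsi le_rfl).const_mul 2).exp).mul
        (((hsm.pow 2).add (hsm.deriv_time.pow 2)).add hsm.norm_gradient_sq)).const_mul
        (t₀ ^ (p + 1))).contDiff_slice le_rfl).continuous)
      fun x hx => ?_) fun x => ?_
    · obtain ⟨h1, h2, h3⟩ := hs.vanish le_rfl hx
      simp [h2, h3]
    · obtain ⟨h1, h2, h3⟩ := hs.vanish le_rfl hx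
      simp [h1, h2, h3]
    · simp only [expWeight, add_zero]
      have h1 : 0 < t₀ ^ (p + 1) := by positivity
      have h5 : 1 / 2 * (dTime 0 w 0 x ^ 2 + ‖∇ (w 0) x‖ ^ 2)
          ≤ w 0 x ^ 2 + dTime 0 w 0 x ^ 2 + ‖∇ (w 0) x‖ ^ 2 := by
        nlinarith [sq_nonneg ‖∇ (w 0) x‖, sq_nonneg (w 0 x), sq_nonneg (dTime 0 w 0 x)]
      have h8 := mul_le_mul_of_nonneg_left (mul_le_mul_of_nonneg_left h5 h1.le)
        (Real.exp_pos (2 * weightPsi α δ 0 x)).le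
      refine le_trans (le_of_eq ?_) (h8.trans (le_of_eq ?_)) <;> ring
  linarith

/-- One round of the iteration. If the space-time integral of `(t₀+t)^{p-1} e^{2ψ} a w²` is at
most `K`, then `w` decays at the rate `p`, its energy at the rate `p + 1`, and `w_t` satisfies the
hypothesis with `p + 2` in place of `p`. -/
theorem IsWave.exists_decay_step (hn : 1 ≤ n) (hα0 : 0 ≤ α) (hα1 : α < 1) (hδ : 0 < δ)
    (hδ1 : δ ≤ 1) (hL : 0 < L) {p : ℝ} (hp : 0 ≤ p) :
    ∃ T₀, 1 + L ≤ T₀ ∧ ∀ t₀, T₀ ≤ t₀ → ∃ C, 0 < C ∧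
      ∀ (w : ℝ → Rn n → ℝ) (K : ℝ), IsWave α w → SupportedInCone L w → 0 ≤ K →
        (∀ T, 0 ≤ T → ∫ q in slab n 0 T,
            expWeight α δ t₀ (p - 1) q.1 q.2 * (damping α q.2 * w q.1 q.2 ^ 2) ≤ K) →
        ∀ T, 0 ≤ T →
          ∫ x, expWeight α δ t₀ p T x * (damping α x * w T x ^ 2)
            ≤ C * (dataEnergy α δ w + K) ∧
          ∫ x, expWeight α δ t₀ (p + 1) T x * ‖∇ (w T) x‖ ^ 2 ≤ C * (dataEnergy α δ w + K) ∧
          ∫ q in slab n 0 T,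
            expWeight α δ t₀ (p + 1) q.1 q.2 * (damping α q.2 * dTime 0 w q.1 q.2 ^ 2)
            ≤ C * (dataEnergy α δ w + K) := by
  obtain ⟨ν, hν, T₁, hT₁, h₁⟩ := IsWave.exists_combined_estimate (n := n) (δ := δ) (η := 1)
    hn hα0 hα1 hδ hδ1 hL hp one_pos
  obtain ⟨T₂, hT₂, h₂⟩ := IsWave.exists_energy_estimate (n := n) (δ := δ) hα0 hα1 hδ hL hp
  refine ⟨max T₁ T₂, hT₁.trans (le_max_left _ _), fun t₀ ht₀ => ?_⟩
  obtain ⟨C₁, hC₁, h₁⟩ := h₁ t₀ ((le_max_left _ _).trans ht₀)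
  obtain ⟨C₂, hC₂, h₂⟩ := h₂ t₀ ((le_max_right _ _).trans ht₀)
  have ht₀0 : 0 < t₀ := by linarith [(le_max_left _ _).trans ht₀]
  set β : ℝ := (n - α) / ((2 - α) * (2 + δ)) with hβ
  have hβ0 : 0 ≤ β := by
    have : (1 : ℝ) ≤ n := by exact_mod_cast hn
    have : 0 < 2 - α := by linarith
    have : 0 ≤ n - α := by linarith
    positivity
  set M := C₁ + ν * (p / 2 + 1) with hM
  have hM0 : 0 < M := by positivity
  set D := 32 / (ν * δ) * M with hD
  have hD0 : 0 < D := by positivity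
  refine ⟨4 / ν * M + 4 * (C₂ + (p + 1) / 2 * D), by positivity, ?_⟩
  intro w K hw hs hK hwK T hT
  have hJ := dataEnergy_nonneg (α := α) (δ := δ) (w := w)
  have k1 := h₁ w hw hs T hT
  have k2 := h₂ w hw hs T hT
  have k3 := hwK T hT
  have hpos : ∀ t, 0 ≤ t → 0 < t₀ + t := fun t ht => by linarith
  have i1 : 0 ≤ ∫ x, expWeight α δ t₀ p T x * (damping α x * w T x ^ 2) :=
    integral_nonneg fun x => mul_nonneg (expWeight_pos (hpos T hT) x).le
      (mul_nonneg (damping_pos α x).le (sq_nonneg _))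
  have i2 : 0 ≤ ∫ q in slab n 0 T, expWeight α δ t₀ p q.1 q.2 * ‖∇ (w q.1) q.2‖ ^ 2 :=
    setIntegral_slab_nonneg (F := fun t x => expWeight α δ t₀ p t x * ‖∇ (w t) x‖ ^ 2)
      fun t ht x => mul_nonneg (expWeight_pos (hpos t ht.1.le) x).le (sq_nonneg _)
  have i3 : 0 ≤ ∫ x, expWeight α δ t₀ (p + 1) T x * ‖∇ (w T) x‖ ^ 2 :=
    integral_nonneg fun x => mul_nonneg (expWeight_pos (hpos T hT) x).le (sq_nonneg _)
  have i4 : 0 ≤ ∫ q in slab n 0 T,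
      expWeight α δ t₀ (p + 1) q.1 q.2 * (damping α q.2 * dTime 0 w q.1 q.2 ^ 2) :=
    setIntegral_slab_nonneg (F := fun t x => expWeight α δ t₀ (p + 1) t x *
      (damping α x * dTime 0 w t x ^ 2)) fun t ht x =>
      mul_nonneg (expWeight_pos (hpos t ht.1.le) x).le
        (mul_nonneg (damping_pos α x).le (sq_nonneg _))
  have i5 : 0 ≤ ∫ q in slab n 0 T,
      expWeight α δ t₀ (p - 1) q.1 q.2 * (damping α q.2 * w q.1 q.2 ^ 2) :=
    setIntegral_slab_nonneg (F := fun t x => expWeight α δ t₀ (p - 1) t x *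
      (damping α x * w t x ^ 2)) fun t ht x =>
      mul_nonneg (expWeight_pos (hpos t ht.1.le) x).le
        (mul_nonneg (damping_pos α x).le (sq_nonneg _))
  have k4 : ν * (p / 2 - β + 1) * (∫ q in slab n 0 T,
      expWeight α δ t₀ (p - 1) q.1 q.2 * (damping α q.2 * w q.1 q.2 ^ 2))
      ≤ ν * (p / 2 + 1) * K := by
    calc _ ≤ ν * (p / 2 + 1) * (∫ q in slab n 0 T,
          expWeight α δ t₀ (p - 1) q.1 q.2 * (damping α q.2 * w q.1 q.2 ^ 2)) := by
          gcongr; linarith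
      _ ≤ _ := by gcongr
  have hνp : 0 ≤ ν * (p / 2 + 1) := by positivity
  have k5 : C₁ * dataEnergy α δ w + ν * (p / 2 + 1) * K ≤ M * (dataEnergy α δ w + K) := by
    rw [hM]
    nlinarith [mul_nonneg hC₁.le hK, mul_nonneg hνp hJ]
  have k6 : ∫ x, expWeight α δ t₀ p T x * (damping α x * w T x ^ 2)
      ≤ 4 / ν * M * (dataEnergy α δ w + K) := by
    have h3 : ν / 4 * (∫ x, expWeight α δ t₀ p T x * (damping α x * w T x ^ 2))
        ≤ M * (dataEnergy α δ w + K) := by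
      have : 0 ≤ ν * (δ / 16) / 2 * (∫ q in slab n 0 T,
            expWeight α δ t₀ p q.1 q.2 * ‖∇ (w q.1) q.2‖ ^ 2) := by positivity
      linarith
    calc _ = 4 / ν * (ν / 4 * (∫ x, expWeight α δ t₀ p T x * (damping α x * w T x ^ 2))) := by
          field_simp
      _ ≤ 4 / ν * (M * (dataEnergy α δ w + K)) := by gcongr
      _ = _ := by ring
  have k7 : ∫ q in slab n 0 T, expWeight α δ t₀ p q.1 q.2 * ‖∇ (w q.1) q.2‖ ^ 2
      ≤ D * (dataEnergy α δ w + K) := by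
    have h3 : ν * (δ / 16) / 2 * (∫ q in slab n 0 T,
            expWeight α δ t₀ p q.1 q.2 * ‖∇ (w q.1) q.2‖ ^ 2)
        ≤ M * (dataEnergy α δ w + K) := by
      have : 0 ≤ ν / 4 * (∫ x, expWeight α δ t₀ p T x * (damping α x * w T x ^ 2)) := by
        positivity
      linarith
    calc _ = 32 / (ν * δ) * (ν * (δ / 16) / 2 * (∫ q in slab n 0 T,
            expWeight α δ t₀ p q.1 q.2 * ‖∇ (w q.1) q.2‖ ^ 2)) := by
          field_simp; ring
      _ ≤ 32 / (ν * δ) * (M * (dataEnergy α δ w + K)) := by gcongr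
      _ = _ := by rw [hD]; ring
  have k8 : C₂ * dataEnergy α δ w + (p + 1) / 2 * (∫ q in slab n 0 T,
            expWeight α δ t₀ p q.1 q.2 * ‖∇ (w q.1) q.2‖ ^ 2)
      ≤ (C₂ + (p + 1) / 2 * D) * (dataEnergy α δ w + K) := by
    have h3 : (p + 1) / 2 * (∫ q in slab n 0 T,
            expWeight α δ t₀ p q.1 q.2 * ‖∇ (w q.1) q.2‖ ^ 2)
        ≤ (p + 1) / 2 * (D * (dataEnergy α δ w + K)) := by gcongr
    nlinarith [mul_nonneg hC₂.le hK]
  have k9 : 0 ≤ 4 / ν * M * (dataEnergy α δ w + K) := by positivity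
  have k10 : 0 ≤ (C₂ + (p + 1) / 2 * D) * (dataEnergy α δ w + K) := by positivity
  refine ⟨?_, ?_, ?_⟩ <;> rw [add_mul] <;> linarith

/-- The start of the iteration: when `p/2` is less than `β`, the lower bound `Δψ ≥ β a/(1+t)`
makes the zeroth order term of the combined estimate dissipative. -/
theorem IsWave.exists_spacetime_bound (hn : 1 ≤ n) (hα0 : 0 ≤ α) (hα1 : α < 1) (hδ : 0 < δ)
    (hδ1 : δ ≤ 1) (hL : 0 < L) {p : ℝ} (hp : 0 ≤ p)
    (hpβ : p / 2 < (n - α) / ((2 - α) * (2 + δ))) :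
    ∃ T₀, 1 + L ≤ T₀ ∧ ∀ t₀, T₀ ≤ t₀ → ∃ C, 0 < C ∧
      ∀ w : ℝ → Rn n → ℝ, IsWave α w → SupportedInCone L w → ∀ T, 0 ≤ T →
        ∫ q in slab n 0 T,
            expWeight α δ t₀ (p - 1) q.1 q.2 * (damping α q.2 * w q.1 q.2 ^ 2)
          ≤ C * dataEnergy α δ w := by
  set β : ℝ := (n - α) / ((2 - α) * (2 + δ)) with hβ
  set η := (β - p / 2) / 2 with hη
  have hη0 : 0 < η := by rw [hη]; linarith
  obtain ⟨ν, hν, T₁, hT₁, h₁⟩ := IsWave.exists_combined_estimate (n := n) (δ := δ)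
    hn hα0 hα1 hδ hδ1 hL hp hη0
  refine ⟨T₁, hT₁, fun t₀ ht₀ => ?_⟩
  obtain ⟨C₁, hC₁, h₁⟩ := h₁ t₀ ht₀
  have ht₀0 : 0 < t₀ := by linarith
  refine ⟨C₁ / (ν * η), by positivity, fun w hw hs T hT => ?_⟩
  have k1 := h₁ w hw hs T hT
  have i1 : 0 ≤ ∫ x, expWeight α δ t₀ p T x * (damping α x * w T x ^ 2) :=
    integral_nonneg fun x => mul_nonneg (expWeight_pos (by linarith) x).le
      (mul_nonneg (damping_pos α x).le (sq_nonneg _))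
  have i2 : 0 ≤ ∫ q in slab n 0 T, expWeight α δ t₀ p q.1 q.2 * ‖∇ (w q.1) q.2‖ ^ 2 :=
    setIntegral_slab_nonneg (F := fun t x => expWeight α δ t₀ p t x * ‖∇ (w t) x‖ ^ 2)
      fun t ht x => mul_nonneg (expWeight_pos (by linarith [ht.1]) x).le (sq_nonneg _)
  have e1 : p / 2 - β + η = -η := by rw [hη]; ring
  rw [e1] at k1
  have i3 := mul_nonneg (by positivity : 0 ≤ ν / 4) i1
  have i4 := mul_nonneg (by positivity : 0 ≤ ν * (δ / 16) / 2) i2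
  rw [div_mul_eq_mul_div, le_div_iff₀ (by positivity)]
  linarith

end WaveDecay

/-! ### Decay of the time derivatives of damped waves -/

section DampedWave

variable {n : ℕ} {α δ L : ℝ} {u₀ u₁ : Rn n → ℝ} {u : ℝ → Rn n → ℝ}

theorem timeDeriv_zero (τ : ℝ) (F : ℝ → Rn n → ℝ) : timeDeriv τ 0 F = F := by
  funext t x
  simp [timeDeriv, iteratedDerivWithin_zero]

theorem timeDeriv_two (τ : ℝ) (F : ℝ → Rn n → ℝ) :
    timeDeriv τ 2 F = dTime τ (dTime τ F) := by
  rw [timeDeriv_succ, timeDeriv_one]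

theorem IsDampedWaveSolution.isWave (h : IsDampedWaveSolution α u₀ u₁ u) : IsWave α u where
  smooth := h.smooth
  equation t ht x := by
    have := h.equation t ht x
    rwa [timeDeriv_two, timeDeriv_one] at this

theorem IsDampedWaveSolution.supportedInCone (h : IsDampedWaveSolution α u₀ u₁ u)
    (h₀ : tsupport u₀ ⊆ Metric.closedBall 0 L) (h₁ : tsupport u₁ ⊆ Metric.closedBall 0 L) :
    SupportedInCone L u := by
  have hz : ∀ {f : Rn n → ℝ}, tsupport f ⊆ Metric.closedBall 0 L → ∀ x, L < ‖x‖ → f x = 0 :=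
    fun {f} hf x hx => image_eq_zero_of_notMem_tsupport fun hmem => by
      have := hf hmem
      rw [mem_closedBall_zero_iff] at this
      linarith
  intro t ht x hx
  refine h.isWave.eq_zero_of_lt_norm (fun y hy => ?_) (fun y hy => ?_) ht hx
  · rw [h.initial_value, hz h₀ y hy]
  · rw [← timeDeriv_one, h.initial_velocity, hz h₁ y hy]

theorem IsWave.timeDeriv (h : IsWave α u) (k : ℕ) : IsWave α (timeDeriv 0 k u) := by
  induction k with
  | zero => rwa [timeDeriv_zero]
  | succ k ih => rw [timeDeriv_succ]; exact ih.deriv_time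

theorem SupportedInCone.timeDeriv (h : SupportedInCone L u) (k : ℕ) :
    SupportedInCone L (timeDeriv 0 k u) := by
  induction k with
  | zero => rwa [timeDeriv_zero]
  | succ k ih => rw [timeDeriv_succ]; exact ih.deriv_time

theorem dataNorm_nonneg (α δ : ℝ) (u₀ u₁ : Rn n → ℝ) (u : ℝ → Rn n → ℝ) (k : ℕ) :
    0 ≤ dataNorm α δ u₀ u₁ u k := by
  induction k with
  | zero => exact integral_nonneg fun x => by positivity
  | succ k ih => exact add_nonneg (integral_nonneg fun x => by positivity) ih

theorem dataNorm_le_succ (α δ : ℝ) (u₀ u₁ : Rn n → ℝ) (u : ℝ → Rn n → ℝ) (k : ℕ) :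
    dataNorm α δ u₀ u₁ u k ≤ dataNorm α δ u₀ u₁ u (k + 1) :=
  le_add_of_nonneg_left (integral_nonneg fun x => by positivity)

theorem integrable_exp_mul {F : ℝ → Rn n → ℝ} {R : ℝ} (hF : SmoothFrom 0 F) {t : ℝ} (ht : 0 ≤ t)
    (h0 : ∀ x, R < ‖x‖ → F t x = 0) :
    Integrable fun x => Real.exp (2 * weightPsi α δ t x) * F t x :=
  integrable_of_vanish (R := R)
    (((((smoothFrom_weightPsi le_rfl).const_mul 2).exp).mul hF).contDiff_slice ht).continuous
    fun x hx => by rw [h0 x hx, mul_zero]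

/-- The data of `∂ₜᵏu` are controlled by `I_k`. -/
theorem IsDampedWaveSolution.dataEnergy_le (h : IsDampedWaveSolution α u₀ u₁ u)
    (hs : SupportedInCone L u) (k : ℕ) :
    dataEnergy α δ (timeDeriv 0 k u) ≤ dataNorm α δ u₀ u₁ u k := by
  have e0 : u 0 = u₀ := funext h.initial_value
  have e1 : timeDeriv 0 1 u 0 = u₁ := funext h.initial_velocity
  have hW : ∀ j, SmoothFrom 0 (timeDeriv 0 j u) := fun j => (h.isWave.timeDeriv j).smooth
  have hz : ∀ j, ∀ x, L + 0 < ‖x‖ → timeDeriv 0 j u 0 x = 0 ∧ ∇ (timeDeriv 0 j u 0) x = 0 :=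
    fun j x hx => ⟨((hs.timeDeriv j).vanish le_rfl hx).1, ((hs.timeDeriv j).vanish le_rfl hx).2.2⟩
  cases k with
  | zero =>
    rw [timeDeriv_zero, dataEnergy, dataNorm, e0, ← timeDeriv_one, e1]
    refine le_of_eq (integral_congr_ae (Filter.Eventually.of_forall fun x => ?_))
    simp only
    ring
  | succ k =>
    have i1 : Integrable fun x => Real.exp (2 * weightPsi α δ 0 x) *
        (timeDeriv 0 (k + 2) u 0 x ^ 2 + ‖∇ (timeDeriv 0 (k + 1) u 0) x‖ ^ 2) :=
      integrable_exp_mul (F := fun t x => timeDeriv 0 (k + 2) u t x ^ 2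
        + ‖∇ (timeDeriv 0 (k + 1) u t) x‖ ^ 2) (R := L + 0)
        (((hW _).pow 2).add (hW _).norm_gradient_sq) le_rfl fun x hx => by
          simp [(hz (k + 2) x hx).1, (hz (k + 1) x hx).2]
    have i2 : Integrable fun x => Real.exp (2 * weightPsi α δ 0 x) *
        timeDeriv 0 (k + 1) u 0 x ^ 2 :=
      integrable_exp_mul (F := fun t x => timeDeriv 0 (k + 1) u t x ^ 2) (R := L + 0)
        ((hW _).pow 2) le_rfl fun x hx => by simp [(hz (k + 1) x hx).1]
    have k1 : ∫ x, Real.exp (2 * weightPsi α δ 0 x) * timeDeriv 0 (k + 1) u 0 x ^ 2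
        ≤ dataNorm α δ u₀ u₁ u k := by
      cases k with
      | zero =>
        rw [dataNorm, e1]
        rw [zero_add, e1] at i2
        refine integral_mono i2 ?_ fun x => ?_
        · have := integrable_exp_mul (α := α) (δ := δ) (F := fun t x => u t x ^ 2
            + ‖∇ (u t) x‖ ^ 2 + timeDeriv 0 1 u t x ^ 2) (R := L + 0)
            ((((h.isWave.smooth).pow 2).add h.isWave.smooth.norm_gradient_sq).add ((hW 1).pow 2))
            le_rfl fun x hx => by
              have := hz 0 x hx
              rw [timeDeriv_zero] at this
              simp [this.1, this.2, (hz 1 x hx).1]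
          simpa only [e0, e1] using this
        · simp only
          gcongr
          nlinarith [sq_nonneg (u₀ x), sq_nonneg ‖∇ u₀ x‖]
      | succ k =>
        rw [dataNorm]
        refine le_trans (integral_mono i2 ?_ fun x => ?_)
          (le_add_of_nonneg_right (dataNorm_nonneg _ _ _ _ _ _))
        · exact integrable_exp_mul (F := fun t x => timeDeriv 0 (k + 2) u t x ^ 2
            + ‖∇ (timeDeriv 0 (k + 1) u t) x‖ ^ 2) (R := L + 0)
            (((hW _).pow 2).add (hW _).norm_gradient_sq) le_rfl fun x hx => by
              simp [(hz (k + 2) x hx).1, (hz (k + 1) x hx).2]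
        · simp only
          gcongr
          nlinarith [sq_nonneg ‖∇ (timeDeriv 0 (k + 1) u 0) x‖]
    rw [dataEnergy, dataNorm, ← timeDeriv_succ]
    have k2 : ∫ x, Real.exp (2 * weightPsi α δ 0 x) * (timeDeriv 0 (k + 1) u 0 x ^ 2
        + timeDeriv 0 (k + 1 + 1) u 0 x ^ 2 + ‖∇ (timeDeriv 0 (k + 1) u 0) x‖ ^ 2)
        = (∫ x, Real.exp (2 * weightPsi α δ 0 x) *
        (timeDeriv 0 (k + 2) u 0 x ^ 2 + ‖∇ (timeDeriv 0 (k + 1) u 0) x‖ ^ 2))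
        + ∫ x, Real.exp (2 * weightPsi α δ 0 x) * timeDeriv 0 (k + 1) u 0 x ^ 2 := by
      rw [← integral_add i1 i2]
      refine integral_congr_ae (Filter.Eventually.of_forall fun x => ?_)
      simp only
      ring
    rw [k2]
    linarith

/-- Passing from the weight `(t₀+t)^q` to the smaller `(1+t)^q`. -/
theorem rpow_mul_integral_le {t₀ t q C : ℝ} (ht : 0 ≤ t) (ht₀ : 1 ≤ t₀) (hq : 0 ≤ q)
    {f : Rn n → ℝ} (hf : ∀ x, 0 ≤ f x) (h : ∫ x, expWeight α δ t₀ q t x * f x ≤ C) :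
    (1 + t) ^ q * ∫ x, Real.exp (2 * weightPsi α δ t x) * f x ≤ C := by
  refine le_trans ?_ h
  rw [← rpow_mul_integral_eq]
  have : 0 ≤ ∫ x, Real.exp (2 * weightPsi α δ t x) * f x :=
    integral_nonneg fun x => mul_nonneg (Real.exp_pos _).le (hf x)
  gcongr

/-- Decay of the time derivatives of solutions of the damped wave equation, by iterating the decay
step along `u`, `u_t`, `u_tt`, `u_ttt` with rates `B`, `B + 2`, `B + 4`, `B + 6`. -/
theorem exists_wave_decay (hn : 1 ≤ n) (hα0 : 0 ≤ α) (hα1 : α < 1) (hδ : 0 < δ)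
    (hδ1 : δ ≤ 1) (hL : 0 < L) {B : ℝ} (hB : 0 ≤ B)
    (hBβ : B / 2 < (n - α) / ((2 - α) * (2 + δ))) :
    ∃ C : ℝ, 0 < C ∧ ∀ (u₀ u₁ : Rn n → ℝ) (u : ℝ → Rn n → ℝ),
      tsupport u₀ ⊆ Metric.closedBall 0 L → tsupport u₁ ⊆ Metric.closedBall 0 L →
      IsDampedWaveSolution α u₀ u₁ u → ∀ t : ℝ, 0 ≤ t →
        ((1 + t) ^ (B + 2) * ∫ x : Rn n,
            Real.exp (2 * weightPsi α δ t x) * (damping α x * timeDeriv 0 1 u t x ^ 2)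
          ≤ C * dataNorm α δ u₀ u₁ u 1) ∧
        ((1 + t) ^ (B + 3) * ∫ x : Rn n,
            Real.exp (2 * weightPsi α δ t x) * ‖∇ (timeDeriv 0 1 u t) x‖ ^ 2
          ≤ C * dataNorm α δ u₀ u₁ u 1) ∧
        ((1 + t) ^ (B + 4) * ∫ x : Rn n,
            Real.exp (2 * weightPsi α δ t x) * (damping α x * timeDeriv 0 2 u t x ^ 2)
          ≤ C * dataNorm α δ u₀ u₁ u 2) ∧
        ((1 + t) ^ (B + 6) * ∫ x : Rn n,
            Real.exp (2 * weightPsi α δ t x) * (damping α x * timeDeriv 0 3 u t x ^ 2)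
          ≤ C * dataNorm α δ u₀ u₁ u 3) := by
  obtain ⟨T₀, hT₀, h₀⟩ := IsWave.exists_spacetime_bound hn hα0 hα1 hδ hδ1 hL hB hBβ
  obtain ⟨T₁, hT₁, h₁⟩ := IsWave.exists_decay_step (δ := δ) hn hα0 hα1 hδ hδ1 hL hB
  obtain ⟨T₂, hT₂, h₂⟩ := IsWave.exists_decay_step (δ := δ) hn hα0 hα1 hδ hδ1 hL
    (by linarith : 0 ≤ B + 2)
  obtain ⟨T₃, hT₃, h₃⟩ := IsWave.exists_decay_step (δ := δ) hn hα0 hα1 hδ hδ1 hL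
    (by linarith : 0 ≤ B + 4)
  obtain ⟨T₄, hT₄, h₄⟩ := IsWave.exists_decay_step (δ := δ) hn hα0 hα1 hδ hδ1 hL
    (by linarith : 0 ≤ B + 6)
  -- One `t₀` serves all steps, since the weights `(t₀+t)^q` of consecutive steps have to match.
  set t₀ := max T₀ (max T₁ (max T₂ (max T₃ T₄))) with ht₀
  obtain ⟨C₀, hC₀, h₀⟩ := h₀ t₀ (by simp [ht₀])
  obtain ⟨C₁, hC₁, h₁⟩ := h₁ t₀ (by simp [ht₀])
  obtain ⟨C₂, hC₂, h₂⟩ := h₂ t₀ (by simp [ht₀])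
  obtain ⟨C₃, hC₃, h₃⟩ := h₃ t₀ (by simp [ht₀])
  obtain ⟨C₄, hC₄, h₄⟩ := h₄ t₀ (by simp [ht₀])
  have ht₀1 : 1 ≤ t₀ := by
    have : T₀ ≤ t₀ := le_max_left _ _
    linarith
  set K₁ := C₁ * (1 + C₀) with hK₁
  set K₂ := C₂ * (1 + K₁) with hK₂
  set K₃ := C₃ * (1 + K₂) with hK₃
  set K₄ := C₄ * (1 + K₃) with hK₄
  have hK₁0 : 0 < K₁ := by positivity
  have hK₂0 : 0 < K₂ := by positivity
  have hK₃0 : 0 < K₃ := by positivity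
  have hK₄0 : 0 < K₄ := by positivity
  refine ⟨K₂ + K₃ + K₄, by positivity, fun u₀ u₁ u hs₀ hs₁ hu t ht => ?_⟩
  have hw := hu.isWave
  have hs := hu.supportedInCone hs₀ hs₁
  set I := dataNorm α δ u₀ u₁ u with hI
  have hI0 : ∀ k, 0 ≤ I k := dataNorm_nonneg α δ u₀ u₁ u
  have hIs : ∀ k, I k ≤ I (k + 1) := dataNorm_le_succ α δ u₀ u₁ u
  have hJ : ∀ k, dataEnergy α δ (timeDeriv 0 k u) ≤ I k := hu.dataEnergy_le hs
  have b0 : ∀ T, 0 ≤ T → ∫ q in slab n 0 T, expWeight α δ t₀ (B - 1) q.1 q.2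
      * (damping α q.2 * timeDeriv 0 0 u q.1 q.2 ^ 2) ≤ C₀ * I 0 := fun T hT =>
    (h₀ _ (hw.timeDeriv 0) (hs.timeDeriv 0) T hT).trans (by gcongr; exact hJ 0)
  have b1 : ∀ T, 0 ≤ T → ∫ q in slab n 0 T, expWeight α δ t₀ (B + 2 - 1) q.1 q.2
      * (damping α q.2 * timeDeriv 0 1 u q.1 q.2 ^ 2) ≤ K₁ * I 0 := fun T hT => by
    have := (h₁ _ (C₀ * I 0) (hw.timeDeriv 0) (hs.timeDeriv 0) (mul_nonneg hC₀.le (hI0 0))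
      b0 T hT).2.2
    rw [← timeDeriv_succ, show B + 1 = B + 2 - 1 by ring] at this
    refine this.trans ?_
    rw [hK₁, mul_assoc]
    gcongr
    linarith [hJ 0]
  have hstep : ∀ {C K J I I' : ℝ}, 0 < C → 0 < K → J ≤ I' → I ≤ I' →
      C * (J + K * I) ≤ C * (1 + K) * I' := fun {C K J I I'} hC hK h1 h2 => by
    have h3 := mul_le_mul_of_nonneg_left h2 hK.le
    calc C * (J + K * I) ≤ C * (I' + K * I') := by gcongr
      _ = _ := by ring
  have b2 := fun T hT => h₂ _ (K₁ * I 0) (hw.timeDeriv 1) (hs.timeDeriv 1)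
    (mul_nonneg hK₁0.le (hI0 0)) b1 T hT
  have c2 : C₂ * (dataEnergy α δ (timeDeriv 0 1 u) + K₁ * I 0) ≤ K₂ * I 1 :=
    hstep hC₂ hK₁0 (hJ 1) (hIs 0)
  have b2' : ∀ T, 0 ≤ T → ∫ q in slab n 0 T, expWeight α δ t₀ (B + 4 - 1) q.1 q.2
      * (damping α q.2 * timeDeriv 0 2 u q.1 q.2 ^ 2) ≤ K₂ * I 1 := fun T hT => by
    have := (b2 T hT).2.2
    rw [← timeDeriv_succ, show B + 2 + 1 = B + 4 - 1 by ring] at this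
    exact this.trans c2
  have b3 := fun T hT => h₃ _ (K₂ * I 1) (hw.timeDeriv 2) (hs.timeDeriv 2)
    (mul_nonneg hK₂0.le (hI0 1)) b2' T hT
  have c3 : C₃ * (dataEnergy α δ (timeDeriv 0 2 u) + K₂ * I 1) ≤ K₃ * I 2 :=
    hstep hC₃ hK₂0 (hJ 2) (hIs 1)
  have b3' : ∀ T, 0 ≤ T → ∫ q in slab n 0 T, expWeight α δ t₀ (B + 6 - 1) q.1 q.2
      * (damping α q.2 * timeDeriv 0 3 u q.1 q.2 ^ 2) ≤ K₃ * I 2 := fun T hT => by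
    have := (b3 T hT).2.2
    rw [← timeDeriv_succ, show B + 4 + 1 = B + 6 - 1 by ring] at this
    exact this.trans c3
  have b4 := fun T hT => h₄ _ (K₃ * I 2) (hw.timeDeriv 3) (hs.timeDeriv 3)
    (mul_nonneg hK₃0.le (hI0 2)) b3' T hT
  have c4 : C₄ * (dataEnergy α δ (timeDeriv 0 3 u) + K₃ * I 2) ≤ K₄ * I 3 :=
    hstep hC₄ hK₃0 (hJ 3) (hIs 2)
  have hsum : ∀ k, K₂ * I k ≤ (K₂ + K₃ + K₄) * I k ∧ K₃ * I k ≤ (K₂ + K₃ + K₄) * I k ∧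
      K₄ * I k ≤ (K₂ + K₃ + K₄) * I k := fun k => by
    have := hI0 k
    refine ⟨?_, ?_, ?_⟩ <;> gcongr <;> linarith
  have ha := fun (k : ℕ) (x : Rn n) =>
    mul_nonneg (damping_pos α x).le (sq_nonneg (timeDeriv 0 k u t x))
  refine ⟨?_, ?_, ?_, ?_⟩
  · exact rpow_mul_integral_le ht ht₀1 (by linarith) (ha 1)
      (((b2 t ht).1.trans c2).trans (hsum 1).1)
  · have := (b2 t ht).2.1
    rw [show B + 2 + 1 = B + 3 by ring] at this
    exact rpow_mul_integral_le ht ht₀1 (by linarith) (fun x => sq_nonneg _)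
      ((this.trans c2).trans (hsum 1).1)
  · exact rpow_mul_integral_le ht ht₀1 (by linarith) (ha 2)
      (((b3 t ht).1.trans c3).trans (hsum 2).2.1)
  · exact rpow_mul_integral_le ht ht₀1 (by linarith) (ha 3)
      (((b4 t ht).1.trans c4).trans (hsum 3).2.2)

theorem IsDampedWaveSolution.integrable (h : IsDampedWaveSolution α u₀ u₁ u)
    (hs : SupportedInCone L u) (k : ℕ) {t : ℝ} (ht : 0 ≤ t) :
    Integrable (fun x => Real.exp (2 * weightPsi α δ t x) *
      (damping α x * timeDeriv 0 k u t x ^ 2)) ∧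
    Integrable (fun x => Real.exp (2 * weightPsi α δ t x) * ‖∇ (timeDeriv 0 k u t) x‖ ^ 2) := by
  have hW := (h.isWave.timeDeriv k).smooth
  refine ⟨integrable_exp_mul (F := fun t x => damping α x * timeDeriv 0 k u t x ^ 2) (R := L + t)
    (smoothFrom_dampingSq hW) ht fun x hx => ?_,
    integrable_exp_mul (F := fun t x => ‖∇ (timeDeriv 0 k u t) x‖ ^ 2) (R := L + t)
    hW.norm_gradient_sq ht fun x hx => ?_⟩
  · simp [((hs.timeDeriv k).vanish ht hx).1]
  · simp [((hs.timeDeriv k).vanish ht hx).2.2]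

end DampedWave

/-! ### The heat equation: energy inequality and removal of cutoffs -/

/-- `v` is a smooth solution of `a v_t = Δv` on `[τ,∞) × ℝⁿ`, with no condition on the data or at
spatial infinity. -/
structure IsHeat {n : ℕ} (α τ : ℝ) (v : ℝ → Rn n → ℝ) : Prop where
  smooth : SmoothFrom τ v
  equation : ∀ t : ℝ, τ < t → ∀ x : Rn n, damping α x * dTime τ v t x = (Δ (v t)) x

section Heat

variable {n : ℕ} {α δ τ T : ℝ} {v : ℝ → Rn n → ℝ}

theorem IsHeat.deriv_time (hv : IsHeat α τ v) : IsHeat α τ (dTime τ v) where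
  smooth := hv.smooth.deriv_time
  equation t ht x := by
    have h2 := hv.smooth.laplacian.hasDerivAt ht x
    have h3 := (hv.smooth.deriv_time.hasDerivAt ht x).const_mul (damping α x)
    rw [hv.smooth.dTime_laplacian ht x] at h2
    refine h3.unique (h2.congr_of_eventuallyEq ?_)
    filter_upwards [Ioi_mem_nhds ht] with s hs
    exact hv.equation s hs x

/-- The equation holds up to the initial time, by continuity. -/
theorem IsHeat.equation_initial (hv : IsHeat α τ v) (x : Rn n) :
    damping α x * dTime τ v τ x = (Δ (v τ)) x := by
  have h1 := (hv.smooth.deriv_time.const_mul (damping α x)).continuousOn_time x τ self_mem_Ici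
  have h2 := hv.smooth.laplacian.continuousOn_time x τ self_mem_Ici
  have h1' := h1.mono_left (nhdsWithin_mono τ Ioi_subset_Ici_self)
  have h2' := h2.mono_left (nhdsWithin_mono τ Ioi_subset_Ici_self)
  refine tendsto_nhds_unique (h1'.congr' ?_) h2'
  filter_upwards [self_mem_nhdsWithin] with s hs
  exact hv.equation s hs x

/-- The weighted energy inequality for the heat equation, combining the multipliers `ρ₁ v_t` and
`ρ₂ v`; the function `ψ` enters through the divergence of `ρ₂ v² ∇ψ`. -/
theorem IsHeat.integral_energy_le (hv : IsHeat α τ v) {R : ℝ} (hT : τ ≤ T)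
    {ρ₁ ρ₂ ψ G : ℝ → Rn n → ℝ} (hρ₁ : SmoothFrom τ ρ₁) (hρ₂ : SmoothFrom τ ρ₂)
    (hψ : SmoothFrom τ ψ) (hG : SmoothFrom τ G)
    (hz : ∀ t ∈ Icc τ T, ∀ x, R < ‖x‖ → ρ₁ t x = 0 ∧ ρ₂ t x = 0)
    (hG0 : ∀ t ∈ Ioo τ T, ∀ x, R < ‖x‖ → G t x = 0)
    (h : ∀ t ∈ Ioo τ T, ∀ x,
      1 / 2 * dTime τ ρ₁ t x * ‖∇ (v t) x‖ ^ 2 - ρ₁ t x * (damping α x * dTime τ v t x ^ 2)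
        - dTime τ v t x * inner ℝ (∇ (ρ₁ t) x) (∇ (v t) x)
        + 1 / 2 * dTime τ ρ₂ t x * (damping α x * v t x ^ 2) - ρ₂ t x * ‖∇ (v t) x‖ ^ 2
        - v t x * inner ℝ (∇ (ρ₂ t) x) (∇ (v t) x)
        - ρ₂ t x * v t x ^ 2 * (Δ (ψ t)) x - v t x ^ 2 * inner ℝ (∇ (ρ₂ t) x) (∇ (ψ t) x)
        - 2 * ρ₂ t x * v t x * inner ℝ (∇ (v t) x) (∇ (ψ t) x) ≤ G t x) :
    ∫ x, (1 / 2 * ρ₁ T x * ‖∇ (v T) x‖ ^ 2 + 1 / 2 * ρ₂ T x * (damping α x * v T x ^ 2))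
      ≤ (∫ x, (1 / 2 * ρ₁ τ x * ‖∇ (v τ) x‖ ^ 2
        + 1 / 2 * ρ₂ τ x * (damping α x * v τ x ^ 2)))
        + ∫ p in slab n τ T, G p.1 p.2 := by
  have hs := hv.smooth
  have hQ := hs.deriv_time
  refine integral_le_of_dTime_le
    (F := fun t x => 1 / 2 * ρ₁ t x * ‖∇ (v t) x‖ ^ 2
      + 1 / 2 * ρ₂ t x * (damping α x * v t x ^ 2)) (R := R)
    (f₁ := fun t x => ρ₁ t x * dTime τ v t x + ρ₂ t x * v t x) (g₁ := v)
    (f₂ := fun t x => ρ₂ t x * (v t x * v t x)) (g₂ := ψ) hT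
    (((hρ₁.const_mul (1 / 2)).mul hs.norm_gradient_sq).add
      ((hρ₂.const_mul (1 / 2)).mul (smoothFrom_dampingSq hs))) hG
    ((hρ₁.mul hQ).add (hρ₂.mul hs)) hs (hρ₂.mul (hs.mul hs)) hψ ?_ hG0 ?_ ?_ ?_
  · intro t ht x hx
    obtain ⟨h1, h2⟩ := hz t ht x hx
    simp [*]
  · intro t ht x hx
    obtain ⟨h1, h2⟩ := hz t (Ioo_subset_Icc_self ht) x hx
    simp [*]
  · intro t ht x hx
    obtain ⟨h1, h2⟩ := hz t (Ioo_subset_Icc_self ht) x hx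
    simp [*]
  · intro t ht x
    have d1 := hρ₁.hasDerivAt ht.1 x
    have d2 := hρ₂.hasDerivAt ht.1 x
    have dv := hs.hasDerivAt ht.1 x
    have dg := hs.hasDerivAt_norm_gradient_sq ht.1 x
    have hd := ((d1.const_mul (1 / 2)).mul dg).add
      ((d2.const_mul (1 / 2)).mul ((dv.pow 2).const_mul (damping α x)))
    refine ⟨_, hd, ?_⟩
    have k1 := hρ₁.differentiable_slice ht.1.le x
    have k2 := hρ₂.differentiable_slice ht.1.le x
    have k3 := hs.differentiable_slice ht.1.le x
    have k4 := hQ.differentiable_slice ht.1.le x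
    have e1 : ∇ (fun x => ρ₁ t x * dTime τ v t x + ρ₂ t x * v t x) x
        = ρ₁ t x • ∇ (dTime τ v t) x + dTime τ v t x • ∇ (ρ₁ t) x
          + (ρ₂ t x • ∇ (v t) x + v t x • ∇ (ρ₂ t) x) := by
      rw [gradient_add (k1.fun_mul k4) (k2.fun_mul k3), gradient_mul k1 k4, gradient_mul k2 k3]
    have e2 : ∇ (fun x => ρ₂ t x * (v t x * v t x)) x
        = ρ₂ t x • (v t x • ∇ (v t) x + v t x • ∇ (v t) x)
          + (v t x * v t x) • ∇ (ρ₂ t) x := by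
      rw [gradient_mul k2 (k3.fun_mul k3), gradient_mul k3 k3]
    have hle := h t ht x
    rw [e1, e2, ← hv.equation t ht.1 x]
    simp only [inner_add_left, real_inner_smul_left, real_inner_self_eq_norm_sq, Pi.pow_apply]
    refine le_trans (le_of_eq ?_) (add_le_add_left (add_le_add_left hle _) _)
    push_cast
    ring

theorem le_of_forall_le_add_div {a b c r : ℝ} (h : ∀ R, r ≤ R → 0 < R → a ≤ b + c / R) :
    a ≤ b := by
  have h1 : Filter.Tendsto (fun R : ℝ => b + c / R) Filter.atTop (nhds (b + 0)) :=
    (tendsto_const_nhds.div_atTop Filter.tendsto_id).const_add b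
  rw [add_zero] at h1
  refine ge_of_tendsto h1 ?_
  filter_upwards [Filter.eventually_ge_atTop r, Filter.eventually_gt_atTop 0] with R h2 h3
  exact h R h2 h3

/-- Removing the cutoff by monotone convergence. -/
theorem integrable_and_integral_le_of_logCutoff {f : Rn n → ℝ} {K : ℝ} (hf : Continuous f)
    (hf0 : ∀ x, 0 ≤ f x) (h : ∀ r, 0 < r → ∫ x, logCutoff r x ^ 2 * f x ≤ K) :
    Integrable f ∧ ∫ x, f x ≤ K := by
  have hc : ∀ r : ℝ, 0 < r → Integrable fun x => logCutoff r x ^ 2 * f x := fun r hr =>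
    integrable_of_vanish (R := Real.exp (2 * r)) (((contDiff_logCutoff r).continuous.pow 2).mul hf)
      fun x hx => by simp [logCutoff_vanish hr hx]
  have hpos : ∀ k : ℕ, (0 : ℝ) < k + 1 := fun k => by positivity
  have hlim : Filter.Tendsto (fun k : ℕ => ∫⁻ x, ENNReal.ofReal (logCutoff (k + 1) x ^ 2 * f x))
      Filter.atTop (nhds (∫⁻ x, ENNReal.ofReal (f x))) := by
    refine lintegral_tendsto_of_tendsto_of_monotone
      (fun k => (hc _ (hpos k)).aestronglyMeasurable.aemeasurable.ennreal_ofReal)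
      (Filter.Eventually.of_forall fun x k l hkl => ?_)
      (Filter.Eventually.of_forall fun x => ?_)
    · have h1 := logCutoff_nonneg ((k : ℝ) + 1) x
      have h2 : logCutoff ((k : ℝ) + 1) x ≤ logCutoff ((l : ℝ) + 1) x :=
        logCutoff_mono (hpos k) (by gcongr) x
      have h3 := hf0 x
      refine ENNReal.ofReal_le_ofReal ?_
      gcongr
    · refine tendsto_const_nhds.congr' ?_
      filter_upwards [Filter.eventually_ge_atTop ⌈Real.log (bracket x)⌉₊] with k hk
      have h1 : Real.log (bracket x) ≤ (k : ℝ) + 1 := by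
        have := (Nat.le_ceil (Real.log (bracket x))).trans (Nat.cast_le.2 hk)
        linarith
      rw [logCutoff_eq_one (hpos k) h1]
      simp
  -- `K ≥ 0` is needed because `ENNReal.ofReal` truncates.
  have hK : 0 ≤ K := le_trans (integral_nonneg fun x => by
    have := hf0 x; positivity) (h 1 one_pos)
  have hle : ∫⁻ x, ENNReal.ofReal (f x) ≤ ENNReal.ofReal K := by
    refine le_of_tendsto' hlim fun k => ?_
    rw [← ofReal_integral_eq_lintegral_ofReal (hc _ (hpos k))
      (Filter.Eventually.of_forall fun x => by have := hf0 x; positivity)]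
    exact ENNReal.ofReal_le_ofReal (h _ (hpos k))
  have hint : Integrable f := by
    refine ⟨hf.aestronglyMeasurable, ?_⟩
    rw [hasFiniteIntegral_iff_ofReal (Filter.Eventually.of_forall hf0)]
    exact hle.trans_lt ENNReal.ofReal_lt_top
  refine ⟨hint, ?_⟩
  rw [integral_eq_lintegral_of_nonneg_ae (Filter.Eventually.of_forall hf0) hf.aestronglyMeasurable]
  exact ENNReal.toReal_le_of_le_ofReal hK hle

/-- The gradient of the cutoff is small against the damping, because `1/⟨x⟩ ≤ a(x)` for `α ≤ 1`. -/
theorem exists_gradient_logCutoff_bounds (n : ℕ) (hα1 : α ≤ 1) : ∃ M : ℝ, 0 < M ∧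
    ∀ R : ℝ, 0 < R → ∀ x : Rn n,
      ‖∇ (logCutoff R) x‖ ≤ M / R * logCutoff (2 * R) x * damping α x ∧
      ‖∇ (logCutoff R) x‖ * (damping α x * bracket x)
        ≤ M / R * logCutoff (2 * R) x * damping α x := by
  obtain ⟨M, hM, h⟩ := exists_norm_gradient_logCutoff_le n
  refine ⟨M, hM, fun R hR x => ⟨?_, ?_⟩⟩
  · have hb := bracket_pos x
    have h1 : (bracket x)⁻¹ ≤ damping α x := by
      rw [← Real.rpow_neg_one, damping]
      exact Real.rpow_le_rpow_of_exponent_le (one_le_bracket x) (by linarith)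
    have h2 := logCutoff_nonneg (2 * R) x
    calc ‖∇ (logCutoff R) x‖ = ‖∇ (logCutoff R) x‖ * bracket x * (bracket x)⁻¹ := by field_simp
      _ ≤ M / R * logCutoff (2 * R) x * (bracket x)⁻¹ :=
          mul_le_mul_of_nonneg_right (h R hR x) (by positivity)
      _ ≤ _ := by gcongr
  · have ha := damping_pos α x
    calc _ = ‖∇ (logCutoff R) x‖ * bracket x * damping α x := by ring
      _ ≤ _ := mul_le_mul_of_nonneg_right (h R hR x) ha.le

/-- The gradient of a weight `c e^{2φ} χ²`, with a cutoff `χ`. -/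
theorem gradient_exp_mul_sq {φ χ : Rn n → ℝ} {x : Rn n} (c : ℝ) (hφ : DifferentiableAt ℝ φ x)
    (hχ : DifferentiableAt ℝ χ x) :
    ∇ (fun y => c * Real.exp (2 * φ y) * χ y ^ 2) x
      = (2 * (c * Real.exp (2 * φ x)) * χ x ^ 2) • ∇ φ x
        + (2 * (c * Real.exp (2 * φ x)) * χ x) • ∇ χ x := by
  have h1 : HasDerivAt (fun s : ℝ => c * Real.exp (2 * s)) (c * (Real.exp (2 * φ x) * (2 * 1)))
      (φ x) := (((hasDerivAt_id _).const_mul 2).exp).const_mul c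
  have h2 : HasDerivAt (fun s : ℝ => s ^ 2) (2 * χ x) (χ x) := by
    simpa using hasDerivAt_pow 2 (χ x)
  have d1 : DifferentiableAt ℝ (fun y => c * Real.exp (2 * φ y)) x :=
    (((hφ.const_mul 2).exp).const_mul c)
  rw [gradient_mul (f := fun y => c * Real.exp (2 * φ y)) (g := fun y => χ y ^ 2) d1 (hχ.pow 2),
    gradient_comp h1 hφ, gradient_comp h2 hχ, smul_smul, smul_smul, add_comm]
  congr 2 <;> ring

theorem dTime_const (t : ℝ) (ht : τ < t) (x : Rn n) (c : ℝ) :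
    dTime τ (fun _ (_ : Rn n) => c) t x = 0 :=
  SmoothFrom.dTime_eq_of_hasDerivAt ht (hasDerivAt_const t c)

theorem smoothFrom_logCutoff_sq (R : ℝ) :
    SmoothFrom τ fun _ (x : Rn n) => logCutoff R x ^ 2 :=
  (SmoothFrom.of_space (contDiff_logCutoff R)).pow 2

theorem sq_mul_le_of_le_mul_mul {c m χ a s : ℝ} (hc0 : 0 ≤ c) (hc : c ≤ m * χ * a) (ha : 0 ≤ a)
    (ha1 : a ≤ 1) : c ^ 2 * s ^ 2 ≤ m ^ 2 * (χ ^ 2 * (a * s ^ 2)) := by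
  have h1 : a ^ 2 ≤ a := by nlinarith
  calc c ^ 2 * s ^ 2 ≤ (m * χ * a) ^ 2 * s ^ 2 := by gcongr
    _ = m ^ 2 * (χ ^ 2 * (a ^ 2 * s ^ 2)) := by ring
    _ ≤ _ := by gcongr

/-- The pointwise form of the weighted mass estimate with weight `e^{2φ} χ²`. The letters stand
for `p = ∂ₜφ`, `d = |∇φ|`, `c = |∇χ|`, `g = |∇v|`, `W = v`, `X = ∇φ·∇v`, `Y = ∇χ·∇v`, and `Z` bounds
the error of the cutoff. -/
theorem cutoff_dissipation {a p d c g W X Y χ Z : ℝ} (hd : 2 * d ^ 2 ≤ a * -p) (hχ : 0 ≤ χ)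
    (hX : |X| ≤ d * g) (hY : |Y| ≤ c * g) (hZ : c ^ 2 * W ^ 2 ≤ Z) :
    χ ^ 2 * (p * (a * W ^ 2)) - χ ^ 2 * g ^ 2 - W * (2 * χ ^ 2 * X) - W * (2 * χ * Y)
      ≤ 2 * Z := by
  have k1 : -(2 * (W * X)) ≤ g ^ 2 / 2 + 2 * d ^ 2 * W ^ 2 := by
    have h1 : |W * X| ≤ |W| * (d * g) := by rw [abs_mul]; gcongr
    have h2 := neg_abs_le (W * X)
    have h3 := sq_nonneg (g - 2 * (d * |W|))
    have h4 : (d * |W|) ^ 2 = d ^ 2 * W ^ 2 := by rw [mul_pow, sq_abs]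
    linarith [show (g - 2 * (d * |W|)) ^ 2
      = g ^ 2 - 4 * (|W| * (d * g)) + 4 * (d * |W|) ^ 2 by ring]
  have k2 : -(2 * (χ * (W * Y))) ≤ χ ^ 2 * g ^ 2 / 2 + 2 * (c ^ 2 * W ^ 2) := by
    have h1 : |W * Y| ≤ |W| * (c * g) := by rw [abs_mul]; gcongr
    have h2 := neg_abs_le (W * Y)
    have h3 := sq_nonneg (χ * g - 2 * (c * |W|))
    have h4 : (c * |W|) ^ 2 = c ^ 2 * W ^ 2 := by rw [mul_pow, sq_abs]
    have h5 : χ * -(W * Y) ≤ χ * (|W| * (c * g)) := by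
      apply mul_le_mul_of_nonneg_left _ hχ
      linarith
    linarith [show (χ * g - 2 * (c * |W|)) ^ 2
      = χ ^ 2 * g ^ 2 - 4 * (χ * (|W| * (c * g))) + 4 * (c * |W|) ^ 2 by ring]
  have k4 : 2 * d ^ 2 * W ^ 2 ≤ a * -p * W ^ 2 := by gcongr
  have k5 : χ ^ 2 * -(2 * (W * X)) ≤ χ ^ 2 * (g ^ 2 / 2 + a * -p * W ^ 2) := by
    gcongr
    linarith
  linarith [show χ ^ 2 * (p * (a * W ^ 2)) - χ ^ 2 * g ^ 2 - W * (2 * χ ^ 2 * X)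
      - W * (2 * χ * Y) = χ ^ 2 * -(2 * (W * X)) - χ ^ 2 * (g ^ 2 / 2 + a * -p * W ^ 2)
      + -(2 * (χ * (W * Y))) - χ ^ 2 * g ^ 2 / 2 by ring]

/-- The weighted `L²` bound for a bounded weight `φ`: the finite energy of `v` absorbs the
error of the cutoff. -/
theorem IsHeat.cutoff_integral_le_of_bounded (hv : IsHeat α τ v) (hα0 : 0 ≤ α) (hα1 : α ≤ 1)
    {R₀ N : ℝ} (hv0 : ∀ x, R₀ < ‖x‖ → v τ x = 0)
    (hfin : IntegrableOn (fun p : ℝ × Rn n => damping α p.2 * v p.1 p.2 ^ 2) (slab n τ T))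
    {φ : ℝ → Rn n → ℝ} (hφ : SmoothFrom τ φ) (hφN : ∀ t, τ < t → ∀ x, φ t x ≤ N)
    (hφd : ∀ t, τ < t → ∀ x, 2 * ‖∇ (φ t) x‖ ^ 2 ≤ damping α x * -dTime τ φ t x)
    (hT : τ ≤ T) {r : ℝ} (hr : 0 < r) :
    ∫ x, logCutoff r x ^ 2 * (Real.exp (2 * φ T x) * (damping α x * v T x ^ 2))
      ≤ ∫ x, Real.exp (2 * φ τ x) * (damping α x * v τ x ^ 2) := by
  obtain ⟨M, hM, hMb⟩ := exists_gradient_logCutoff_bounds (α := α) n hα1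
  have hs := hv.smooth
  set E := ∫ p in slab n τ T, damping α p.2 * v p.1 p.2 ^ 2 with hE
  have hE0 : 0 ≤ E := setIntegral_slab_nonneg (F := fun t x => damping α x * v t x ^ 2)
    fun t _ x => mul_nonneg (damping_pos α x).le (sq_nonneg _)
  apply le_of_forall_le_add_div (r := max r 1) (c := 4 * Real.exp (2 * N) * M ^ 2 * E)
  intro R hRr hR
  have hRr' : r ≤ R := (le_max_left _ _).trans hRr
  have hR1 : 1 ≤ R := (le_max_right _ _).trans hRr
  have hρ : SmoothFrom τ fun t (x : Rn n) => 1 * Real.exp (2 * φ t x) * logCutoff R x ^ 2 :=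
    (((hφ.const_mul 2).exp).const_mul 1).mul (smoothFrom_logCutoff_sq R)
  have hA : SmoothFrom τ fun t x => damping α x * v t x ^ 2 := smoothFrom_dampingSq hs
  have g1 : SmoothFrom τ fun t x => logCutoff (2 * R) x ^ 2 * (damping α x * v t x ^ 2) :=
    (smoothFrom_logCutoff_sq (2 * R)).mul hA
  have key := hv.integral_energy_le (T := T) (R := Real.exp (2 * (2 * R))) hT
    (ρ₁ := fun _ _ => 0) (ρ₂ := fun t x => 1 * Real.exp (2 * φ t x) * logCutoff R x ^ 2)
    (ψ := fun _ _ => 0) (G := fun t x => 2 * Real.exp (2 * N) * (M / R) ^ 2 *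
      (logCutoff (2 * R) x ^ 2 * (damping α x * v t x ^ 2))) (.const 0) hρ (.const 0)
    (g1.const_mul _)
    (fun t _ x hx => ⟨rfl, by
      rw [logCutoff_vanish hR (lt_of_le_of_lt (Real.exp_le_exp.2 (by linarith)) hx)]; ring⟩)
    (fun t _ x hx => by simp [logCutoff_vanish (by positivity : 0 < 2 * R) hx])
    (by
      intro t ht x
      set χ := logCutoff R x with hχ
      set e := Real.exp (2 * φ t x) with he
      have he0 : 0 < e := Real.exp_pos _
      have heN : e ≤ Real.exp (2 * N) := Real.exp_le_exp.2 (by linarith [hφN t ht.1 x])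
      have d1 : dTime τ (fun t (x : Rn n) => 1 * Real.exp (2 * φ t x) * logCutoff R x ^ 2) t x
          = 2 * dTime τ φ t x * (e * χ ^ 2) := by
        apply SmoothFrom.dTime_eq_of_hasDerivAt ht.1
        have := ((((hφ.hasDerivAt ht.1 x).const_mul 2).exp).const_mul 1).mul_const
          (logCutoff R x ^ 2)
        refine this.congr_deriv ?_
        rw [← he, ← hχ]; ring
      have d2 := gradient_exp_mul_sq (x := x) 1 (hφ.differentiable_slice ht.1.le x)
        ((contDiff_logCutoff R).differentiable (by simp) x)
      have ha := damping_pos α x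
      have ha1 := damping_le_one hα0 x
      have hd := hφd t ht.1 x
      set X := inner ℝ (∇ (φ t) x) (∇ (v t) x) with hX
      set Y := inner ℝ (∇ (logCutoff R) x) (∇ (v t) x) with hY
      have hXle : |X| ≤ ‖∇ (φ t) x‖ * ‖∇ (v t) x‖ := abs_real_inner_le_norm _ _
      have hYle : |Y| ≤ ‖∇ (logCutoff R) x‖ * ‖∇ (v t) x‖ := abs_real_inner_le_norm _ _
      have hc := (hMb R hR x).1
      set c := ‖∇ (logCutoff R) x‖ with hcdef
      set g := ‖∇ (v t) x‖ with hg
      set d := ‖∇ (φ t) x‖ with hddef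
      have hc0 : 0 ≤ c := norm_nonneg _
      have hχ0 : 0 ≤ χ := logCutoff_nonneg R x
      have k3 := sq_mul_le_of_le_mul_mul (s := v t x) hc0 hc ha.le ha1
      have k6 := cutoff_dissipation hd hχ0 hXle hYle k3
      have k7 : 0 ≤ 2 * ((M / R) ^ 2 *
          (logCutoff (2 * R) x ^ 2 * (damping α x * v t x ^ 2))) := by positivity
      have k8 := (mul_le_mul_of_nonneg_left k6 he0.le).trans
        (mul_le_mul_of_nonneg_right heN k7)
      rw [d1, dTime_const t ht.1 x, d2]
      simp only [inner_add_left, real_inner_smul_left, gradient_fun_const, inner_zero_left,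
        inner_zero_right, InnerProductSpace.laplacian_const, Pi.zero_apply]
      rw [← hX, ← hY, ← he]
      refine le_trans (le_of_eq ?_) (k8.trans (le_of_eq ?_)) <;> ring)
  rw [integral_const_mul] at key
  have hEle : ∫ p in slab n τ T, logCutoff (2 * R) p.2 ^ 2 * (damping α p.2 * v p.1 p.2 ^ 2)
      ≤ E := by
    refine setIntegral_mono_on (integrableOn_slab (R := Real.exp (2 * (2 * R)))
      (F := fun t x => logCutoff (2 * R) x ^ 2 * (damping α x * v t x ^ 2)) g1.continuousOn
      fun t _ x hx => by simp [logCutoff_vanish (by positivity : 0 < 2 * R) hx]) hfin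
      measurableSet_slab fun p _ => ?_
    have h1 := logCutoff_nonneg (2 * R) p.2
    have h2 := logCutoff_le_one (2 * R) p.2
    have h3 := damping_pos α p.2
    have h4 : logCutoff (2 * R) p.2 ^ 2 ≤ 1 := pow_le_one₀ h1 h2
    exact mul_le_of_le_one_left (by positivity) h4
  have hW : SmoothFrom τ fun t x => Real.exp (2 * φ t x) * (damping α x * v t x ^ 2) :=
    ((hφ.const_mul 2).exp).mul hA
  have hint : ∀ ρ : ℝ, 0 < ρ → ∀ t, τ ≤ t → Integrable fun x =>
      logCutoff ρ x ^ 2 * (Real.exp (2 * φ t x) * (damping α x * v t x ^ 2)) := fun ρ hρ t ht =>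
    integrable_of_vanish (R := Real.exp (2 * ρ))
      (((smoothFrom_logCutoff_sq ρ).mul hW).contDiff_slice ht).continuous
      fun x hx => by simp [logCutoff_vanish hρ hx]
  have e1 : ∀ t, ∫ x, (1 / 2 * (0 : ℝ) * ‖∇ (v t) x‖ ^ 2 + 1 / 2 * (1 * Real.exp (2 * φ t x) *
      logCutoff R x ^ 2) * (damping α x * v t x ^ 2)) = 1 / 2 * ∫ x, logCutoff R x ^ 2 *
      (Real.exp (2 * φ t x) * (damping α x * v t x ^ 2)) := fun t => by
    rw [← integral_const_mul]
    refine integral_congr_ae (Filter.Eventually.of_forall fun x => ?_)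
    simp only
    ring
  simp only [e1] at key
  have h1 : ∫ x, logCutoff r x ^ 2 * (Real.exp (2 * φ T x) * (damping α x * v T x ^ 2))
      ≤ ∫ x, logCutoff R x ^ 2 * (Real.exp (2 * φ T x) * (damping α x * v T x ^ 2)) := by
    refine integral_mono (hint r hr T hT) (hint R hR T hT) fun x => ?_
    have h2 := logCutoff_nonneg r x
    have h3 := logCutoff_mono hr hRr' x
    have h4 := damping_pos α x
    simp only
    gcongr
  have h2 : ∫ x, logCutoff R x ^ 2 * (Real.exp (2 * φ τ x) * (damping α x * v τ x ^ 2))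
      ≤ ∫ x, Real.exp (2 * φ τ x) * (damping α x * v τ x ^ 2) := by
    refine integral_mono (hint R hR τ le_rfl) (integrable_of_vanish (R := R₀)
      (hW.contDiff_slice le_rfl).continuous fun x hx => by simp [hv0 x hx]) fun x => ?_
    have h4 := damping_pos α x
    exact mul_le_of_le_one_left (by positivity)
      (pow_le_one₀ (logCutoff_nonneg R x) (logCutoff_le_one R x))
  have h3 : 2 * (2 * Real.exp (2 * N) * (M / R) ^ 2 * E)
      ≤ 4 * Real.exp (2 * N) * M ^ 2 * E / R := by
    have : 4 * Real.exp (2 * N) * M ^ 2 * E / R ^ 2 ≤ 4 * Real.exp (2 * N) * M ^ 2 * E / R := by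
      apply div_le_div_of_nonneg_left (by positivity) hR
      nlinarith
    refine le_trans (le_of_eq ?_) this
    rw [div_pow]
    ring
  have h4 : 2 * Real.exp (2 * N) * (M / R) ^ 2 * (∫ p in slab n τ T,
      logCutoff (2 * R) p.2 ^ 2 * (damping α p.2 * v p.1 p.2 ^ 2))
      ≤ 2 * Real.exp (2 * N) * (M / R) ^ 2 * E := by gcongr
  linarith

end Heat

/-! ### The weighted mass of heat solutions -/

section HeatWeight

variable {n : ℕ} {α δ τ T r R : ℝ} {v : ℝ → Rn n → ℝ}

theorem integrable_logCutoff_sq_mul {f : Rn n → ℝ} (hf : Continuous f) (hr : 0 < r) :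
    Integrable fun x => logCutoff r x ^ 2 * f x :=
  integrable_of_vanish (R := Real.exp (2 * r)) (((contDiff_logCutoff r).continuous.pow 2).mul hf)
    fun x hx => by simp [logCutoff_vanish hr hx]

theorem SmoothFrom.integrableOn_logCutoff_sq_mul {F : ℝ → Rn n → ℝ} (hF : SmoothFrom τ F)
    (hr : 0 < r) :
    IntegrableOn (fun p : ℝ × Rn n => logCutoff r p.2 ^ 2 * F p.1 p.2) (slab n τ T) :=
  integrableOn_slab (R := Real.exp (2 * r)) (F := fun t x => logCutoff r x ^ 2 * F t x)
    ((smoothFrom_logCutoff_sq r).mul hF).continuousOn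
    fun t _ x hx => by simp [logCutoff_vanish hr hx]

theorem logCutoff_sq_mul_le {s : ℝ} (hs : 0 ≤ s) (x : Rn n) : logCutoff r x ^ 2 * s ≤ s :=
  mul_le_of_le_one_left hs (pow_le_one₀ (logCutoff_nonneg r x) (logCutoff_le_one r x))

theorem logCutoff_sq_mono (hr : 0 < r) (hR : r ≤ R) (x : Rn n) :
    logCutoff r x ^ 2 ≤ logCutoff R x ^ 2 :=
  pow_le_pow_left₀ (logCutoff_nonneg r x) (logCutoff_mono hr hR x) 2

theorem SmoothFrom.setIntegral_logCutoff_mono {F : ℝ → Rn n → ℝ} (hF : SmoothFrom τ F)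
    (hF0 : ∀ t ∈ Ioo τ T, ∀ x, 0 ≤ F t x) (hr : 0 < r) (hR : r ≤ R) :
    ∫ p in slab n τ T, logCutoff r p.2 ^ 2 * F p.1 p.2
      ≤ ∫ p in slab n τ T, logCutoff R p.2 ^ 2 * F p.1 p.2 :=
  setIntegral_mono_on (hF.integrableOn_logCutoff_sq_mul hr)
    (hF.integrableOn_logCutoff_sq_mul (hr.trans_le hR)) measurableSet_slab fun p hp =>
    mul_le_mul_of_nonneg_right (logCutoff_sq_mono hr hR _) (hF0 p.1 hp.1 p.2)

/-- The weighted mass `∫ a v²` does not increase. -/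
theorem IsHeat.integrable_and_integral_le (hv : IsHeat α τ v) (hα0 : 0 ≤ α) (hα1 : α ≤ 1)
    {R₀ : ℝ} (hv0 : ∀ x, R₀ < ‖x‖ → v τ x = 0)
    (hfin : IntegrableOn (fun p : ℝ × Rn n => damping α p.2 * v p.1 p.2 ^ 2) (slab n τ T))
    (hT : τ ≤ T) :
    Integrable (fun x => damping α x * v T x ^ 2) ∧
      ∫ x, damping α x * v T x ^ 2 ≤ ∫ x, damping α x * v τ x ^ 2 := by
  refine integrable_and_integral_le_of_logCutoff
    ((smoothFrom_dampingSq hv.smooth).contDiff_slice hT).continuous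
    (fun x => mul_nonneg (damping_pos α x).le (sq_nonneg _)) fun r hr => ?_
  have h := hv.cutoff_integral_le_of_bounded hα0 hα1 (N := 0) hv0 hfin (φ := fun _ _ => 0)
    (.const 0) (fun t _ x => le_rfl) (fun t ht x => by
      rw [dTime_const t ht x, gradient_fun_const]; simp) hT hr
  simpa using h

/-- The weighted bound `∫ e^{2ψ(t)} a v(t)² ≤ ∫ e^{2ψ(τ)} a v(τ)²`. The bounded weights
`ψ / (1 + mψ)` are admissible and increase to `ψ` as `m → 0`. -/
theorem IsHeat.cutoff_integral_exp_le (hv : IsHeat α τ v) (hα0 : 0 ≤ α) (hα1 : α ≤ 1)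
    (hδ : 0 < δ) (hτ : 0 ≤ τ) {R₀ : ℝ} (hv0 : ∀ x, R₀ < ‖x‖ → v τ x = 0)
    (hfin : IntegrableOn (fun p : ℝ × Rn n => damping α p.2 * v p.1 p.2 ^ 2) (slab n τ T))
    (hT : τ ≤ T) (hr : 0 < r) :
    ∫ x, logCutoff r x ^ 2 * (Real.exp (2 * weightPsi α δ T x) * (damping α x * v T x ^ 2))
      ≤ ∫ x, Real.exp (2 * weightPsi α δ τ x) * (damping α x * v τ x ^ 2) := by
  have hψ : SmoothFrom (n := n) τ (weightPsi α δ) := smoothFrom_weightPsi hτ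
  have hψ0 : ∀ t, τ ≤ t → ∀ x : Rn n, 0 ≤ weightPsi α δ t x := fun t ht x =>
    weightPsi_nonneg hδ (hτ.trans ht) x
  have hA : SmoothFrom τ fun t x => damping α x * v t x ^ 2 := smoothFrom_dampingSq hv.smooth
  have hA0 : ∀ t x, 0 ≤ damping α x * v t x ^ 2 := fun t x =>
    mul_nonneg (damping_pos α x).le (sq_nonneg _)
  have hφ : ∀ m : ℝ, 0 < m →
      SmoothFrom (n := n) τ fun t x => weightPsi α δ t x / (1 + m * weightPsi α δ t x) :=
    fun m hm => ContDiffOn.div hψ ((SmoothFrom.const 1).add (hψ.const_mul m)) fun p hp => by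
      have := hψ0 p.1 hp.1 p.2
      positivity
  have hφle : ∀ m : ℝ, 0 < m → ∀ t, τ ≤ t → ∀ x : Rn n,
      weightPsi α δ t x / (1 + m * weightPsi α δ t x) ≤ weightPsi α δ t x := fun m hm t ht x => by
    have := hψ0 t ht x
    exact div_le_self this (by nlinarith)
  have hbound : ∀ m : ℝ, 0 < m →
      ∫ x, logCutoff r x ^ 2 * (Real.exp (2 * (weightPsi α δ T x / (1 + m * weightPsi α δ T x)))
        * (damping α x * v T x ^ 2))
      ≤ ∫ x, Real.exp (2 * weightPsi α δ τ x) * (damping α x * v τ x ^ 2) := by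
    intro m hm
    have hh : ∀ s : ℝ, 0 ≤ s → HasDerivAt (fun s : ℝ => s / (1 + m * s)) (1 / (1 + m * s) ^ 2) s :=
      fun s hs => by
        have h1 : HasDerivAt (fun s : ℝ => 1 + m * s) (m * 1) s :=
          ((hasDerivAt_id s).const_mul m).const_add 1
        refine ((hasDerivAt_id s).div h1 (by positivity)).congr_deriv ?_
        rw [id, show 1 * (1 + m * s) - s * (m * 1) = 1 by ring]
    refine (hv.cutoff_integral_le_of_bounded hα0 hα1 (N := 1 / m) hv0 hfin (hφ m hm)
      (fun t ht x => ?_) (fun t ht x => ?_) hT hr).trans ?_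
    · have h0 := hψ0 t ht.le x
      rw [div_le_div_iff₀ (by positivity) hm]
      linarith
    · have h0 := hψ0 t ht.le x
      have ht0 : 0 ≤ t := hτ.trans ht.le
      set s := weightPsi α δ t x with hs
      have e1 : dTime τ (fun t (x : Rn n) => weightPsi α δ t x / (1 + m * weightPsi α δ t x)) t x
          = 1 / (1 + m * s) ^ 2 * -(s / (1 + t)) := by
        apply SmoothFrom.dTime_eq_of_hasDerivAt ht
        exact (hh s h0).comp t (hasDerivAt_weightPsi ht0 x)
      have e2 := gradient_comp (f := weightPsi α δ t) (x := x) (hh s h0)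
        (hψ.differentiable_slice ht.le x)
      have ha := damping_pos α x
      have h2 := two_mul_norm_gradient_weightPsi_sq_le (α := α) (by linarith) hδ ht0 x
      rw [← hs] at h2
      have h3 : 1 / (1 + m * s) ^ 2 ≤ 1 := by
        rw [div_le_one (by positivity)]
        have := mul_nonneg hm.le h0
        nlinarith
      rw [e1, e2, norm_smul, mul_pow, Real.norm_eq_abs, sq_abs]
      calc 2 * ((1 / (1 + m * s) ^ 2) ^ 2 * ‖∇ (weightPsi α δ t) x‖ ^ 2)
          = 1 / (1 + m * s) ^ 2 * (1 / (1 + m * s) ^ 2) *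
            (2 * ‖∇ (weightPsi α δ t) x‖ ^ 2) := by ring
        _ ≤ 1 / (1 + m * s) ^ 2 * 1 * (damping α x * (s / (1 + t))) := by gcongr
        _ = _ := by ring
    · refine integral_mono
        (integrable_of_vanish (R := R₀) (((((hφ m hm).const_mul 2).exp).mul hA).contDiff_slice
          le_rfl).continuous fun x hx => by simp [hv0 x hx])
        (integrable_of_vanish (R := R₀) ((((hψ.const_mul 2).exp).mul hA).contDiff_slice
          le_rfl).continuous fun x hx => by simp [hv0 x hx]) fun x => ?_
      exact mul_le_mul_of_nonneg_right (Real.exp_le_exp.2 (by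
        linarith [hφle m hm τ le_rfl x])) (hA0 τ x)
  refine le_of_tendsto'
    (tendsto_integral_of_dominated_convergence
      (F := fun (k : ℕ) x => logCutoff r x ^ 2 *
        (Real.exp (2 * (weightPsi α δ T x / (1 + 1 / ((k : ℝ) + 1) * weightPsi α δ T x)))
          * (damping α x * v T x ^ 2)))
      (fun x => logCutoff r x ^ 2 * (Real.exp (2 * weightPsi α δ T x) *
        (damping α x * v T x ^ 2))) (fun k => ?_) ?_ (fun k => ?_) ?_)
    fun k : ℕ => hbound (1 / ((k : ℝ) + 1)) (one_div_pos.2 (Nat.cast_add_one_pos k))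
  · exact (integrable_logCutoff_sq_mul ((((hφ (1 / ((k : ℝ) + 1))
      (by positivity)).const_mul 2).exp.mul hA).contDiff_slice hT).continuous
      hr).aestronglyMeasurable
  · exact integrable_logCutoff_sq_mul (((hψ.const_mul 2).exp.mul
      hA).contDiff_slice hT).continuous hr
  · refine Filter.Eventually.of_forall fun x => ?_
    have h1 := hA0 T x
    rw [Real.norm_of_nonneg (by positivity)]
    gcongr
    exact hφle _ (by positivity) T hT x
  · refine Filter.Eventually.of_forall fun x => ?_
    have h1 : Filter.Tendsto (fun k : ℕ => 1 + 1 / ((k : ℝ) + 1) * weightPsi α δ T x)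
        Filter.atTop (nhds (1 + 0 * weightPsi α δ T x)) :=
      (tendsto_one_div_add_atTop_nhds_zero_nat.mul_const _).const_add 1
    have h2 := (tendsto_const_nhds (x := weightPsi α δ T x)).div h1 (by simp)
    rw [zero_mul, add_zero, div_one] at h2
    exact (((Real.continuous_exp.tendsto _).comp (h2.const_mul 2)).mul_const _).const_mul _

end HeatWeight

/-! ### Decay of the time derivative of heat solutions -/

section HeatDecay

variable {n : ℕ} {α δ τ T r R B : ℝ} {v : ℝ → Rn n → ℝ}

/-- The pointwise form of the weighted `L²` estimate with weight `(1+t)^B e^{2ψ} χ²`: the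
quadratic form is coercive up to the errors `Z₁`, `Z₂` of the cutoff. The letters stand for
`S = 1+t`, `m = -∂ₜψ`, `d = |∇ψ|`, `c = |∇χ|`, `g = |∇v|`, `W = v`, `Λ = Δψ`, `X = ∇ψ·∇v`,
`Y = ∇χ·∇v`, `Z = ∇χ·∇ψ`. -/
theorem cutoff_coercive {a m d c g W X Y Z χ Λ S Z₁ Z₂ : ℝ} (hδ : 0 < δ) (hδ1 : δ ≤ 1)
    (hd : (2 + δ) * d ^ 2 ≤ a * m) (ha : 0 ≤ a) (hm : 0 ≤ m) (hχ : 0 ≤ χ) (hX : |X| ≤ d * g)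
    (hY : |Y| ≤ c * g) (hZ : |Z| ≤ c * d) (h₁ : c ^ 2 * W ^ 2 ≤ Z₁) (h₂ : χ * (c * d) * W ^ 2 ≤ Z₂)
    (hΛ : B / 2 * (a / S) ≤ Λ) :
    1 / 2 * (χ ^ 2 * (B / S - 2 * m)) * (a * W ^ 2) - χ ^ 2 * g ^ 2
        - W * (2 * χ ^ 2 * X + 2 * χ * Y) - χ ^ 2 * W ^ 2 * Λ
        - W ^ 2 * (2 * χ ^ 2 * d ^ 2 + 2 * χ * Z) - 2 * χ ^ 2 * W * X
      ≤ 2 / (δ / 16) * Z₁ + 2 * Z₂ - δ / 16 / 2 * (χ ^ 2 * g ^ 2) := by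
  have k1 := mul_le_mul_of_nonneg_left (quadraticForm_coercive (W := W) hδ hδ1 hd hX)
    (sq_nonneg χ)
  have k2 : -(2 * (χ * (W * Y))) ≤ δ / 16 / 2 * (χ ^ 2 * g ^ 2) + 2 / (δ / 16) * Z₁ := by
    have h1 : |W * Y| ≤ |W| * (c * g) := by rw [abs_mul]; gcongr
    have h2 := neg_abs_le (W * Y)
    have h3 : 0 ≤ (δ / 16 * (χ * g) - 2 * (c * |W|)) ^ 2 / (2 * (δ / 16)) := by positivity
    have h4 : (δ / 16 * (χ * g) - 2 * (c * |W|)) ^ 2 / (2 * (δ / 16))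
        = δ / 16 / 2 * (χ ^ 2 * g ^ 2) + 2 / (δ / 16) * (c * |W|) ^ 2
          - 2 * (χ * (|W| * (c * g))) := by
      field_simp
      ring
    have h5 : χ * -(W * Y) ≤ χ * (|W| * (c * g)) := by
      apply mul_le_mul_of_nonneg_left _ hχ
      linarith
    have h6 : 2 / (δ / 16) * (c * |W|) ^ 2 ≤ 2 / (δ / 16) * Z₁ := by
      rw [mul_pow, sq_abs]
      gcongr
    linarith
  have k3 : -(χ * Z * W ^ 2) ≤ Z₂ := by
    have h1 : χ * -Z ≤ χ * (c * d) :=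
      mul_le_mul_of_nonneg_left ((neg_le_abs Z).trans hZ) hχ
    have h2 := mul_le_mul_of_nonneg_right h1 (sq_nonneg W)
    linarith
  have k4 := mul_le_mul_of_nonneg_left hΛ (mul_nonneg (sq_nonneg χ) (sq_nonneg W))
  have k5 : 0 ≤ δ / 16 * (m * a * W ^ 2) := by positivity
  have k6 := mul_nonneg (sq_nonneg χ) k5
  have e : 1 / 2 * (χ ^ 2 * (B / S - 2 * m)) * (a * W ^ 2)
      = χ ^ 2 * W ^ 2 * (B / 2 * (a / S)) - χ ^ 2 * (m * a * W ^ 2) := by ring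
  rw [e]
  linarith [mul_add (χ ^ 2) (δ / 16 * g ^ 2) (δ / 16 * (m * a * W ^ 2)),
    show χ ^ 2 * (g ^ 2 + 4 * (W * X) + 2 * d ^ 2 * W ^ 2 + m * a * W ^ 2)
      = χ ^ 2 * g ^ 2 + W * (2 * χ ^ 2 * X) + 2 * χ ^ 2 * W * X + W ^ 2 * (2 * χ ^ 2 * d ^ 2)
        + χ ^ 2 * (m * a * W ^ 2) by ring]

/-- The pointwise form of the energy estimate with a weight `(1+t)^B e^{2ψ} χ²`, in the notation of
`cutoff_coercive` and with `P = v_t`. -/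
theorem cutoff_velocity_dissipation {a m d c g P X Y χ S Z : ℝ} (ha : 0 < a)
    (hd : 2 * d ^ 2 ≤ a * m) (hχ : 0 ≤ χ) (hX : |X| ≤ d * g) (hY : |Y| ≤ c * g)
    (hc : c ^ 2 ≤ a * Z) :
    1 / 2 * (χ ^ 2 * (B / S - 2 * m)) * g ^ 2 - χ ^ 2 * (a * P ^ 2)
        - P * (2 * χ ^ 2 * X + 2 * χ * Y)
      ≤ B / 2 * (χ ^ 2 * g ^ 2 / S) - 1 / 4 * (χ ^ 2 * (a * P ^ 2)) + 4 * (Z * g ^ 2) := by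
  have k1 : -(2 * (P * X)) ≤ a * P ^ 2 / 2 + m * g ^ 2 := by
    linarith [abs_velocity_cross_le (P := P) ha hd hX, neg_abs_le (P * X)]
  have k2 : -(2 * (χ * (P * Y))) ≤ 1 / 4 * (χ ^ 2 * (a * P ^ 2)) + 4 * (Z * g ^ 2) := by
    have h1 : |P * Y| ≤ |P| * (c * g) := by rw [abs_mul]; gcongr
    have h2 := neg_abs_le (P * Y)
    have h3 : 0 ≤ (a * (χ * |P|) - 4 * (c * g)) ^ 2 / (4 * a) := by positivity
    have h4 : (a * (χ * |P|) - 4 * (c * g)) ^ 2 / (4 * a)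
        = 1 / 4 * (χ ^ 2 * (a * P ^ 2)) - 2 * (χ * (|P| * (c * g))) + 4 * (c ^ 2 / a * g ^ 2) := by
      rw [← sq_abs P]
      field_simp
      ring
    have h5 : χ * -(P * Y) ≤ χ * (|P| * (c * g)) := by
      apply mul_le_mul_of_nonneg_left _ hχ
      linarith
    have h6 : c ^ 2 / a * g ^ 2 ≤ Z * g ^ 2 := by
      gcongr
      rw [div_le_iff₀ ha]
      linarith
    linarith
  have k3 := mul_le_mul_of_nonneg_left k1 (sq_nonneg χ)
  have e : 1 / 2 * (χ ^ 2 * (B / S - 2 * m)) * g ^ 2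
      = B / 2 * (χ ^ 2 * g ^ 2 / S) - χ ^ 2 * (m * g ^ 2) := by ring
  rw [e]
  linarith

/-- The time derivative of the weight `(1+t)^B e^{2ψ} χ²`. -/
theorem dTime_expWeight_mul_sq (hτ : 0 ≤ τ) {t : ℝ} (ht : τ < t) (χ : Rn n → ℝ) (x : Rn n) :
    dTime τ (fun t x => expWeight α δ 1 B t x * χ x ^ 2) t x
      = expWeight α δ 1 B t x *
        (χ x ^ 2 * (B / (1 + t) - 2 * (weightPsi α δ t x / (1 + t)))) := by
  rw [SmoothFrom.dTime_eq_of_hasDerivAt ht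
    ((hasDerivAt_expWeight one_pos (hτ.trans ht.le) x).mul_const (χ x ^ 2))]
  ring

theorem gradient_expWeight_mul_sq {t : ℝ} (ht : 0 ≤ t) {χ : Rn n → ℝ} {x : Rn n}
    (hχ : DifferentiableAt ℝ χ x) :
    ∇ (fun x => expWeight α δ 1 B t x * χ x ^ 2) x
      = expWeight α δ 1 B t x • ((2 * χ x ^ 2) • ∇ (weightPsi α δ t) x
        + (2 * χ x) • ∇ χ x) := by
  have h := gradient_exp_mul_sq (φ := weightPsi α δ t) ((1 + t) ^ B)
    ((smoothFrom_weightPsi le_rfl).differentiable_slice ht x) hχ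
  refine h.trans ?_
  rw [smul_add, smul_smul, smul_smul]
  unfold expWeight
  congr 2 <;> ring

/-- The space-time integral of `(1+t)^B e^{2ψ}|∇v|²` is controlled by the weighted mass of the data.
The a priori bound `hK` enters only through the cutoff error, which is of size `1/R`, so that `K`
does not appear in the conclusion. -/
theorem IsHeat.setIntegral_gradient_le (hv : IsHeat α τ v) (hα0 : 0 ≤ α) (hα1 : α ≤ 1)
    (hδ : 0 < δ) (hδ1 : δ ≤ 1) (hτ : 0 ≤ τ) (hB : 0 ≤ B)
    (hBβ : B / 2 ≤ (n - α) / ((2 - α) * (2 + δ))) {R₀ K : ℝ}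
    (hv0 : ∀ x, R₀ < ‖x‖ → v τ x = 0) (hT : τ ≤ T)
    (hK : ∀ t ∈ Ioo τ T, ∀ r, 0 < r → ∫ x, logCutoff r x ^ 2 *
      (Real.exp (2 * weightPsi α δ t x) * (damping α x * v t x ^ 2)) ≤ K) (hr : 0 < r) :
    ∫ p in slab n τ T, logCutoff r p.2 ^ 2 * (expWeight α δ 1 B p.1 p.2 * ‖∇ (v p.1) p.2‖ ^ 2)
      ≤ 16 / δ * ∫ x, expWeight α δ 1 B τ x * (damping α x * v τ x ^ 2) := by
  obtain ⟨M, hM, hMb⟩ := exists_gradient_logCutoff_bounds (α := α) n hα1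
  have hs := hv.smooth
  have hE : SmoothFrom (n := n) τ (expWeight α δ 1 B) := smoothFrom_expWeight hτ one_pos
  have hE0 : ∀ t, τ ≤ t → ∀ x : Rn n, 0 < expWeight α δ 1 B t x := fun t ht x =>
    expWeight_pos (by linarith) x
  have hA : SmoothFrom τ fun t x => damping α x * v t x ^ 2 := smoothFrom_dampingSq hs
  have hA0 : ∀ t x, 0 ≤ damping α x * v t x ^ 2 := fun t x =>
    mul_nonneg (damping_pos α x).le (sq_nonneg _)
  have hEA : SmoothFrom τ fun t x => expWeight α δ 1 B t x * (damping α x * v t x ^ 2) :=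
    hE.mul hA
  have hEg : SmoothFrom τ fun t x => expWeight α δ 1 B t x * ‖∇ (v t) x‖ ^ 2 :=
    hE.mul hs.norm_gradient_sq
  set c : ℝ := 2 / (δ / 16) * M ^ 2 + 2 * M with hc
  set V : ℝ := (1 + T) ^ B * K * (volume : Measure ℝ).real (Ioo τ T) with hV
  have hV0 : ∀ ρ, 0 < ρ → ∫ p in slab n τ T, logCutoff ρ p.2 ^ 2 *
      (expWeight α δ 1 B p.1 p.2 * (damping α p.2 * v p.1 p.2 ^ 2)) ≤ V := by
    intro ρ hρ
    rw [setIntegral_slab (R := Real.exp (2 * ρ)) (F := fun t x => logCutoff ρ x ^ 2 *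
      (expWeight α δ 1 B t x * (damping α x * v t x ^ 2)))
      ((smoothFrom_logCutoff_sq ρ).mul hEA).continuousOn
      fun t _ x hx => by simp [logCutoff_vanish hρ hx]]
    refine (Real.le_norm_self _).trans
      (norm_setIntegral_le_of_norm_le_const (by simp) fun t ht => ?_)
    have h1 : ∀ x : Rn n, 0 ≤ logCutoff ρ x ^ 2 *
        (expWeight α δ 1 B t x * (damping α x * v t x ^ 2)) := fun x =>
      mul_nonneg (sq_nonneg _) (mul_nonneg (hE0 t ht.1.le x).le (hA0 t x))
    rw [Real.norm_of_nonneg (integral_nonneg h1)]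
    have h2 : ∫ x, logCutoff ρ x ^ 2 * (expWeight α δ 1 B t x * (damping α x * v t x ^ 2))
        = (1 + t) ^ B * ∫ x, logCutoff ρ x ^ 2 *
          (Real.exp (2 * weightPsi α δ t x) * (damping α x * v t x ^ 2)) := by
      rw [← integral_const_mul]
      refine integral_congr_ae (Filter.Eventually.of_forall fun x => ?_)
      simp only [expWeight]
      ring
    have h3 : (1 + t) ^ B ≤ (1 + T) ^ B :=
      Real.rpow_le_rpow (by linarith [ht.1]) (by linarith [ht.2]) hB
    have h4 : 0 ≤ ∫ x, logCutoff ρ x ^ 2 *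
          (Real.exp (2 * weightPsi α δ t x) * (damping α x * v t x ^ 2)) :=
      integral_nonneg fun x => mul_nonneg (sq_nonneg _)
        (mul_nonneg (Real.exp_pos _).le (hA0 t x))
    rw [h2]
    exact mul_le_mul h3 (hK t ht ρ hρ) h4 (Real.rpow_nonneg (by linarith) _)
  apply le_of_forall_le_add_div (r := max r 1) (c := 2 / (δ / 16) * (c * V))
  intro R hRr hR
  have hRr' : r ≤ R := (le_max_left _ _).trans hRr
  have hR1 : 1 ≤ R := (le_max_right _ _).trans hRr
  have h2R : 0 < 2 * R := by linarith
  have key := hv.integral_energy_le (T := T) (R := Real.exp (2 * (2 * R))) hT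
    (ρ₁ := fun _ _ => 0) (ρ₂ := fun t x => expWeight α δ 1 B t x * logCutoff R x ^ 2)
    (ψ := weightPsi α δ)
    (G := fun t x => (2 / (δ / 16) * (M / R) ^ 2 + 2 * (M / R)) * (logCutoff (2 * R) x ^ 2 *
        (expWeight α δ 1 B t x * (damping α x * v t x ^ 2)))
      - δ / 16 / 2 * (logCutoff R x ^ 2 * (expWeight α δ 1 B t x * ‖∇ (v t) x‖ ^ 2)))
    (.const 0) (hE.mul (smoothFrom_logCutoff_sq R)) (smoothFrom_weightPsi hτ)
    ((((smoothFrom_logCutoff_sq (2 * R)).mul hEA).const_mul _).sub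
      (((smoothFrom_logCutoff_sq R).mul hEg).const_mul _))
    (fun t _ x hx => ⟨rfl, by
      rw [logCutoff_vanish hR (lt_of_le_of_lt (Real.exp_le_exp.2 (by linarith)) hx)]; ring⟩)
    (fun t _ x hx => by
      rw [logCutoff_vanish hR (lt_of_le_of_lt (Real.exp_le_exp.2 (by linarith)) hx),
        logCutoff_vanish h2R hx]; ring)
    (by
      intro t ht x
      have ht0 : 0 ≤ t := hτ.trans ht.1.le
      have ha := damping_pos α x
      have ha1 := damping_le_one hα0 x
      have hψ0 : 0 ≤ weightPsi α δ t x := weightPsi_nonneg hδ ht0 x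
      have hd1 := dTime_expWeight_mul_sq (α := α) (δ := δ) (B := B) hτ ht.1 (logCutoff R) x
      have hd2 := gradient_expWeight_mul_sq (α := α) (δ := δ) (B := B) ht0
        ((contDiff_logCutoff R).differentiable (by simp) x)
      rw [hd1, hd2, dTime_const t ht.1 x]
      simp only [inner_add_left, real_inner_smul_left, gradient_fun_const, inner_zero_left,
        real_inner_self_eq_norm_sq]
      rw [real_inner_comm (∇ (weightPsi α δ t) x) (∇ (v t) x)]
      set χ := logCutoff R x with hχ
      set E := expWeight α δ 1 B t x with hEdef
      have hE0' : 0 < E := hE0 t ht.1.le x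
      have hXle : |inner ℝ (∇ (weightPsi α δ t) x) (∇ (v t) x)|
        ≤ ‖∇ (weightPsi α δ t) x‖ * ‖∇ (v t) x‖ := abs_real_inner_le_norm _ _
      have hYle : |inner ℝ (∇ (logCutoff R) x) (∇ (v t) x)|
        ≤ ‖∇ (logCutoff R) x‖ * ‖∇ (v t) x‖ := abs_real_inner_le_norm _ _
      have hZle : |inner ℝ (∇ (logCutoff R) x) (∇ (weightPsi α δ t) x)|
        ≤ ‖∇ (logCutoff R) x‖ * ‖∇ (weightPsi α δ t) x‖ := abs_real_inner_le_norm _ _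
      have hχ0 : 0 ≤ χ := logCutoff_nonneg R x
      have hχ2 : χ ≤ logCutoff (2 * R) x := logCutoff_mono hR (by linarith) x
      have h₁ := sq_mul_le_of_le_mul_mul (s := v t x) (norm_nonneg _) (hMb R hR x).1 ha.le ha1
      have h₂ : χ * (‖∇ (logCutoff R) x‖ * ‖∇ (weightPsi α δ t) x‖) * v t x ^ 2
          ≤ M / R * (logCutoff (2 * R) x ^ 2 * (damping α x * v t x ^ 2)) := by
        have h1 : ‖∇ (logCutoff R) x‖ * ‖∇ (weightPsi α δ t) x‖
            ≤ M / R * logCutoff (2 * R) x * damping α x :=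
          (mul_le_mul_of_nonneg_left (norm_gradient_weightPsi_le hα1 hδ ht0 x)
            (norm_nonneg _)).trans (hMb R hR x).2
        have h3 := logCutoff_nonneg (2 * R) x
        calc _ ≤ logCutoff (2 * R) x * (M / R * logCutoff (2 * R) x * damping α x) * v t x ^ 2 := by
              apply mul_le_mul_of_nonneg_right _ (sq_nonneg _)
              exact mul_le_mul hχ2 h1 (by positivity) h3
          _ = _ := by ring
      have hΛ : B / 2 * (damping α x / (1 + t)) ≤ (Δ (weightPsi α δ t)) x :=
        (mul_le_mul_of_nonneg_right hBβ (by positivity)).trans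
          (le_laplacian_weightPsi hα0 (by linarith) hδ ht0 x)
      have k := cutoff_coercive (B := B) hδ hδ1
        (norm_gradient_weightPsi_sq_le (by linarith) hδ ht0 x)
        ha.le (by positivity) hχ0 hXle hYle hZle h₁ h₂ hΛ
      refine le_trans (le_of_eq ?_)
        ((mul_le_mul_of_nonneg_left k hE0'.le).trans (le_of_eq ?_)) <;> ring)
  rw [integral_sub (((hEA.integrableOn_logCutoff_sq_mul h2R)).const_mul _)
    ((hEg.integrableOn_logCutoff_sq_mul hR).const_mul _), integral_const_mul,
    integral_const_mul] at key
  have e1 : ∀ t, ∫ x, (1 / 2 * (0 : ℝ) * ‖∇ (v t) x‖ ^ 2 + 1 / 2 * (expWeight α δ 1 B t x *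
      logCutoff R x ^ 2) * (damping α x * v t x ^ 2)) = 1 / 2 * ∫ x, logCutoff R x ^ 2 *
      (expWeight α δ 1 B t x * (damping α x * v t x ^ 2)) := fun t => by
    rw [← integral_const_mul]
    refine integral_congr_ae (Filter.Eventually.of_forall fun x => ?_)
    simp only
    ring
  simp only [e1] at key
  have h1 : 0 ≤ ∫ x, logCutoff R x ^ 2 *
      (expWeight α δ 1 B T x * (damping α x * v T x ^ 2)) := integral_nonneg fun x =>
    mul_nonneg (sq_nonneg _) (mul_nonneg (hE0 T hT x).le (hA0 T x))
  have h2 : ∫ x, logCutoff R x ^ 2 * (expWeight α δ 1 B τ x * (damping α x * v τ x ^ 2))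
      ≤ ∫ x, expWeight α δ 1 B τ x * (damping α x * v τ x ^ 2) := by
    have hc := (hEA.contDiff_slice le_rfl).continuous
    refine integral_mono (integrable_logCutoff_sq_mul hc hR) (integrable_of_vanish (R := R₀)
      hc fun x hx => by simp [hv0 x hx]) fun x => ?_
    exact logCutoff_sq_mul_le (mul_nonneg (hE0 τ le_rfl x).le (hA0 τ x)) x
  have h3 := hEg.setIntegral_logCutoff_mono (T := T)
    (fun t ht x => mul_nonneg (hE0 t ht.1.le x).le (sq_nonneg _)) hr hRr'
  have h4 : (2 / (δ / 16) * (M / R) ^ 2 + 2 * (M / R)) * (∫ p in slab n τ T,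
      logCutoff (2 * R) p.2 ^ 2 * (expWeight α δ 1 B p.1 p.2 * (damping α p.2 * v p.1 p.2 ^ 2)))
      ≤ c * V / R := by
    have hI0 : 0 ≤ ∫ p in slab n τ T, logCutoff (2 * R) p.2 ^ 2 *
        (expWeight α δ 1 B p.1 p.2 * (damping α p.2 * v p.1 p.2 ^ 2)) :=
      setIntegral_slab_nonneg (F := fun t x => logCutoff (2 * R) x ^ 2 *
        (expWeight α δ 1 B t x * (damping α x * v t x ^ 2))) fun t ht x =>
        mul_nonneg (sq_nonneg _) (mul_nonneg (hE0 t ht.1.le x).le (hA0 t x))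
    have h5 : 2 / (δ / 16) * (M / R) ^ 2 + 2 * (M / R) ≤ c / R := by
      have : 2 / (δ / 16) * M ^ 2 / R ^ 2 ≤ 2 / (δ / 16) * M ^ 2 / R := by
        apply div_le_div_of_nonneg_left (by positivity) hR
        nlinarith
      rw [hc, div_pow, add_div]
      linarith [mul_div_assoc (2 / (δ / 16)) (M ^ 2) (R ^ 2), mul_div_assoc 2 M R]
    calc _ ≤ c / R * V := mul_le_mul h5 (hV0 _ h2R) hI0 (by positivity)
      _ = _ := by ring
  have h6 : δ / 16 / 2 * (∫ p in slab n τ T, logCutoff R p.2 ^ 2 *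
      (expWeight α δ 1 B p.1 p.2 * ‖∇ (v p.1) p.2‖ ^ 2))
      ≤ 1 / 2 * (∫ x, expWeight α δ 1 B τ x * (damping α x * v τ x ^ 2)) + c * V / R := by
    linarith
  refine h3.trans ?_
  have h7 := mul_le_mul_of_nonneg_left h6 (show 0 ≤ 2 / (δ / 16) by positivity)
  refine le_trans (le_of_eq ?_) (h7.trans (le_of_eq ?_))
  · field_simp
  · field_simp

/-- The space-time integral of `(1+t)^{B+1} e^{2ψ} a v_t²`, given that of `(1+t)^B e^{2ψ}|∇v|²`. -/
theorem IsHeat.setIntegral_velocity_le (hv : IsHeat α τ v) (hα0 : 0 ≤ α) (hα1 : α ≤ 1)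
    (hδ : 0 < δ) (hτ : 0 ≤ τ) (hB : 0 ≤ B) {R₀ D : ℝ}
    (hv0 : ∀ x, R₀ < ‖x‖ → v τ x = 0) (hT : τ ≤ T)
    (hD : ∀ r, 0 < r → ∫ p in slab n τ T, logCutoff r p.2 ^ 2 *
      (expWeight α δ 1 B p.1 p.2 * ‖∇ (v p.1) p.2‖ ^ 2) ≤ D) (hr : 0 < r) :
    ∫ p in slab n τ T, logCutoff r p.2 ^ 2 *
        (expWeight α δ 1 (B + 1) p.1 p.2 * (damping α p.2 * dTime τ v p.1 p.2 ^ 2))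
      ≤ 2 * (∫ x, expWeight α δ 1 (B + 1) τ x * ‖∇ (v τ) x‖ ^ 2) + 2 * (B + 1) * D := by
  obtain ⟨M, hM, hMb⟩ := exists_gradient_logCutoff_bounds (α := α) n hα1
  have hs := hv.smooth
  have hE : ∀ q, SmoothFrom (n := n) τ (expWeight α δ 1 q) := fun q =>
    smoothFrom_expWeight hτ one_pos
  have hE0 : ∀ q t, τ ≤ t → ∀ x : Rn n, 0 < expWeight α δ 1 q t x := fun q t ht x =>
    expWeight_pos (by linarith) x
  have hEA : SmoothFrom τ fun t x => expWeight α δ 1 (B + 1) t x *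
      (damping α x * dTime τ v t x ^ 2) := (hE _).mul (smoothFrom_dampingSq hs.deriv_time)
  have hEg : ∀ q, SmoothFrom τ fun t x => expWeight α δ 1 q t x * ‖∇ (v t) x‖ ^ 2 := fun q =>
    (hE q).mul hs.norm_gradient_sq
  apply le_of_forall_le_add_div (r := max r 1) (c := 4 * (4 * M ^ 2 * (1 + T) * D))
  intro R hRr hR
  have hRr' : r ≤ R := (le_max_left _ _).trans hRr
  have hR1 : 1 ≤ R := (le_max_right _ _).trans hRr
  have h2R : 0 < 2 * R := by linarith
  have key := hv.integral_energy_le (T := T) (R := Real.exp (2 * (2 * R))) hT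
    (ρ₁ := fun t x => expWeight α δ 1 (B + 1) t x * logCutoff R x ^ 2)
    (ρ₂ := fun _ _ => 0) (ψ := fun _ _ => 0)
    (G := fun t x => (B + 1) / 2 * (logCutoff R x ^ 2 *
        (expWeight α δ 1 B t x * ‖∇ (v t) x‖ ^ 2))
      + 4 * ((M / R) ^ 2 * (1 + T)) * (logCutoff (2 * R) x ^ 2 *
        (expWeight α δ 1 B t x * ‖∇ (v t) x‖ ^ 2))
      - 1 / 4 * (logCutoff R x ^ 2 *
        (expWeight α δ 1 (B + 1) t x * (damping α x * dTime τ v t x ^ 2))))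
    ((hE _).mul (smoothFrom_logCutoff_sq R)) (.const 0) (.const 0)
    (((((smoothFrom_logCutoff_sq R).mul (hEg B)).const_mul _).add
      (((smoothFrom_logCutoff_sq (2 * R)).mul (hEg B)).const_mul _)).sub
      (((smoothFrom_logCutoff_sq R).mul hEA).const_mul _))
    (fun t _ x hx => ⟨by
      rw [logCutoff_vanish hR (lt_of_le_of_lt (Real.exp_le_exp.2 (by linarith)) hx)]; ring, rfl⟩)
    (fun t _ x hx => by
      rw [logCutoff_vanish hR (lt_of_le_of_lt (Real.exp_le_exp.2 (by linarith)) hx),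
        logCutoff_vanish h2R hx]; ring)
    (by
      intro t ht x
      have ht0 : 0 ≤ t := hτ.trans ht.1.le
      have ha := damping_pos α x
      have ha1 := damping_le_one hα0 x
      have hψ0 : 0 ≤ weightPsi α δ t x := weightPsi_nonneg hδ ht0 x
      have hd1 := dTime_expWeight_mul_sq (α := α) (δ := δ) (B := B + 1) hτ ht.1 (logCutoff R) x
      have hd2 := gradient_expWeight_mul_sq (α := α) (δ := δ) (B := B + 1) ht0
        ((contDiff_logCutoff R).differentiable (by simp) x)
      rw [hd1, hd2, dTime_const t ht.1 x]
      simp only [inner_add_left, real_inner_smul_left, gradient_fun_const, inner_zero_left,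
        inner_zero_right]
      have hXle : |inner ℝ (∇ (weightPsi α δ t) x) (∇ (v t) x)|
        ≤ ‖∇ (weightPsi α δ t) x‖ * ‖∇ (v t) x‖ := abs_real_inner_le_norm _ _
      have hYle : |inner ℝ (∇ (logCutoff R) x) (∇ (v t) x)|
        ≤ ‖∇ (logCutoff R) x‖ * ‖∇ (v t) x‖ := abs_real_inner_le_norm _ _
      have hc : ‖∇ (logCutoff R) x‖ ^ 2
          ≤ damping α x * ((M / R) ^ 2 * logCutoff (2 * R) x ^ 2) := by
        have h1 : ‖∇ (logCutoff R) x‖ ^ 2 ≤ (M / R * logCutoff (2 * R) x * damping α x) ^ 2 :=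
          pow_le_pow_left₀ (norm_nonneg _) (hMb R hR x).1 2
        have h2 : damping α x ^ 2 ≤ damping α x := by nlinarith
        calc _ ≤ damping α x ^ 2 * ((M / R) ^ 2 * logCutoff (2 * R) x ^ 2) := by linarith
          _ ≤ _ := by gcongr
      have hd := two_mul_norm_gradient_weightPsi_sq_le (α := α) (by linarith) hδ ht0 x
      have k := cutoff_velocity_dissipation (B := B + 1) (P := dTime τ v t x) (S := 1 + t) ha hd
        (logCutoff_nonneg R x) hXle hYle hc
      have hS : 0 < 1 + t := by linarith
      have hEq : expWeight α δ 1 (B + 1) t x = expWeight α δ 1 B t x * (1 + t) := by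
        rw [expWeight_add hS, Real.rpow_one]
      have hEB := hE0 B t ht.1.le x
      have k2 := mul_le_mul_of_nonneg_left k (hE0 (B + 1) t ht.1.le x).le
      have k3 : 4 * (M / R) ^ 2 * (logCutoff (2 * R) x ^ 2 *
          (expWeight α δ 1 B t x * ‖∇ (v t) x‖ ^ 2)) * (1 + t)
          ≤ 4 * (M / R) ^ 2 * (logCutoff (2 * R) x ^ 2 *
          (expWeight α δ 1 B t x * ‖∇ (v t) x‖ ^ 2)) * (1 + T) := by
        gcongr
        exact ht.2.le
      have k4 : expWeight α δ 1 (B + 1) t x *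
          ((B + 1) / 2 * (logCutoff R x ^ 2 * ‖∇ (v t) x‖ ^ 2 / (1 + t)))
          = (B + 1) / 2 * (logCutoff R x ^ 2 *
            (expWeight α δ 1 B t x * ‖∇ (v t) x‖ ^ 2)) := by
        rw [hEq]
        field_simp
      have k5 : expWeight α δ 1 (B + 1) t x *
          (4 * ((M / R) ^ 2 * logCutoff (2 * R) x ^ 2 * ‖∇ (v t) x‖ ^ 2))
          = 4 * (M / R) ^ 2 * (logCutoff (2 * R) x ^ 2 *
          (expWeight α δ 1 B t x * ‖∇ (v t) x‖ ^ 2)) * (1 + t) := by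
        rw [hEq]
        ring
      rw [mul_add (expWeight α δ 1 (B + 1) t x), mul_sub (expWeight α δ 1 (B + 1) t x)
        ((B + 1) / 2 * _), k4, k5] at k2
      refine le_trans (le_of_eq ?_) (k2.trans ?_)
      · ring
      · refine le_trans (add_le_add_right k3 _) (le_of_eq ?_)
        ring)
  have i1 := ((hEg B).integrableOn_logCutoff_sq_mul (T := T) hR).const_mul ((B + 1) / 2)
  have i2 := ((hEg B).integrableOn_logCutoff_sq_mul (T := T) h2R).const_mul
    (4 * ((M / R) ^ 2 * (1 + T)))
  rw [integral_sub (i1.fun_add i2) ((hEA.integrableOn_logCutoff_sq_mul hR).const_mul _),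
    integral_add i1 i2, integral_const_mul, integral_const_mul, integral_const_mul] at key
  have e1 : ∀ t, ∫ x, (1 / 2 * (expWeight α δ 1 (B + 1) t x * logCutoff R x ^ 2) *
      ‖∇ (v t) x‖ ^ 2 + 1 / 2 * (0 : ℝ) * (damping α x * v t x ^ 2))
      = 1 / 2 * ∫ x, logCutoff R x ^ 2 * (expWeight α δ 1 (B + 1) t x * ‖∇ (v t) x‖ ^ 2) :=
    fun t => by
      rw [← integral_const_mul]
      refine integral_congr_ae (Filter.Eventually.of_forall fun x => ?_)
      simp only
      ring
  simp only [e1] at key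
  have h1 : 0 ≤ ∫ x, logCutoff R x ^ 2 * (expWeight α δ 1 (B + 1) T x * ‖∇ (v T) x‖ ^ 2) :=
    integral_nonneg fun x => mul_nonneg (sq_nonneg _)
      (mul_nonneg (hE0 _ T hT x).le (sq_nonneg _))
  have h2 : ∫ x, logCutoff R x ^ 2 * (expWeight α δ 1 (B + 1) τ x * ‖∇ (v τ) x‖ ^ 2)
      ≤ ∫ x, expWeight α δ 1 (B + 1) τ x * ‖∇ (v τ) x‖ ^ 2 := by
    have hc := ((hEg (B + 1)).contDiff_slice le_rfl).continuous
    refine integral_mono (integrable_logCutoff_sq_mul hc hR) (integrable_of_vanish (R := R₀)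
      hc fun x hx => by simp [gradient_eq_zero_of_vanish hv0 hx]) fun x => ?_
    exact logCutoff_sq_mul_le (mul_nonneg (hE0 _ τ le_rfl x).le (sq_nonneg _)) x
  have h3 := hEA.setIntegral_logCutoff_mono (T := T) (fun t ht x =>
    mul_nonneg (hE0 _ t ht.1.le x).le (mul_nonneg (damping_pos α x).le (sq_nonneg _))) hr hRr'
  have h4 : 4 * ((M / R) ^ 2 * (1 + T)) * (∫ p in slab n τ T,
      logCutoff (2 * R) p.2 ^ 2 * (expWeight α δ 1 B p.1 p.2 * ‖∇ (v p.1) p.2‖ ^ 2))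
      ≤ 4 * M ^ 2 * (1 + T) * D / R := by
    have hI0 : 0 ≤ ∫ p in slab n τ T, logCutoff (2 * R) p.2 ^ 2 *
        (expWeight α δ 1 B p.1 p.2 * ‖∇ (v p.1) p.2‖ ^ 2) :=
      setIntegral_slab_nonneg (F := fun t x => logCutoff (2 * R) x ^ 2 *
        (expWeight α δ 1 B t x * ‖∇ (v t) x‖ ^ 2)) fun t ht x =>
        mul_nonneg (sq_nonneg _) (mul_nonneg (hE0 _ t ht.1.le x).le (sq_nonneg _))
    have hT1 : 0 ≤ 1 + T := by linarith
    have h5 : (M / R) ^ 2 ≤ M ^ 2 / R := by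
      rw [div_pow]
      apply div_le_div_of_nonneg_left (by positivity) hR
      nlinarith
    calc _ ≤ 4 * (M ^ 2 / R * (1 + T)) * D := by
          refine mul_le_mul ?_ (hD _ h2R) hI0 (by positivity)
          gcongr
      _ = _ := by ring
  have h5 := mul_le_mul_of_nonneg_left (hD R hR) (show 0 ≤ (B + 1) / 2 by linarith)
  refine h3.trans ?_
  rw [mul_div_assoc 4]
  linarith

/-- The decay of `∫ a v_t²` in terms of the space-time integral of `(1+t)^{B+1} e^{2ψ} a v_t²`:
the multiplier is `(1+t-τ)^{B+2} v_t`, applied to the equation for `v_t`. -/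
theorem IsHeat.velocity_decay (hv : IsHeat α τ v) (hα0 : 0 ≤ α) (hα1 : α ≤ 1)
    (hδ : 0 < δ) (hτ : 0 ≤ τ) (hB : 0 ≤ B) {R₀ D : ℝ}
    (hv0 : ∀ x, R₀ < ‖x‖ → v τ x = 0) (hT : τ ≤ T)
    (hD : ∀ r, 0 < r → ∫ p in slab n τ T, logCutoff r p.2 ^ 2 *
        (expWeight α δ 1 (B + 1) p.1 p.2 * (damping α p.2 * dTime τ v p.1 p.2 ^ 2)) ≤ D) :
    Integrable (fun x => damping α x * dTime τ v T x ^ 2) ∧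
      (1 + T - τ) ^ (B + 2) * ∫ x, damping α x * dTime τ v T x ^ 2
        ≤ (∫ x, (damping α x)⁻¹ * (Δ (v τ)) x ^ 2) + (B + 2) * D := by
  obtain ⟨M, hM, hMb⟩ := exists_gradient_logCutoff_bounds (α := α) n hα1
  set w := dTime τ v with hw
  have hwH : IsHeat α τ w := hv.deriv_time
  have hs := hwH.smooth
  have hA : SmoothFrom τ fun t x => damping α x * w t x ^ 2 := smoothFrom_dampingSq hs
  have hA0 : ∀ t x, 0 ≤ damping α x * w t x ^ 2 := fun t x =>
    mul_nonneg (damping_pos α x).le (sq_nonneg _)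
  have hE : SmoothFrom (n := n) τ (expWeight α δ 1 (B + 1)) := smoothFrom_expWeight hτ one_pos
  have hE0 : ∀ t, τ ≤ t → ∀ x : Rn n, 0 < expWeight α δ 1 (B + 1) t x := fun t ht x =>
    expWeight_pos (by linarith) x
  have hEA : SmoothFrom τ fun t x => expWeight α δ 1 (B + 1) t x * (damping α x * w t x ^ 2) :=
    hE.mul hA
  have hσ : SmoothFrom (n := n) τ fun t _ => (1 + t - τ) ^ (B + 2) :=
    SmoothFrom.of_time (ContDiffOn.rpow_const_of_ne (by fun_prop) fun t ht => by
      have : τ ≤ t := ht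
      linarith)
  have hinit : ∀ x, damping α x * w τ x ^ 2 = (damping α x)⁻¹ * (Δ (v τ)) x ^ 2 := fun x => by
    have := damping_pos α x
    rw [← hv.equation_initial x, ← hw]
    field_simp
  -- By the equation at time `τ`, `v_t(τ)` is compactly supported like `v(τ)`.
  have hw0 : ∀ x, R₀ < ‖x‖ → w τ x = 0 := fun x hx => by
    have h1 := hv.equation_initial x
    have h2 : (Δ (v τ)) x = 0 := by
      have h3 : v τ =ᶠ[nhds x] fun _ => 0 := by
        filter_upwards [(isOpen_lt continuous_const continuous_norm).mem_nhds hx] with y hy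
        exact hv0 y hy
      rw [InnerProductSpace.laplacian_congr_nhds h3 |>.self_of_nhds]
      simp
    rw [h2] at h1
    exact (mul_eq_zero.1 h1).resolve_left (damping_pos α x).ne'
  have hpos : 0 < (1 + T - τ) ^ (B + 2) := Real.rpow_pos_of_pos (by linarith) _
  have main : ∀ r, 0 < r → ∫ x, logCutoff r x ^ 2 * (damping α x * w T x ^ 2)
      ≤ ((1 + T - τ) ^ (B + 2))⁻¹ *
        ((∫ x, (damping α x)⁻¹ * (Δ (v τ)) x ^ 2) + (B + 2) * D) := by
    intro r hr
    rw [inv_mul_eq_div, le_div_iff₀ hpos, mul_comm]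
    apply le_of_forall_le_add_div (r := max r 1) (c := 2 * (M ^ 2 * (1 + T) * D))
    intro R hRr hR
    have hRr' : r ≤ R := (le_max_left _ _).trans hRr
    have hR1 : 1 ≤ R := (le_max_right _ _).trans hRr
    have h2R : 0 < 2 * R := by linarith
    have key := hwH.integral_energy_le (T := T) (R := Real.exp (2 * (2 * R))) hT
      (ρ₁ := fun _ _ => 0) (ρ₂ := fun t x => (1 + t - τ) ^ (B + 2) * logCutoff R x ^ 2)
      (ψ := fun _ _ => 0)
      (G := fun t x => (B + 2) / 2 * (logCutoff R x ^ 2 *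
          (expWeight α δ 1 (B + 1) t x * (damping α x * w t x ^ 2)))
        + (M / R) ^ 2 * (1 + T) * (logCutoff (2 * R) x ^ 2 *
          (expWeight α δ 1 (B + 1) t x * (damping α x * w t x ^ 2))))
      (.const 0) (hσ.mul (smoothFrom_logCutoff_sq R)) (.const 0)
      ((((smoothFrom_logCutoff_sq R).mul hEA).const_mul _).add
        (((smoothFrom_logCutoff_sq (2 * R)).mul hEA).const_mul _))
      (fun t _ x hx => ⟨rfl, by
        rw [logCutoff_vanish hR (lt_of_le_of_lt (Real.exp_le_exp.2 (by linarith)) hx)]; ring⟩)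
      (fun t _ x hx => by
        rw [logCutoff_vanish hR (lt_of_le_of_lt (Real.exp_le_exp.2 (by linarith)) hx),
          logCutoff_vanish h2R hx]; ring)
      (by
        intro t ht x
        have ht0 : 0 ≤ t := hτ.trans ht.1.le
        have hσ0 : 0 < 1 + t - τ := by linarith [ht.1]
        have ha := damping_pos α x
        have ha1 := damping_le_one hα0 x
        have d1 : dTime τ (fun t (x : Rn n) => (1 + t - τ) ^ (B + 2) * logCutoff R x ^ 2) t x
            = (B + 2) * (1 + t - τ) ^ (B + 1) * logCutoff R x ^ 2 := by
          apply SmoothFrom.dTime_eq_of_hasDerivAt ht.1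
          have h1 : HasDerivAt (fun s : ℝ => 1 + s - τ) 1 t :=
            ((hasDerivAt_id t).const_add 1).sub_const τ
          have h2 := (h1.rpow_const (p := B + 2) (Or.inl hσ0.ne')).mul_const (logCutoff R x ^ 2)
          refine h2.congr_deriv ?_
          rw [show B + 2 - 1 = B + 1 by ring]
          ring
        have d2 : ∇ (fun x : Rn n => (1 + t - τ) ^ (B + 2) * logCutoff R x ^ 2) x
            = ((1 + t - τ) ^ (B + 2) * (2 * logCutoff R x)) • ∇ (logCutoff R) x := by
          have h2 : HasDerivAt (fun s : ℝ => (1 + t - τ) ^ (B + 2) * s ^ 2)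
              ((1 + t - τ) ^ (B + 2) * (2 * logCutoff R x)) (logCutoff R x) := by
            simpa using (hasDerivAt_pow 2 (logCutoff R x)).const_mul ((1 + t - τ) ^ (B + 2))
          exact gradient_comp h2 ((contDiff_logCutoff R).differentiable (by simp) x)
        have e1 : (1 + t - τ) ^ (B + 2) = (1 + t - τ) ^ (B + 1) * (1 + t - τ) := by
          rw [show B + 2 = B + 1 + 1 by ring, Real.rpow_add_one hσ0.ne']
        have hσE : (1 + t - τ) ^ (B + 1) ≤ expWeight α δ 1 (B + 1) t x := by
          have h1 : (1 + t - τ) ^ (B + 1) ≤ (1 + t) ^ (B + 1) :=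
            Real.rpow_le_rpow hσ0.le (by linarith) (by linarith)
          have h2 : 1 ≤ Real.exp (2 * weightPsi α δ t x) :=
            Real.one_le_exp (by linarith [weightPsi_nonneg (α := α) hδ ht0 x])
          exact h1.trans (le_mul_of_one_le_right (Real.rpow_nonneg (by linarith) _) h2)
        have hσ1 : 0 < (1 + t - τ) ^ (B + 1) := Real.rpow_pos_of_pos hσ0 _
        have hYle : |inner ℝ (∇ (logCutoff R) x) (∇ (w t) x)|
          ≤ ‖∇ (logCutoff R) x‖ * ‖∇ (w t) x‖ := abs_real_inner_le_norm _ _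
        have h₁ := sq_mul_le_of_le_mul_mul (s := w t x) (norm_nonneg _) (hMb R hR x).1 ha.le ha1
        rw [d1, d2, dTime_const t ht.1 x]
        simp only [real_inner_smul_left, gradient_fun_const, inner_zero_left,
          inner_zero_right, InnerProductSpace.laplacian_const, Pi.zero_apply]
        set Y := inner ℝ (∇ (logCutoff R) x) (∇ (w t) x) with hY
        have k : -(2 * (logCutoff R x * (w t x * Y))) ≤ logCutoff R x ^ 2 * ‖∇ (w t) x‖ ^ 2
            + ‖∇ (logCutoff R) x‖ ^ 2 * w t x ^ 2 := by
          have h1 : |logCutoff R x * (w t x * Y)|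
              ≤ logCutoff R x * (|w t x| * (‖∇ (logCutoff R) x‖ * ‖∇ (w t) x‖)) := by
            rw [abs_mul, abs_mul, abs_of_nonneg (logCutoff_nonneg R x)]
            have := logCutoff_nonneg R x
            gcongr
          have h2 := neg_abs_le (logCutoff R x * (w t x * Y))
          have h3 := sq_nonneg (logCutoff R x * ‖∇ (w t) x‖ - ‖∇ (logCutoff R) x‖ * |w t x|)
          have h4 : (‖∇ (logCutoff R) x‖ * |w t x|) ^ 2
              = ‖∇ (logCutoff R) x‖ ^ 2 * w t x ^ 2 := by rw [mul_pow, sq_abs]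
          rw [sub_sq, h4] at h3
          linarith
        have k1 := mul_le_mul_of_nonneg_left (k.trans (add_le_add_right h₁ _))
          (Real.rpow_nonneg hσ0.le (B + 2))
        have k2 : (B + 2) / 2 * (logCutoff R x ^ 2 *
            ((1 + t - τ) ^ (B + 1) * (damping α x * w t x ^ 2))) ≤ (B + 2) / 2 *
            (logCutoff R x ^ 2 * (expWeight α δ 1 (B + 1) t x * (damping α x * w t x ^ 2))) := by
          gcongr
        have k3 : (1 + t - τ) ^ (B + 2) *
            ((M / R) ^ 2 * (logCutoff (2 * R) x ^ 2 * (damping α x * w t x ^ 2)))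
            ≤ (M / R) ^ 2 * (1 + T) * (logCutoff (2 * R) x ^ 2 *
              (expWeight α δ 1 (B + 1) t x * (damping α x * w t x ^ 2))) := by
          have hEt := hE0 t ht.1.le x
          have h5 : (1 + t - τ) ^ (B + 2) ≤ expWeight α δ 1 (B + 1) t x * (1 + T) := by
            rw [e1]
            exact mul_le_mul hσE (by linarith [ht.2]) hσ0.le hEt.le
          calc _ ≤ expWeight α δ 1 (B + 1) t x * (1 + T) *
                ((M / R) ^ 2 * (logCutoff (2 * R) x ^ 2 * (damping α x * w t x ^ 2))) := by
                gcongr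
            _ = _ := by ring
        have k4 : (1 + t - τ) ^ (B + 2) * (-(2 * (logCutoff R x * (w t x * Y)))
            - logCutoff R x ^ 2 * ‖∇ (w t) x‖ ^ 2) ≤ (1 + t - τ) ^ (B + 2) *
            ((M / R) ^ 2 * (logCutoff (2 * R) x ^ 2 * (damping α x * w t x ^ 2))) := by
          rw [mul_add] at k1
          rw [mul_sub]
          linarith
        refine le_trans (le_of_eq ?_) (add_le_add k2 (k4.trans k3))
        ring)
    rw [integral_add ((hEA.integrableOn_logCutoff_sq_mul hR).const_mul _)
      ((hEA.integrableOn_logCutoff_sq_mul h2R).const_mul _), integral_const_mul,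
      integral_const_mul] at key
    have e1 : ∀ t, ∫ x, (1 / 2 * (0 : ℝ) * ‖∇ (w t) x‖ ^ 2 + 1 / 2 * ((1 + t - τ) ^ (B + 2) *
        logCutoff R x ^ 2) * (damping α x * w t x ^ 2))
        = 1 / 2 * ((1 + t - τ) ^ (B + 2) *
          ∫ x, logCutoff R x ^ 2 * (damping α x * w t x ^ 2)) := fun t => by
      rw [← integral_const_mul, ← integral_const_mul]
      refine integral_congr_ae (Filter.Eventually.of_forall fun x => ?_)
      simp only
      ring
    simp only [e1] at key
    rw [show 1 + τ - τ = 1 by ring, Real.one_rpow, one_mul] at key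
    have hcT := (hA.contDiff_slice hT).continuous
    have hcτ := (hA.contDiff_slice le_rfl).continuous
    have h1 : ∫ x, logCutoff r x ^ 2 * (damping α x * w T x ^ 2)
        ≤ ∫ x, logCutoff R x ^ 2 * (damping α x * w T x ^ 2) :=
      integral_mono (integrable_logCutoff_sq_mul hcT hr) (integrable_logCutoff_sq_mul hcT hR)
        fun x => mul_le_mul_of_nonneg_right (logCutoff_sq_mono hr hRr' x) (hA0 T x)
    have h2 : ∫ x, logCutoff R x ^ 2 * (damping α x * w τ x ^ 2)
        ≤ ∫ x, (damping α x)⁻¹ * (Δ (v τ)) x ^ 2 := by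
      simp only [← hinit]
      exact integral_mono (integrable_logCutoff_sq_mul hcτ hR) (integrable_of_vanish (R := R₀)
        hcτ fun x hx => by simp [hw0 x hx]) fun x => logCutoff_sq_mul_le (hA0 τ x) x
    have h3 := mul_le_mul_of_nonneg_left h1 hpos.le
    have hD0 : 0 ≤ D := le_trans (setIntegral_slab_nonneg (F := fun t x => logCutoff R x ^ 2 *
        (expWeight α δ 1 (B + 1) t x * (damping α x * w t x ^ 2))) fun t ht x =>
        mul_nonneg (sq_nonneg _) (mul_nonneg (hE0 t ht.1.le x).le (hA0 t x))) (hD R hR)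
    have hT1 : 0 ≤ 1 + T := by linarith
    have h4 := mul_le_mul_of_nonneg_left (hD _ h2R)
      (show 0 ≤ (M / R) ^ 2 * (1 + T) by positivity)
    have h5 : (M / R) ^ 2 * (1 + T) * D ≤ M ^ 2 * (1 + T) * D / R := by
      have h6 : (M / R) ^ 2 ≤ M ^ 2 / R := by
        rw [div_pow]
        apply div_le_div_of_nonneg_left (by positivity) hR
        nlinarith
      calc _ ≤ M ^ 2 / R * (1 + T) * D := by gcongr
        _ = _ := by ring
    have h6 := mul_le_mul_of_nonneg_left (hD R hR) (show 0 ≤ (B + 2) / 2 by linarith)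
    rw [mul_div_assoc 2]
    linarith
  obtain ⟨hi, hle⟩ := integrable_and_integral_le_of_logCutoff
    (hA.contDiff_slice hT).continuous (hA0 T) main
  refine ⟨hi, ?_⟩
  rwa [inv_mul_eq_div, le_div_iff₀ hpos, mul_comm] at hle

end HeatDecay

/-! ### Choice of `δ` and the decay rates -/

section HeatSolution

variable {n : ℕ} {α δ τ : ℝ} {vτ : Rn n → ℝ} {v : ℝ → Rn n → ℝ}

theorem IsHeatSolution.isHeat (h : IsHeatSolution α τ vτ v) : IsHeat α τ v where
  smooth := h.smooth
  equation t ht x := by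
    have := h.equation t ht x
    rw [timeDeriv_one] at this
    linarith

/-- The heat part of the theorem, in terms of `B = (n-α)/(2-α) - ε`. -/
theorem exists_heat_decay (hα0 : 0 ≤ α) (hα1 : α < 1) (hδ : 0 < δ) (hδ1 : δ ≤ 1) {B : ℝ}
    (hB : 0 ≤ B) (hBβ : B / 2 < (n - α) / ((2 - α) * (2 + δ))) :
    ∃ C : ℝ, 0 < C ∧ ∀ (τ : ℝ) (vτ : Rn n → ℝ) (v : ℝ → Rn n → ℝ), 0 ≤ τ →
      HasCompactSupport vτ → IsHeatSolution α τ vτ v → ∀ t : ℝ, τ ≤ t →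
        (Integrable (fun x : Rn n => damping α x * v t x ^ 2) ∧
          ∫ x : Rn n, damping α x * v t x ^ 2 ≤ ∫ x : Rn n, damping α x * vτ x ^ 2) ∧
        (Integrable (fun x : Rn n => damping α x * timeDeriv τ 1 v t x ^ 2) ∧
          (1 + t - τ) ^ (B + 2) * ∫ x : Rn n, damping α x * timeDeriv τ 1 v t x ^ 2
          ≤ (∫ x : Rn n, (damping α x)⁻¹ * (Δ vτ) x ^ 2) +
            C * (1 + τ) ^ (B + 1) *
              (∫ x : Rn n, Real.exp (2 * weightPsi α δ τ x) * ‖∇ vτ x‖ ^ 2) +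
            C * (1 + τ) ^ B *
              (∫ x : Rn n, Real.exp (2 * weightPsi α δ τ x) * (damping α x * vτ x ^ 2))) := by
  refine ⟨(B + 2) * (2 + 2 * (B + 1) * (16 / δ)), by positivity, ?_⟩
  intro τ vτ v hτ hsupp h t ht
  have hv := h.isHeat
  obtain rfl : v τ = vτ := funext h.initial_value
  obtain ⟨R₀, hR₀⟩ := (hsupp.isCompact.isBounded).subset_closedBall (0 : Rn n)
  have hv0 : ∀ x, R₀ < ‖x‖ → v τ x = 0 := fun x hx => by
    by_contra hne
    have := hR₀ (subset_tsupport _ hne)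
    rw [mem_closedBall_zero_iff] at this
    linarith
  have hfin : ∀ T, IntegrableOn (fun p : ℝ × Rn n => damping α p.2 * v p.1 p.2 ^ 2)
      (slab n τ T) := fun T =>
    (h.finite_energy T).mono_set (prod_mono_left Ioo_subset_Icc_self)
  refine ⟨hv.integrable_and_integral_le hα0 hα1.le hv0 (hfin t) ht, ?_⟩
  rw [timeDeriv_one]
  have hD := fun r (hr : (0 : ℝ) < r) => hv.setIntegral_gradient_le hα0 hα1.le hδ hδ1 hτ hB hBβ.le
    hv0 ht (fun s hs r hr => hv.cutoff_integral_exp_le hα0 hα1.le hδ hτ hv0 (hfin s) hs.1.le hr) hr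
  have hD2 := fun r (hr : (0 : ℝ) < r) => hv.setIntegral_velocity_le hα0 hα1.le hδ hτ hB hv0 ht
    hD hr
  obtain ⟨hi, hle⟩ := hv.velocity_decay hα0 hα1.le hδ hτ hB hv0 ht hD2
  refine ⟨hi, hle.trans ?_⟩
  rw [← rpow_mul_integral_eq, ← rpow_mul_integral_eq]
  have hG : 0 ≤ (1 + τ) ^ (B + 1) *
      ∫ x : Rn n, Real.exp (2 * weightPsi α δ τ x) * ‖∇ (v τ) x‖ ^ 2 :=
    mul_nonneg (Real.rpow_nonneg (by linarith) _) (integral_nonneg fun x => by positivity)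
  have hM : 0 ≤ (1 + τ) ^ B *
      ∫ x : Rn n, Real.exp (2 * weightPsi α δ τ x) * (damping α x * v τ x ^ 2) :=
    mul_nonneg (Real.rpow_nonneg (by linarith) _) (integral_nonneg fun x => by
      have := damping_pos α x
      positivity)
  have c1 : 0 ≤ (B + 2) * (2 * (B + 1) * (16 / δ)) := by positivity
  have c2 : 0 ≤ (B + 2) * 2 := by positivity
  have k1 := mul_nonneg c1 hG
  have k2 := mul_nonneg c2 hM
  linarith

end HeatSolution

theorem lemma1p3 (n : ℕ) (hn : 1 ≤ n) (α : ℝ) (hα0 : 0 ≤ α) (hα1 : α < 1) :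
    ∃ ε₀ : ℝ, 0 < ε₀ ∧ ∀ ε : ℝ, 0 < ε → ε < ε₀ → ∃ δ : ℝ, 0 < δ ∧
      -- part (i)
      (∀ L : ℝ, 0 < L → ∃ C : ℝ, 0 < C ∧
        ∀ (u₀ u₁ : Rn n → ℝ) (u : ℝ → Rn n → ℝ),
          ContDiff ℝ ∞ u₀ → ContDiff ℝ ∞ u₁ →
          tsupport u₀ ⊆ Metric.closedBall 0 L → tsupport u₁ ⊆ Metric.closedBall 0 L →
          IsDampedWaveSolution α u₀ u₁ u →
          ∀ t : ℝ, 0 ≤ t →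
            (Integrable (fun x : Rn n =>
                Real.exp (2 * weightPsi α δ t x) * damping α x * timeDeriv 0 1 u t x ^ 2) ∧
              (1 + t) ^ ((n - α) / (2 - α) + 2 - ε) *
                ∫ x : Rn n,
                  Real.exp (2 * weightPsi α δ t x) * damping α x * timeDeriv 0 1 u t x ^ 2
              ≤ C * dataNorm α δ u₀ u₁ u 1) ∧
            (Integrable (fun x : Rn n =>
                Real.exp (2 * weightPsi α δ t x) * ‖∇ (timeDeriv 0 1 u t) x‖ ^ 2) ∧
              (1 + t) ^ ((n - α) / (2 - α) + 3 - ε) *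
                ∫ x : Rn n,
                  Real.exp (2 * weightPsi α δ t x) * ‖∇ (timeDeriv 0 1 u t) x‖ ^ 2
              ≤ C * dataNorm α δ u₀ u₁ u 1) ∧
            (Integrable (fun x : Rn n =>
                Real.exp (2 * weightPsi α δ t x) * damping α x * timeDeriv 0 2 u t x ^ 2) ∧
              (1 + t) ^ ((n - α) / (2 - α) + 4 - ε) *
                ∫ x : Rn n,
                  Real.exp (2 * weightPsi α δ t x) * damping α x * timeDeriv 0 2 u t x ^ 2
              ≤ C * dataNorm α δ u₀ u₁ u 2) ∧
            (Integrable (fun x : Rn n =>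
                Real.exp (2 * weightPsi α δ t x) * damping α x * timeDeriv 0 3 u t x ^ 2) ∧
              (1 + t) ^ ((n - α) / (2 - α) + 6 - ε) *
                ∫ x : Rn n,
                  Real.exp (2 * weightPsi α δ t x) * damping α x * timeDeriv 0 3 u t x ^ 2
              ≤ C * dataNorm α δ u₀ u₁ u 3)) ∧
      -- part (ii)
      (∃ C : ℝ, 0 < C ∧
        ∀ (τ : ℝ) (vτ : Rn n → ℝ) (v : ℝ → Rn n → ℝ), 0 ≤ τ →
          ContDiff ℝ ∞ vτ → HasCompactSupport vτ → IsHeatSolution α τ vτ v →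
          ∀ t : ℝ, τ ≤ t →
            (Integrable (fun x : Rn n => damping α x * v t x ^ 2) ∧
              ∫ x : Rn n, damping α x * v t x ^ 2 ≤ ∫ x : Rn n, damping α x * vτ x ^ 2) ∧
            (Integrable (fun x : Rn n => damping α x * timeDeriv τ 1 v t x ^ 2) ∧
              (1 + t - τ) ^ ((n - α) / (2 - α) + 2 - ε) *
                ∫ x : Rn n, damping α x * timeDeriv τ 1 v t x ^ 2
              ≤ (∫ x : Rn n, (damping α x)⁻¹ * (Δ vτ) x ^ 2) +
                C * (1 + τ) ^ ((n - α) / (2 - α) + 1 - ε) *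
                  (∫ x : Rn n, Real.exp (2 * weightPsi α δ τ x) * ‖∇ vτ x‖ ^ 2) +
                C * (1 + τ) ^ ((n - α) / (2 - α) - ε) *
                  (∫ x : Rn n,
                    Real.exp (2 * weightPsi α δ τ x) * damping α x * vτ x ^ 2))) := by
  have hn' : (1 : ℝ) ≤ n := by exact_mod_cast hn
  have hα2 : 0 < 2 - α := by linarith
  set N : ℝ := (n - α) / (2 - α) with hN
  have hN0 : 0 < N := div_pos (by linarith) hα2
  refine ⟨N, hN0, fun ε hε hεN => ?_⟩
  have hδ : 0 < ε / N := div_pos hε hN0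
  have hδ1 : ε / N ≤ 1 := (div_le_one hN0).2 hεN.le
  have hB : 0 ≤ N - ε := by linarith
  -- `1/(2+δ) ≥ 1/2 - δ/4`, and `δ = ε/N` makes the loss `Nδ/4 = ε/4` smaller than `ε/2`
  have hBβ : (N - ε) / 2 < (n - α) / ((2 - α) * (2 + ε / N)) := by
    rw [← div_div, ← hN, div_lt_div_iff₀ two_pos (by linarith)]
    have h1 : N * (ε / N) = ε := by field_simp
    have h2 := mul_pos hε hδ
    linarith [show (N - ε) * (2 + ε / N) = 2 * N - 2 * ε + N * (ε / N) - ε * (ε / N) by ring]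
  have e : ∀ k : ℝ, N + k - ε = N - ε + k := fun k => by ring
  simp only [e, mul_assoc (Real.exp _) (damping _ _)]
  refine ⟨ε / N, hδ, fun L hL => ?_, ?_⟩
  · obtain ⟨C, hC, h⟩ := exists_wave_decay hn hα0 hα1 hδ hδ1 hL hB hBβ
    refine ⟨C, hC, fun u₀ u₁ u _ _ hs₀ hs₁ hu t ht => ?_⟩
    obtain ⟨h1, h2, h3, h4⟩ := h u₀ u₁ u hs₀ hs₁ hu t ht
    have hi := fun k => hu.integrable (δ := ε / N) (hu.supportedInCone hs₀ hs₁) k ht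
    exact ⟨⟨(hi 1).1, h1⟩, ⟨(hi 1).2, h2⟩, ⟨(hi 2).1, h3⟩, ⟨(hi 3).1, h4⟩⟩
  · obtain ⟨C, hC, h⟩ := exists_heat_decay (n := n) hα0 hα1 hδ hδ1 hB hBβ
    exact ⟨C, hC, fun τ vτ v hτ _ => h τ vτ v hτ⟩
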